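/- Conventions. Let $S$ be a scheme. Vector bundles and line bundles on $S$ are locally free $\mathcal O_S$-modules of finite rank, respectively of rank one. A quadratic form $(E,q,L)$ on $S$ consists of a vector bundle $E$, a line bundle $L$ and a morphism of sheaves $q:E\to L$ with $q(rv)=r^2q(v)$ on sections and such that $b_q(v,w)=q(v+w)-q(v)-q(w)$ is $\mathcal O_S$-bilinear. It is regular at a point $y$ if the map $\psi_q:E\to\mathcal Hom(E,L)$ given by $b_q$ is an isomorphism on stalks at $y$; it is (semi)regular at $y$ if it is regular at $y$, or has odd rank at $y$ and its half-discriminant is a unit at $y$; it is generically (semi)regular if it is (semi)regular at the generic point of every irreducible component of $S$. An isotropic subbundle is a monomorphism $g:N\to E$ of vector bundles with locally free quotient $E/N$ and $q\circ g=0$. It is regular if for every point $y$ of $S$ the subspace $N(y)$ of the fibre $E(y)=E_y\otimes\kappa(y)$ meets the radical of the bilinear form $b_q(y)$ only in $0$. Write $N^\perp$ for the kernel of $E\to\mathcal Hom(N,L)$, $v\mapsto b_q(v,g(\cdot))$, and $q':N^\perp/N\to L$ for the form induced by $q|_{N^\perp}$. For a vector bundle $P$ and a line bundle $L$, $H_L(P)$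 is the form $(v,f)\mapsto f(v)$ on $P\oplus\mathcal Hom(P,L)$. A Zariski-locally trivial affine bundle is a morphism $p:V\to S$ such that every point of $S$ has an open neighbourhood $U$ with $p^{-1}(U)\cong\mathbb A^n_U$ over $U$ for some $n\ge 0$. Theorem. Let $(E,q,L)$ be a generically (semi)regular quadratic form on a scheme $S$ and let $g:N\to E$ be a regular isotropic subbundle. Then $N^\perp/N$ is a vector bundle, so that $(N^\perp/N,q',L)$ is a quadratic form on $S$, and there is a Zariski-locally trivial affine bundle $p:V\to S$ with an isometry of quadratic forms on $V$ $$p^*(E,q,L)\;\cong\;H_{p^*L}(p^*N)\perp p^*(N^\perp/N,q',L).$$ In particular, there is a Zariski open covering of $S$ such that for each member $U$ of the covering $$(E,q,L)|_U\;\cong\;H_{L|_U}(N|_U)\perp(N^\perp/N,q',L)|_U.$$ -/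

import Mathlib

universe u
open CategoryTheory Limits AlgebraicGeometry TopologicalSpace Opposite

noncomputable section
namespace SplitPrinciple

variable {S : Scheme.{u}}

/-- Restriction of functions. -/
def fres {U V : S.Opens} (h : V ≤ U) : Γ(S, U) →+* Γ(S, V) :=
  (S.presheaf.map (homOfLE h).op).hom

/-- Restriction of sections of an `𝒪_S`-module. -/
def res (M : S.Modules) {U V : S.Opens} (h : V ≤ U) : Γ(M, U) →+ Γ(M, V) :=
  (M.presheaf.map (homOfLE h).op).hom

lemma res_smul (M : S.Modules) {U V : S.Opens} (h : V ≤ U) (r : Γ(S, U)) (x : Γ(M, U)) :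
    res M h (r • x) = fres h r • res M h x :=
  Scheme.Modules.map_smul M (homOfLE h) r x

lemma res_res (M : S.Modules) {U V W : S.Opens} (h : V ≤ U) (h' : W ≤ V) (x : Γ(M, U)) :
    res M h' (res M h x) = res M (h'.trans h) x := by
  change (M.presheaf.map _ ≫ M.presheaf.map _).hom x = _
  rw [← M.presheaf.map_comp]; rfl

lemma res_self (M : S.Modules) {U : S.Opens} (h : U ≤ U) (x : Γ(M, U)) :
    res M h x = x := by
  change (M.presheaf.map (𝟙 _)).hom x = _
  rw [M.presheaf.map_id]; rfl

lemma fres_fres {U V W : S.Opens} (h : V ≤ U) (h' : W ≤ V) (x : Γ(S, U)) :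
    fres h' (fres h x) = fres (h'.trans h) x := by
  change (S.presheaf.map _ ≫ S.presheaf.map _).hom x = _
  rw [← S.presheaf.map_comp]; rfl

lemma fres_self {U : S.Opens} (h : U ≤ U) (x : Γ(S, U)) : fres h x = x := by
  change (S.presheaf.map (𝟙 _)).hom x = _
  rw [S.presheaf.map_id]; rfl

/-- A morphism of `𝒪_S`-modules on sections, as a linear map. -/
def appₗ {M N : S.Modules} (φ : M ⟶ N) (U : S.Opens) : Γ(M, U) →ₗ[Γ(S, U)] Γ(N, U) where
  toFun := φ.app U
  map_add' := map_add (φ.app U).hom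
  map_smul' := φ.app_smul

lemma appₗ_res {M N : S.Modules} (φ : M ⟶ N) {U V : S.Opens} (h : V ≤ U) (x : Γ(M, U)) :
    appₗ φ V (res M h x) = res N h (appₗ φ U x) :=
  congr($(φ.mapPresheaf.naturality (homOfLE h).op).hom x)

/-- The morphism of `𝒪_S`-modules given by linear maps on sections that commute with restriction. -/
def mkHom {M N : S.Modules} (f : ∀ U, Γ(M, U) →ₗ[Γ(S, U)] Γ(N, U))
    (hf : ∀ {U V : S.Opens} (h : V ≤ U) (x : Γ(M, U)), f V (res M h x) = res N h (f U x)) :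
    M ⟶ N :=
  (⟨PresheafOfModules.homMk
    { app := fun U => AddCommGrpCat.ofHom (f U.unop).toAddMonoidHom
      naturality := fun U V i => by
        ext x
        exact hf (leOfHom i.unop) x }
    (fun U r m => (f U.unop).map_smul r m)⟩ : SheafOfModules.Hom M N)

lemma eq_of_locally (M : S.Modules) {U : S.Opens} (s t : Γ(M, U))
    (h : ∀ x ∈ U, ∃ V : S.Opens, ∃ hV : V ≤ U, x ∈ V ∧ res M hV s = res M hV t) : s = t := by
  choose V hV hx e using h
  exact TopCat.Sheaf.eq_of_locally_eq' (⟨M.presheaf, M.isSheaf⟩ : TopCat.Sheaf Ab S)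
    (fun x : U => V x x.2) U (fun x => homOfLE (hV _ _))
    (fun x hxU => Opens.mem_iSup.mpr ⟨⟨x, hxU⟩, hx x hxU⟩) s t (fun x => e _ _)

lemma exists_glue (M : S.Modules) {U : S.Opens} {ι : Type u} (V : ι → S.Opens) (hV : ∀ i, V i ≤ U)
    (hU : U ≤ iSup V) (s : ∀ i, Γ(M, V i))
    (hs : ∀ i j (W : S.Opens) (hi : W ≤ V i) (hj : W ≤ V j), res M hi (s i) = res M hj (s j)) :
    ∃ t : Γ(M, U), ∀ i, res M (hV i) t = s i :=
  (TopCat.Sheaf.existsUnique_gluing' (⟨M.presheaf, M.isSheaf⟩ : TopCat.Sheaf Ab S)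
    V U (fun i => homOfLE (hV i)) hU s (fun i j => hs i j _ _ _)).exists

/-! ### The sheaf `Hom(N, L)` -/

variable (N L : S.Modules)

/-- Sections of `Hom(N, L)` over `U`: the `𝒪_U`-linear maps `N|_U → L|_U`, given as families of
linear maps on the sections over the open subsets of `U` that commute with restriction. -/
def homSec (U : S.Opens) :
    AddSubgroup (∀ V : {V : S.Opens // V ≤ U}, Γ(N, V.1) →ₗ[Γ(S, V.1)] Γ(L, V.1)) where
  carrier := {f | ∀ (V W : {V : S.Opens // V ≤ U}) (h : W.1 ≤ V.1) (n : Γ(N, V.1)),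
    f W (res N h n) = res L h (f V n)}
  zero_mem' := by intro V W h n; simp
  add_mem' := by intro f g hf hg V W h n; simp [hf V W h n, hg V W h n]
  neg_mem' := by intro f hf V W h n; simp [hf V W h n]

variable {N L}

instance (U : S.Opens) : SMul Γ(S, U) (homSec N L U) where
  smul r f := ⟨fun V => fres V.2 r • f.1 V, fun V W h n => by
    simp [f.2 V W h n, res_smul, fres_fres]⟩

lemma homSec_smul_apply {U : S.Opens} (r : Γ(S, U)) (f : homSec N L U) (V : {V // V ≤ U})
    (n : Γ(N, V.1)) : (r • f).1 V n = fres V.2 r • f.1 V n := rfl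

instance (U : S.Opens) : Module Γ(S, U) (homSec N L U) where
  one_smul f := by ext V n; simp [homSec_smul_apply]
  mul_smul r s f := by ext V n; simp [homSec_smul_apply, mul_smul]
  smul_zero r := by ext V n; simp [homSec_smul_apply]
  smul_add r f g := by ext V n; simp [homSec_smul_apply]
  add_smul r s f := by ext V n; simp [homSec_smul_apply, add_smul]
  zero_smul f := by ext V n; simp [homSec_smul_apply]

/-- Restriction of a homomorphism `N|_U → L|_U` to `V ≤ U`. -/
def homSecRes {U V : S.Opens} (h : V ≤ U) : homSec N L U →+ homSec N L V where
  toFun f := ⟨fun W => f.1 ⟨W.1, W.2.trans h⟩, fun A B hAB n => f.2 ⟨A.1, _⟩ ⟨B.1, _⟩ hAB n⟩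
  map_zero' := rfl
  map_add' _ _ := rfl

variable (N L)

/-- The presheaf of abelian groups `U ↦ Hom(N|_U, L|_U)`. -/
def homAb : TopCat.Presheaf Ab S where
  obj U := AddCommGrpCat.of (homSec N L U.unop)
  map i := AddCommGrpCat.ofHom (homSecRes (leOfHom i.unop))

instance (U : (S.Opens)ᵒᵖ) : Module (S.ringCatSheaf.obj.obj U) ((homAb N L).obj U) :=
  inferInstanceAs (Module Γ(S, U.unop) (homSec N L U.unop))

lemma homAb_isSheaf : (homAb N L).IsSheaf := by
  rw [TopCat.Presheaf.isSheaf_iff_isSheafUniqueGluing]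
  intro ι U sf hsf
  have key : ∀ i j (W : S.Opens) (hi : W ≤ U i) (hj : W ≤ U j) (n : Γ(N, W)),
      (sf i).1 ⟨W, hi⟩ n = (sf j).1 ⟨W, hj⟩ n := by
    intro i j W hi hj n
    exact congr(($(hsf i j)).1 ⟨W, le_inf hi hj⟩ n)
  have glue : ∀ (V : {V : S.Opens // V ≤ iSup U}) (n : Γ(N, V.1)),
      ∃ l : Γ(L, V.1), ∀ i, res L (inf_le_left : V.1 ⊓ U i ≤ V.1) l =
        (sf i).1 ⟨V.1 ⊓ U i, inf_le_right⟩ (res N inf_le_left n) := by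
    intro V n
    refine exists_glue L (fun i => V.1 ⊓ U i) (fun i => inf_le_left) ?_ _ ?_
    · rw [← inf_iSup_eq]; exact le_inf le_rfl V.2
    · intro i j W hi hj
      erw [← (sf i).2 ⟨V.1 ⊓ U i, inf_le_right⟩ ⟨W, hi.trans inf_le_right⟩ hi,
        ← (sf j).2 ⟨V.1 ⊓ U j, inf_le_right⟩ ⟨W, hj.trans inf_le_right⟩ hj]
      rw [res_res, res_res]
      exact key _ _ _ _ _ _
  choose l hl using glue
  have loc : ∀ (V : S.Opens) (hV : V ≤ iSup U) (a b : Γ(L, V)),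
      (∀ i, res L (inf_le_left : V ⊓ U i ≤ V) a = res L (inf_le_left : V ⊓ U i ≤ V) b) → a = b := by
    intro V hV a b h
    refine eq_of_locally L a b fun x hx => ?_
    obtain ⟨i, hi⟩ := Opens.mem_iSup.mp (hV hx)
    exact ⟨V ⊓ U i, inf_le_left, ⟨hx, hi⟩, h i⟩
  have linj : ∀ (V : {V : S.Opens // V ≤ iSup U}) (n : Γ(N, V.1)) (m : Γ(L, V.1)),
      (∀ i, res L (inf_le_left : V.1 ⊓ U i ≤ V.1) m =
        (sf i).1 ⟨V.1 ⊓ U i, inf_le_right⟩ (res N inf_le_left n)) → l V n = m := by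
    intro V n m h
    exact loc _ V.2 _ _ fun i => (hl V n i).trans (h i).symm
  let F : homSec N L (iSup U) := ⟨fun V =>
    { toFun := l V
      map_add' := fun a b => linj _ _ _ fun i => by
        simp only [map_add, hl]
      map_smul' := fun r a => linj _ _ _ fun i => by
        simp only [res_smul, map_smul, hl, RingHom.id_apply] },
    fun V W h n => linj _ _ _ fun i => by
      change res L _ (res L _ (l V n)) = _
      rw [res_res, res_res]
      have hle : W.1 ⊓ U i ≤ V.1 ⊓ U i := inf_le_inf_right _ h
      have := congrArg (res L hle) (hl V n i)
      rw [res_res, ← (sf i).2 ⟨V.1 ⊓ U i, inf_le_right⟩ ⟨W.1 ⊓ U i, inf_le_right⟩ hle, res_res]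
        at this
      exact this⟩
  refine ⟨F, ?_, ?_⟩
  · intro i
    refine Subtype.ext (funext fun V => LinearMap.ext fun n => ?_)
    refine linj ⟨V.1, V.2.trans (le_iSup U i)⟩ n _ fun j => ?_
    erw [← (sf i).2 V ⟨V.1 ⊓ U j, inf_le_left.trans V.2⟩ inf_le_left]
    exact key _ _ _ _ _ _
  · intro G hG
    refine Subtype.ext (funext fun V => LinearMap.ext fun n => ?_)
    refine (linj V n _ fun i => ?_).symm
    erw [← G.2 V ⟨V.1 ⊓ U i, inf_le_left.trans V.2⟩ inf_le_left]
    rw [← hG i]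
    rfl

/-- The sheaf of modules `Hom(N, L)`. -/
def sheafHom : S.Modules :=
  (⟨PresheafOfModules.ofPresheaf (homAb N L) (by
      intro U V i r f
      refine Subtype.ext (funext fun W => LinearMap.ext fun n => ?_)
      exact congr($((fres_fres (leOfHom i.unop) W.2 r).symm) • f.1 ⟨W.1, _⟩ n)),
    homAb_isSheaf N L⟩ : SheafOfModules S.ringCatSheaf)

variable {N L}
/-- The evaluation pairing `(f, n) ↦ f n` on sections. -/
def ev (U : S.Opens) : Γ(sheafHom N L, U) →ₗ[Γ(S, U)] Γ(N, U) →ₗ[Γ(S, U)] Γ(L, U) where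
  toFun f := (show homSec N L U from f).1 ⟨U, le_rfl⟩
  map_add' _ _ := rfl
  map_smul' r f := by
    ext n
    exact congr($(fres_self le_rfl r) • (show homSec N L U from f).1 ⟨U, le_rfl⟩ n)


/-- A section of `Hom(N, L)` over `U` is a homomorphism `N|_U → L|_U`. -/
def sheafHomEquiv (U : S.Opens) : Γ(sheafHom N L, U) ≃ₗ[Γ(S, U)] homSec N L U where
  toFun f := f
  invFun f := f
  map_add' _ _ := rfl
  map_smul' _ _ := rfl

lemma sheafHomEquiv_res {U V : S.Opens} (h : V ≤ U) (f : Γ(sheafHom N L, U)) :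
    sheafHomEquiv V (res _ h f) = homSecRes h (sheafHomEquiv U f) := rfl

variable {E : S.Modules}

/-- A quadratic form on `E` with values in `L`: a morphism of sheaves `q : E → L` that is quadratic
on sections, that is, `q (r v) = r ^ 2 q v` and `q (v + w) - q v - q w` is `𝒪_S`-bilinear. -/
structure QuadForm (E L : S.Modules) where
  app (U : S.Opens) : QuadraticMap Γ(S, U) Γ(E, U) Γ(L, U)
  app_res : ∀ {U V : S.Opens} (h : V ≤ U) (v : Γ(E, U)), app V (res E h v) = res L h (app U v)

namespace QuadForm

variable (q : QuadForm E L)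

/-- The associated symmetric bilinear form `b_q (v, w) = q (v + w) - q v - q w`. -/
def b (U : S.Opens) : LinearMap.BilinMap Γ(S, U) Γ(E, U) Γ(L, U) := (q.app U).polarBilin

lemma b_res {U V : S.Opens} (h : V ≤ U) (v w : Γ(E, U)) :
    q.b V (res E h v) (res E h w) = res L h (q.b U v w) := by
  simp [b, QuadraticMap.polar, ← map_add, q.app_res]

/-- The homomorphism `n ↦ b_q (v, g n)` from `N|_U` to `L|_U`, as a linear function of `v`. -/
def psiSec (g : N ⟶ E) (U : S.Opens) : Γ(E, U) →ₗ[Γ(S, U)] homSec N L U where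
  toFun v := ⟨fun V => (q.b V.1 (res E V.2 v)).comp (appₗ g V.1),
        fun V W h n => by
          simp only [LinearMap.comp_apply, appₗ_res]
          rw [← res_res E V.2 h, b_res]⟩
  map_add' v w := by ext V n; simp
  map_smul' r v := by ext V n; simp [homSec_smul_apply, res_smul]

/-- The morphism `ψ_{q,N} : E → Hom(N, L)`, `v ↦ b_q (v, g ·)`; for `g = 𝟙 E` this is `ψ_q`. -/
def psi (g : N ⟶ E) : E ⟶ sheafHom N L :=
  mkHom (fun U => (sheafHomEquiv U).symm.toLinearMap ∘ₗ q.psiSec g U)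
    (fun {U V} h v => (sheafHomEquiv V).injective (by
      rw [sheafHomEquiv_res]
      ext W n
      simp [psiSec, res_res, homSecRes]))

/-- `g : N → E` is isotropic: `q` vanishes on `N`. -/
def IsIsotropic (g : N ⟶ E) : Prop := ∀ (U : S.Opens) (n : Γ(N, U)), q.app U (appₗ g U n) = 0

/-- The orthogonal complement `N^⊥`, the kernel of `ψ_{q,N} : E → Hom(N, L)`. -/
abbrev perp (g : N ⟶ E) : S.Modules := kernel (q.psi g)

/-- The inclusion `N^⊥ → E`. -/
abbrev perpι (g : N ⟶ E) : q.perp g ⟶ E := kernel.ι (q.psi g)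

lemma b_perp (g : N ⟶ E) (U : S.Opens) (v : Γ(q.perp g, U)) (n : Γ(N, U)) :
    q.b U (appₗ (q.perpι g) U v) (appₗ g U n) = 0 := by
  have h : appₗ (q.perpι g ≫ q.psi g) U v = 0 := by
    rw [kernel.condition]; rfl
  have h2 := congr(($(congrArg (sheafHomEquiv U) h)).1 ⟨U, le_rfl⟩ n)
  change q.b U (res E le_rfl (appₗ (q.perpι g) U v)) _ = 0 at h2
  rwa [res_self] at h2

variable {q}
lemma IsIsotropic.comp_psi {g : N ⟶ E} (h : q.IsIsotropic g) : g ≫ q.psi g = 0 := by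
  ext U n
  refine (sheafHomEquiv U).injective ?_
  ext V m
  change q.b V.1 (res E V.2 (appₗ g U n)) (appₗ g V.1 m) = 0
  rw [← appₗ_res]
  simp [b, QuadraticMap.polar, ← map_add, h _ _]

/-- The inclusion `N → N^⊥` for isotropic `N`. -/
def IsIsotropic.toPerp {g : N ⟶ E} (h : q.IsIsotropic g) : N ⟶ q.perp g :=
  kernel.lift _ g h.comp_psi

/-- The quotient `N^⊥/N`. -/
abbrev IsIsotropic.reducedModule {g : N ⟶ E} (h : q.IsIsotropic g) : S.Modules := cokernel h.toPerp

end QuadForm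

/-- A section of `B` that dies in `B/A` comes from `A`. -/
lemma exact_sections {A B : S.Modules} (f : A ⟶ B) [Mono f] (U : S.Opens) (x : Γ(B, U))
    (hx : appₗ (cokernel.π f) U x = 0) : ∃ y, appₗ f U y = x := by
  let T : ShortComplex S.Modules := ShortComplex.mk f (cokernel.π f) (by simp)
  have hT : T.Exact := ShortComplex.exact_cokernel f
  let F : S.Modules ⥤ Ab := Scheme.Modules.toPresheaf S ⋙ (evaluation _ _).obj (op U)
  have : F.PreservesZeroMorphisms := ⟨fun _ _ => rfl⟩
  have : PreservesLimitsOfShape WalkingParallelPair ((evaluation (Opens S)ᵒᵖ Ab.{u}).obj (op U)) :=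
    evaluation_preservesLimitsOfShape (J := WalkingParallelPair) (op U)
  have : PreservesLimitsOfShape WalkingParallelPair F := comp_preservesLimitsOfShape _ _
  have h := hT.map_of_mono_of_preservesKernel F (inferInstanceAs (Mono f)) inferInstance
  rw [ShortComplex.ab_exact_iff] at h
  exact h x hx

/-- The sections of `B` that lie locally in the image of `f`. -/
def locImage {A B : S.Modules} (f : A ⟶ B) (U : S.Opens) : Submodule Γ(S, U) Γ(B, U) where
  carrier := {y | ∀ x ∈ U, ∃ (V : S.Opens) (hV : V ≤ U), x ∈ V ∧ ∃ a, appₗ f V a = res B hV y}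
  add_mem' := by
    intro y z hy hz x hx
    obtain ⟨V, hV, hxV, a, ha⟩ := hy x hx
    obtain ⟨W, hW, hxW, c, hc⟩ := hz x hx
    exact ⟨V ⊓ W, inf_le_left.trans hV, ⟨hxV, hxW⟩, res A inf_le_left a + res A inf_le_right c, by
      rw [map_add, map_add, appₗ_res, appₗ_res, ha, hc, res_res, res_res]⟩
  zero_mem' := fun x hx => ⟨U, le_rfl, hx, 0, by simp⟩
  smul_mem' := by
    intro r y hy x hx
    obtain ⟨V, hV, hxV, a, ha⟩ := hy x hx
    exact ⟨V, hV, hxV, fres hV r • a, by rw [map_smul, ha, res_smul]⟩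

lemma locImage_res {A B : S.Modules} (f : A ⟶ B) {U V : S.Opens} (h : V ≤ U) {y : Γ(B, U)}
    (hy : y ∈ locImage f U) : res B h y ∈ locImage f V := by
  intro x hx
  obtain ⟨W, hW, hxW, a, ha⟩ := hy x (h hx)
  exact ⟨V ⊓ W, inf_le_left, ⟨hx, hxW⟩, res A inf_le_right a, by
    rw [appₗ_res, ha, res_res, res_res]⟩

/-- The presheaf of sections that lie locally in the image of `f`. -/
def imageAb {A B : S.Modules} (f : A ⟶ B) : TopCat.Presheaf Ab S where
  obj U := AddCommGrpCat.of (locImage f U.unop)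
  map {U V} i := AddCommGrpCat.ofHom (((res B (leOfHom i.unop)).comp
    (locImage f U.unop).subtype.toAddMonoidHom).codRestrict (locImage f V.unop)
      (fun y => locImage_res f _ y.2))
  map_id U := by ext y; exact res_self B _ _
  map_comp i j := by ext y; exact (res_res B _ _ _).symm

instance {A B : S.Modules} (f : A ⟶ B) (U : (S.Opens)ᵒᵖ) :
    Module (S.ringCatSheaf.obj.obj U) ((imageAb f).obj U) :=
  inferInstanceAs (Module Γ(S, U.unop) (locImage f U.unop))

lemma imageAb_isSheaf {A B : S.Modules} (f : A ⟶ B) : (imageAb f).IsSheaf := by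
  rw [TopCat.Presheaf.isSheaf_iff_isSheafUniqueGluing]
  intro ι U sf hsf
  obtain ⟨t, ht⟩ := exists_glue B U (fun i => le_iSup U i) le_rfl (fun i => (sf i).1) (by
    intro i j W hi hj
    have := congrArg (res B (le_inf hi hj)) (congrArg Subtype.val (hsf i j))
    change res B _ (res B _ _) = res B _ (res B _ _) at this
    rwa [res_res, res_res] at this)
  refine ⟨⟨t, fun x hx => ?_⟩, fun i => Subtype.ext (ht i), fun s hs => Subtype.ext ?_⟩
  · obtain ⟨i, hi⟩ := Opens.mem_iSup.mp hx
    obtain ⟨V, hV, hxV, a, ha⟩ := (sf i).2 x hi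
    exact ⟨V, hV.trans (le_iSup U i), hxV, a, by rw [ha, ← ht i, res_res]⟩
  · refine eq_of_locally B _ _ fun x hx => ?_
    obtain ⟨i, hi⟩ := Opens.mem_iSup.mp hx
    exact ⟨U i, le_iSup U i, hi, (congrArg Subtype.val (hs i)).trans (ht i).symm⟩

/-- The image sheaf of `f`. -/
def imageMod {A B : S.Modules} (f : A ⟶ B) : S.Modules :=
  (⟨PresheafOfModules.ofPresheaf (imageAb f) (fun _ _ i r y =>
      Subtype.ext (res_smul B (leOfHom i.unop) r y.1)),
    imageAb_isSheaf f⟩ : SheafOfModules S.ringCatSheaf)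

/-- The inclusion of the image sheaf. -/
def imageModι {A B : S.Modules} (f : A ⟶ B) : imageMod f ⟶ B :=
  mkHom (M := imageMod f) (fun U => (locImage f U).subtype) (fun _ _ => rfl)

/-- An epimorphism of sheaves of modules is locally surjective on sections. -/
lemma epi_locally_surjective {A B : S.Modules} (f : A ⟶ B) [Epi f] (U : S.Opens) (y : Γ(B, U))
    (x : S) (hx : x ∈ U) :
    ∃ (V : S.Opens) (hV : V ≤ U), x ∈ V ∧ ∃ a, appₗ f V a = res B hV y := by
  let p : A ⟶ imageMod f := mkHom (N := imageMod f)
    (fun U => (appₗ f U).codRestrict (locImage f U)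
      (fun a x hx => ⟨U, le_rfl, hx, a, (res_self B _ _).symm⟩))
    (fun h a => Subtype.ext (appₗ_res f h a))
  have hp : p ≫ imageModι f = f := by ext U a; rfl
  have : Epi (p ≫ imageModι f) := by rwa [hp]
  have : Epi (imageModι f) := epi_of_epi p _
  have : Mono (imageModι f) := by
    refine ⟨fun {Z} a c h => ?_⟩
    ext W z
    exact Subtype.ext congr($(congrArg (fun k => appₗ k W) h) z)
  have : IsIso (imageModι f) := isIso_of_mono_of_epi _
  obtain ⟨z, rfl⟩ : ∃ z, appₗ (imageModι f) U z = y := by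
    refine ⟨appₗ (inv (imageModι f)) U y, ?_⟩
    change appₗ (inv (imageModι f) ≫ imageModι f) U y = y
    rw [IsIso.inv_hom_id]; rfl
  exact z.2 x hx

namespace QuadForm

/-- A quadratic form that is constant on the fibres of an epimorphism descends. -/
lemma exists_descend {F G : S.Modules} (π : F ⟶ G) [Epi π] (q : QuadForm F L)
    (h : ∀ (U : S.Opens) (v w : Γ(F, U)), appₗ π U v = appₗ π U w → q.app U v = q.app U w) :
    ∃ q' : QuadForm G L, ∀ (U : S.Opens) (v : Γ(F, U)), q'.app U (appₗ π U v) = q.app U v := by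
  have ex : ∀ (U : S.Opens) (e : Γ(G, U)), ∃ l : Γ(L, U), ∀ (V : S.Opens) (hV : V ≤ U)
      (v : Γ(F, V)), appₗ π V v = res G hV e → q.app V v = res L hV l := by
    intro U e
    choose V hV hx a ha using fun x : U => epi_locally_surjective π U e x x.2
    obtain ⟨l, hl⟩ := exists_glue L V hV (fun x hxU => Opens.mem_iSup.mpr ⟨⟨x, hxU⟩, hx _⟩)
      (fun x => q.app _ (a x)) (by
        intro i j W hi hj
        rw [← q.app_res, ← q.app_res]
        apply h
        rw [appₗ_res, appₗ_res, ha, ha, res_res, res_res])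
    refine ⟨l, fun W hW v hv => eq_of_locally L _ _ fun x hxW => ?_⟩
    refine ⟨W ⊓ V ⟨x, hW hxW⟩, inf_le_left, ⟨hxW, hx _⟩, ?_⟩
    rw [res_res, ← res_res L (hV ⟨x, hW hxW⟩) inf_le_right, hl, ← q.app_res, ← q.app_res]
    apply h
    rw [appₗ_res, appₗ_res, hv, ha, res_res, res_res]
  choose l hl using ex
  have lift := epi_locally_surjective π
  -- `l U e` is determined by local lifts of `e`
  have uniq : ∀ (U : S.Opens) (e : Γ(G, U)) (m : Γ(L, U)),
      (∀ x ∈ U, ∃ (V : S.Opens) (hV : V ≤ U), x ∈ V ∧ ∃ a : Γ(F, V),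
        appₗ π V a = res G hV e ∧ q.app V a = res L hV m) → l U e = m := by
    intro U e m hm
    refine eq_of_locally L _ _ fun x hx => ?_
    obtain ⟨V, hV, hxV, a, ha, hq⟩ := hm x hx
    exact ⟨V, hV, hxV, (hl U e V hV a ha).symm.trans hq⟩
  have lres : ∀ {U V : S.Opens} (hV : V ≤ U) (e : Γ(G, U)), l V (res G hV e) = res L hV (l U e) := by
    intro U V hV e
    refine uniq V _ _ fun x hx => ?_
    obtain ⟨W, hW, hxW, a, ha⟩ := lift V (res G hV e) x hx
    refine ⟨W, hW, hxW, a, ha, ?_⟩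
    rw [res_res] at ha ⊢
    exact hl U e W _ a ha
  have lapp : ∀ (U : S.Opens) (v : Γ(F, U)), l U (appₗ π U v) = q.app U v := fun U v =>
    uniq U _ _ fun x hx => ⟨U, le_rfl, hx, v, by rw [res_self], by rw [res_self]⟩
  -- identities may be checked on common local lifts
  have loc : ∀ (U : S.Opens) (e : Fin 3 → Γ(G, U)) (s t : Γ(L, U)),
      (∀ (V : S.Opens) (hV : V ≤ U) (a : Fin 3 → Γ(F, V)),
        (∀ i, appₗ π V (a i) = res G hV (e i)) → res L hV s = res L hV t) → s = t := by
    intro U e s t hst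
    refine eq_of_locally L _ _ fun x hx => ?_
    choose V hV hxV a ha using fun i => lift U (e i) x hx
    have h0 : V 0 ⊓ (V 1 ⊓ V 2) ≤ U := inf_le_left.trans (hV 0)
    have hle : ∀ i, V 0 ⊓ (V 1 ⊓ V 2) ≤ V i := by
      intro i
      fin_cases i
      · exact inf_le_left
      · exact inf_le_right.trans inf_le_left
      · exact inf_le_right.trans inf_le_right
    exact ⟨_, h0, ⟨hxV 0, hxV 1, hxV 2⟩, hst _ h0 (fun i => res F (hle i) (a i)) (fun i => by
      rw [appₗ_res, ha, res_res])⟩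
  have lsmul : ∀ (U : S.Opens) (r : Γ(S, U)) (e : Γ(G, U)), l U (r • e) = (r * r) • l U e := by
    intro U r e
    refine loc U (fun _ => e) _ _ fun V hV a ha => ?_
    rw [← lres, res_smul, res_smul, ← lres, ← ha 0, ← map_smul, lapp, lapp,
      QuadraticMap.map_smul, map_mul]
  have ladd : ∀ (U : S.Opens) (e f g : Γ(G, U)),
      QuadraticMap.polar (l U) (e + f) g = QuadraticMap.polar (l U) e g +
        QuadraticMap.polar (l U) f g := by
    intro U e f g
    refine loc U ![e, f, g] _ _ fun V hV a ha => ?_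
    have h0 : appₗ π V (a 0) = res G hV e := ha 0
    have h1 : appₗ π V (a 1) = res G hV f := ha 1
    have h2 : appₗ π V (a 2) = res G hV g := ha 2
    have := QuadraticMap.polar_add_left (q.app V) (a 0) (a 1) (a 2)
    simp only [QuadraticMap.polar, map_sub, map_add, ← lres, ← h0, ← h1, ← h2] at this ⊢
    simpa only [← map_add, lapp] using this
  have lsmul' : ∀ (U : S.Opens) (r : Γ(S, U)) (e f : Γ(G, U)),
      QuadraticMap.polar (l U) (r • e) f = r • QuadraticMap.polar (l U) e f := by
    intro U r e f
    refine loc U ![e, f, f] _ _ fun V hV a ha => ?_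
    have h0 : appₗ π V (a 0) = res G hV e := ha 0
    have h1 : appₗ π V (a 1) = res G hV f := ha 1
    have := QuadraticMap.polar_smul_left (q.app V) (fres hV r) (a 0) (a 1)
    simp only [QuadraticMap.polar, map_sub, map_add, res_smul, ← lres, ← h0, ← h1] at this ⊢
    simpa only [← map_add, ← map_smul, lapp] using this
  exact ⟨⟨fun U => QuadraticMap.ofPolar (l U) (lsmul U) (ladd U) (lsmul' U), lres⟩, lapp⟩

/-- The form on `G` induced by a form on `F` along an epimorphism `F → G`. -/
def descend {F G : S.Modules} (π : F ⟶ G) [Epi π] (q : QuadForm F L)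
    (h : ∀ (U : S.Opens) (v w : Γ(F, U)), appₗ π U v = appₗ π U w → q.app U v = q.app U w) :
    QuadForm G L := (exists_descend π q h).choose

lemma descend_app {F G : S.Modules} (π : F ⟶ G) [Epi π] (q : QuadForm F L)
    (h : ∀ (U : S.Opens) (v w : Γ(F, U)), appₗ π U v = appₗ π U w → q.app U v = q.app U w)
    (U : S.Opens) (v : Γ(F, U)) : (descend π q h).app U (appₗ π U v) = q.app U v :=
  (exists_descend π q h).choose_spec U v

/-- The form `v ↦ q (f v)`. -/
def comp {F : S.Modules} (q : QuadForm E L) (f : F ⟶ E) : QuadForm F L where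
  app U := (q.app U).comp (appₗ f U)
  app_res h v := by simp [appₗ_res, q.app_res]

/-- The reduced form `q'` on `N^⊥/N`, induced by the restriction of `q` to `N^⊥`. -/
def reducedForm (q : QuadForm E L) {g : N ⟶ E} [Mono g] (h : q.IsIsotropic g) : QuadForm h.reducedModule L :=
  descend (cokernel.π h.toPerp) (q.comp (q.perpι g)) (by
    intro U v w hvw
    have hfac : h.toPerp ≫ q.perpι g = g := kernel.lift_ι _ _ _
    have : Mono (h.toPerp ≫ q.perpι g) := by rw [hfac]; infer_instance
    have : Mono h.toPerp := mono_of_mono _ (q.perpι g)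
    obtain ⟨n, hn⟩ := exact_sections h.toPerp U (v - w) (by rw [map_sub, hvw, sub_self])
    have hg : appₗ (q.perpι g) U (appₗ h.toPerp U n) = appₗ g U n := by
      change appₗ (h.toPerp ≫ q.perpι g) U n = _
      rw [IsIsotropic.toPerp, kernel.lift_ι]
    have hv : v = w + appₗ h.toPerp U n := by rw [hn]; abel
    have hb := q.b_perp g U w n
    simp only [b, QuadraticMap.polarBilin_apply_apply, QuadraticMap.polar] at hb
    rw [hv]
    simp only [comp, QuadraticMap.comp_apply, map_add, hg]
    rw [h U n, sub_zero, sub_eq_zero] at hb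
    exact hb)

/-- The `L`-valued hyperbolic form `H_L(P)` on `P ⊕ Hom(P, L)`, `(v, f) ↦ f v`. -/
def hyperbolic (P L : S.Modules) : QuadForm (P ⊞ sheafHom P L) L where
  app U := LinearMap.BilinMap.toQuadraticMap
    ((ev (N := P) (L := L) U).compl₁₂ (appₗ biprod.snd U) (appₗ biprod.fst U))
  app_res h v := by
    simp only [LinearMap.BilinMap.toQuadraticMap_apply, LinearMap.compl₁₂_apply, appₗ_res]
    exact (sheafHomEquiv _ (appₗ biprod.snd _ v)).2 ⟨_, le_rfl⟩ ⟨_, h⟩ h _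

lemma reducedForm_app (q : QuadForm E L) {g : N ⟶ E} [Mono g] (h : q.IsIsotropic g) (U : S.Opens)
    (v : Γ(q.perp g, U)) :
    (q.reducedForm h).app U (appₗ (cokernel.π h.toPerp) U v) =
      q.app U (appₗ (q.perpι g) U v) :=
  descend_app _ _ _ _ _

/-- The orthogonal sum `q ⊥ q'` on `E ⊕ E'`. -/
def orthSum {E' : S.Modules} (q : QuadForm E L) (q' : QuadForm E' L) : QuadForm (E ⊞ E') L where
  app U := (q.app U).comp (appₗ biprod.fst U) + (q'.app U).comp (appₗ biprod.snd U)
  app_res h v := by simp [appₗ_res, q.app_res, q'.app_res]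

/-- `(E, q, L)` and `(E', q', L)` are isometric: there is an isomorphism `φ : E ≅ E'` of
`𝒪_S`-modules with `q' ∘ φ = q`. -/
def Isometric {E' : S.Modules} (q : QuadForm E L) (q' : QuadForm E' L) : Prop :=
  ∃ φ : E ≅ E', ∀ (U : S.Opens) (v : Γ(E, U)), q'.app U (appₗ φ.hom U v) = q.app U v

end QuadForm

/-- The section `f^* s` of `f^* M` over `f⁻¹ U` for a section `s` of `M` over `U`. -/
def pullSec {T : Scheme.{u}} (f : T ⟶ S) (M : S.Modules) (U : S.Opens) (s : Γ(M, U)) :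
    Γ((Scheme.Modules.pullback f).obj M, f ⁻¹ᵁ U) :=
  ((Scheme.Modules.pullbackPushforwardAdjunction f).unit.app M).app U s

/-- `qT` is the pullback `f^* q : f^* E → f^* L`, that is, `qT (f^* v) = f^* (q v)` for all local
sections `v` of `E`. As `f^* E` is generated locally over `𝒪_T` by the sections `f^* v`, and a
quadratic form is determined by its values and its polar form on generators, there is at most one
such `qT`. -/
def QuadForm.IsPullback {T : Scheme.{u}} (f : T ⟶ S) (q : QuadForm E L)
    (qT : QuadForm ((Scheme.Modules.pullback f).obj E) ((Scheme.Modules.pullback f).obj L)) : Prop :=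
  ∀ (U : S.Opens) (v : Γ(E, U)), qT.app (f ⁻¹ᵁ U) (pullSec f E U v) = pullSec f L U (q.app U v)

/-- The sections `e` form a basis of `M|_U`, that is, they define an isomorphism `𝒪_U ^ n ≅ M|_U`. -/
def IsBasisOn (M : S.Modules) {U : S.Opens} {n : ℕ} (e : Fin n → Γ(M, U)) : Prop :=
  ∀ (V : S.Opens) (hV : V ≤ U),
    Function.Bijective fun c : Fin n → Γ(S, V) => ∑ i, c i • res M hV (e i)

/-- `M` is locally free of finite rank (the rank may vary). -/
def IsVectorBundle (M : S.Modules) : Prop :=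
  ∀ x : S, ∃ U : S.Opens, x ∈ U ∧ ∃ (n : ℕ) (e : Fin n → Γ(M, U)), IsBasisOn M e

/-- `M` is locally free of rank one. -/
def IsLineBundle (M : S.Modules) : Prop :=
  ∀ x : S, ∃ U : S.Opens, x ∈ U ∧ ∃ e : Fin 1 → Γ(M, U), IsBasisOn M e

/-- The half-determinant polynomial (for odd `n`): half of the determinant of the symmetric matrix of
the polar form of the generic quadratic form `∑_{i ≤ j} X_ij x_i x_j`. For odd `n` all coefficients
of this determinant are even. -/
def halfDet (n : ℕ) : MvPolynomial (Fin n × Fin n) ℤ :=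
  let d : MvPolynomial (Fin n × Fin n) ℤ := (Matrix.of fun i j : Fin n =>
    if i = j then 2 * MvPolynomial.X (i, i) else MvPolynomial.X (min i j, max i j)).det
  ∑ m ∈ d.support, MvPolynomial.monomial m (d.coeff m / 2)

namespace QuadForm
variable (q : QuadForm E L)

/-- `q` is regular at `y`: the map of stalks `ψ_{q,y}` is an isomorphism. -/
def IsRegularAt (y : S) : Prop :=
  IsIso ((TopCat.Presheaf.stalkFunctor Ab.{u} y).map (q.psi (𝟙 E)).mapPresheaf)

/-- `q` has odd rank at `y` and is semiregular there: its half-discriminant, computed in local bases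
of `E` and `L`, is a unit at `y`. -/
def IsOddSemiregularAt (y : S) : Prop :=
  ∃ (U : S.Opens) (hy : y ∈ U) (n : ℕ) (e : Fin n → Γ(E, U)) (l : Fin 1 → Γ(L, U))
    (a : Fin n × Fin n → Γ(S, U)), Odd n ∧ IsBasisOn E e ∧ IsBasisOn L l ∧
    (∀ i, q.app U (e i) = a (i, i) • l 0) ∧
    (∀ i j, i < j → q.b U (e i) (e j) = a (i, j) • l 0) ∧
    IsUnit (S.presheaf.germ U y hy (MvPolynomial.aeval a (halfDet n)))

/-- `q` is generically (semi)regular: (semi)regular at every maximal generic point of `S`, that is,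
at the generic point of every irreducible component. -/
def IsGenericallySemiregular : Prop :=
  ∀ y ∈ genericPoints S, q.IsRegularAt y ∨ q.IsOddSemiregularAt y

end QuadForm

/-- The functions on `U` that vanish at `y`. -/
def vanishingIdeal (y : S) (U : S.Opens) (hy : y ∈ U) : Ideal Γ(S, U) :=
  (IsLocalRing.maximalIdeal (S.presheaf.stalk y)).comap (S.presheaf.germ U y hy).hom

/-- The value of the section `s` in the fibre `M(y) = M_y ⊗ κ(y)` is zero: the germ of `s` lies in
`𝔪_y M_y`. -/
def VanishesAt (M : S.Modules) (y : S) {U : S.Opens} (s : Γ(M, U)) : Prop :=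
  ∃ (V : S.Opens) (hV : V ≤ U) (hy : y ∈ V),
    res M hV s ∈ vanishingIdeal y V hy • (⊤ : Submodule Γ(S, V) Γ(M, V))

/-- The subbundle `g : N → E` is regular: in every fibre `E(y)`, the subspace `N(y)` meets the
radical of the bilinear form `b_q(y)` only in zero. That is, for each local section `n` with
`n(y) ≠ 0` there is a local section `v` of `E` with `b_q (n, v)(y) ≠ 0`. By the Jacobian criterion
this says, for isotropic `N` and `q(y) ≠ 0`, that the quadric `q(y) = 0` is smooth along `ℙ(N(y))`:
the differential of `q(y)` at `n` is `b_q(y) (n, ·)`. -/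
def QuadForm.IsRegularSubbundle (q : QuadForm E L) (g : N ⟶ E) : Prop :=
  ∀ (y : S) (U : S.Opens) (_ : y ∈ U) (n : Γ(N, U)), ¬ VanishesAt N y n →
    ∃ (V : S.Opens) (hV : V ≤ U) (_ : y ∈ V) (v : Γ(E, V)),
      ¬ VanishesAt L y (q.b V (appₗ g V (res N hV n)) v)

/-- `p : V → S` is a Zariski-locally trivial affine bundle: locally on `S` it is isomorphic to a
projection `𝔸ⁿ × U → U`. -/
def IsAffineBundle {V : Scheme.{u}} (p : V ⟶ S) : Prop :=
  ∀ x : S, ∃ U : S.Opens, x ∈ U ∧ ∃ (n : ℕ)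
    (e : (p ⁻¹ᵁ U).toScheme ≅ 𝔸(ULift.{u} (Fin n); U.toScheme)),
      e.hom ≫ (𝔸(ULift.{u} (Fin n); U.toScheme) ↘ U.toScheme) = p ∣_ U

/-- `f^*(E, q, L) ≅ H_{f^* L}(f^* N) ⊥ f^*(N^⊥/N, q', L)`. -/
def QuadForm.SplitsAlong (q : QuadForm E L) {g : N ⟶ E} [Mono g] (h : q.IsIsotropic g)
    {T : Scheme.{u}} (f : T ⟶ S) : Prop :=
  ∃ (qT : QuadForm ((Scheme.Modules.pullback f).obj E) ((Scheme.Modules.pullback f).obj L))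
    (qT' : QuadForm ((Scheme.Modules.pullback f).obj h.reducedModule) ((Scheme.Modules.pullback f).obj L)),
    q.IsPullback f qT ∧ (q.reducedForm h).IsPullback f qT' ∧
    qT.Isometric ((QuadForm.hyperbolic ((Scheme.Modules.pullback f).obj N)
      ((Scheme.Modules.pullback f).obj L)).orthSum qT')

end SplitPrinciple

end

open SplitPrinciple

/-!
Why the form splits over an affine bundle.

The idea is to parametrize the choices from which a splitting is built. A splitting needs an
isotropic section `s'` of `ψ_{q,N} : E → Hom(N, L)`: then `g` and `s'` span a hyperbolic subform
`H_L(N)` of `E`. With `r : E → N` the retraction of `g` determined by `b_q(g (r v), s' h) =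
b_q(v, s' h)`, the morphism `1 - g r` kills `N` and embeds `N^⊥/N` isometrically in `E` as the
orthogonal complement of that subform (`QuadForm.isometric_of_section`, `splitsAlong_of`).

Isotropic sections do not form a torsor under a sheaf of modules, since isotropy is a quadratic
condition. All sections `s` of `ψ_{q,N}`, however, are a torsor under `Hom(Hom(N, L), N^⊥)`, and the
bilinear forms `β` with `β(v)(v) = q(v)` are a torsor under the alternating forms. Both torsors have
affine frames locally (`AdaptedFrame.dualFrame`, `exists_bilinFrame`). From a pair `(s, β)` one gets
an isotropic section: for the `α : Hom(N, L) → N` with `b_q(g (α h), s h') = β(s h)(s h')`, the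
section `s - g α` is isotropic, because
`q(s h - g (α h)) = q(s h) - β(s h)(s h) = 0` (`QuadForm.exists_isotropic_section`).
No division by `2` is used, which is the reason for carrying `β` along.

So the bundle `V → S` is the torsor of the pairs `(s, β)`. In general, a subsheaf of sets of a sheaf
of modules that locally has affine frames defines an affine bundle: the affine spaces over the
domains of all affine frames are glued along the changes of coordinates (`AffFrame.gluing`). Every
semilinear map out of the sheaf of modules then has a tautological value over the total space
(`AffFrame.exists_tautSection`), and pulling back sections of `Hom` sheaves provides the tautological
pair `(s, β)` over `V` (`SemiMap.hom`, `splitsAlong_of_locally`). The domain of an affine frame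
carries a pair as well, the origin of the frame, so `q` splits over it; these domains are the open
covering.

The local input is the existence of a frame of `E` that starts with a frame of `N`, continues with
sections of `N^⊥`, and ends with sections dual to the frame of `N` (`exists_adaptedFrame`). Over the
residue field it is linear algebra: regularity says that `N(y)` is in duality with a quotient of
`E(y)`. The frame is then lifted to a neighbourhood, and the sections of `N^⊥` in it show that
`N^⊥/N` is a vector bundle (`AdaptedFrame.isFrame_reduced`).
-/

noncomputable section
namespace SplitPrinciple

variable {S : Scheme.{u}}

/-! ### Frames -/

/-- A family of sections `e` of `M` over `U` is a frame if it induces `𝒪_U ^ ι ≅ M|_U`. This is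
`IsBasisOn` for an arbitrary finite index type. -/
def IsFrame (M : S.Modules) {U : S.Opens} {ι : Type*} [Fintype ι] (e : ι → Γ(M, U)) : Prop :=
  ∀ (V : S.Opens) (hV : V ≤ U),
    Function.Bijective fun c : ι → Γ(S, V) => ∑ i, c i • res M hV (e i)

namespace IsFrame

variable {M : S.Modules} {U : S.Opens} {ι : Type*} [Fintype ι] {e : ι → Γ(M, U)}

/-- The isomorphism `𝒪(V) ^ ι ≅ M(V)` given by a frame. -/
def equiv (he : IsFrame M e) {V : S.Opens} (hV : V ≤ U) : (ι → Γ(S, V)) ≃ₗ[Γ(S, V)] Γ(M, V) :=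
  LinearEquiv.ofBijective (Fintype.linearCombination Γ(S, V) fun i => res M hV (e i)) (he V hV)

/-- The coordinates of a section with respect to a frame. -/
def coord (he : IsFrame M e) {V : S.Opens} (hV : V ≤ U) : Γ(M, V) →ₗ[Γ(S, V)] (ι → Γ(S, V)) :=
  (he.equiv hV).symm.toLinearMap

lemma sum_coord (he : IsFrame M e) {V : S.Opens} (hV : V ≤ U) (x : Γ(M, V)) :
    ∑ i, he.coord hV x i • res M hV (e i) = x :=
  (he.equiv hV).apply_symm_apply x

lemma coord_sum (he : IsFrame M e) {V : S.Opens} (hV : V ≤ U) (c : ι → Γ(S, V)) :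
    he.coord hV (∑ i, c i • res M hV (e i)) = c :=
  (he.equiv hV).symm_apply_apply c

lemma coord_injective (he : IsFrame M e) {V : S.Opens} (hV : V ≤ U) :
    Function.Injective (he.coord hV) :=
  (he.equiv hV).symm.injective

lemma coord_self [DecidableEq ι] (he : IsFrame M e) {V : S.Opens} (hV : V ≤ U) (i : ι) :
    he.coord hV (res M hV (e i)) = Pi.single i 1 := by
  rw [← he.coord_sum hV (Pi.single i 1)]
  congr 1
  simp [Pi.single_apply, ite_smul]

lemma coord_res (he : IsFrame M e) {V W : S.Opens} (hV : V ≤ U) (hW : W ≤ V) (x : Γ(M, V)) (i : ι) :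
    he.coord (hW.trans hV) (res M hW x) i = fres hW (he.coord hV x i) := by
  suffices he.coord (hW.trans hV) (res M hW x) = fun i => fres hW (he.coord hV x i) from
    congrFun this i
  rw [← he.coord_sum (hW.trans hV) fun i => fres hW (he.coord hV x i)]
  congr 1
  conv_lhs => rw [← he.sum_coord hV x]
  simp [res_smul, res_res]

lemma restrict (he : IsFrame M e) {V : S.Opens} (hV : V ≤ U) : IsFrame M fun i => res M hV (e i) := by
  intro W hW
  simpa only [res_res] using he W (hW.trans hV)

lemma reindex (he : IsFrame M e) {κ : Type*} [Fintype κ] (σ : κ ≃ ι) : IsFrame M (e ∘ σ) := by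
  intro V hV
  convert! (he V hV).comp (Equiv.arrowCongr σ (Equiv.refl Γ(S, V))).bijective using 1
  funext c
  simp only [Function.comp_apply, Equiv.arrowCongr_apply, Equiv.coe_refl, id_eq]
  exact Fintype.sum_equiv σ _ _ (by simp)

/-- Two morphisms of sheaves of modules agree on the sections over `V ≤ U` if they agree on a
frame over `U`. -/
lemma hom_ext (he : IsFrame M e) {K : S.Modules} {φ ψ : M ⟶ K}
    (h : ∀ i, appₗ φ U (e i) = appₗ ψ U (e i)) {V : S.Opens} (hV : V ≤ U) (x : Γ(M, V)) :
    appₗ φ V x = appₗ ψ V x := by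
  rw [← he.sum_coord hV x]
  simp only [map_sum, map_smul, appₗ_res, h]

end IsFrame

lemma IsVectorBundle.exists_frame {M : S.Modules} (hM : IsVectorBundle M) (x : S) :
    ∃ U : S.Opens, x ∈ U ∧ ∃ (n : ℕ) (e : Fin n → Γ(M, U)), IsFrame M e := hM x

lemma IsLineBundle.exists_frame {M : S.Modules} (hM : IsLineBundle M) (x : S) :
    ∃ U : S.Opens, x ∈ U ∧ ∃ e : Unit → Γ(M, U), IsFrame M e := by
  obtain ⟨U, hx, e, he⟩ := hM x
  have he' : IsFrame M e := he
  exact ⟨U, hx, _, he'.reindex (Equiv.ofUnique Unit (Fin 1))⟩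

/-! ### Sections of `Hom` sheaves -/

section sheafHom

variable {A B L : S.Modules}

lemma ev_res {U V : S.Opens} (hV : V ≤ U) (f : Γ(sheafHom A B, U)) (a : Γ(A, U)) :
    ev V (res _ hV f) (res A hV a) = res B hV (ev U f a) :=
  (sheafHomEquiv U f).2 ⟨U, le_rfl⟩ ⟨V, hV⟩ hV a

lemma sheafHom_ext {U : S.Opens} {f g : Γ(sheafHom A B, U)}
    (h : ∀ (V : S.Opens) (hV : V ≤ U) (a : Γ(A, V)), ev V (res _ hV f) a = ev V (res _ hV g) a) :
    f = g := by
  refine (sheafHomEquiv U).injective (Subtype.ext (funext fun V => LinearMap.ext fun a => ?_))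
  exact h V.1 V.2 a

/-- The section of `Hom(A, B)` over `U` given by a compatible family of linear maps. -/
def mkSec {U : S.Opens} (f : ∀ V : S.Opens, V ≤ U → (Γ(A, V) →ₗ[Γ(S, V)] Γ(B, V)))
    (hf : ∀ (V W : S.Opens) (hV : V ≤ U) (h : W ≤ V) (a : Γ(A, V)),
      f W (h.trans hV) (res A h a) = res B h (f V hV a)) : Γ(sheafHom A B, U) :=
  (sheafHomEquiv U).symm ⟨fun V => f V.1 V.2, fun V W h a => hf V.1 W.1 V.2 h a⟩

lemma IsFrame.sheafHom_ext {U : S.Opens} {ι : Type*} [Fintype ι] {e : ι → Γ(A, U)}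
    (he : IsFrame A e) {V : S.Opens} (hV : V ≤ U) {f g : Γ(sheafHom A B, V)}
    (h : ∀ i, ev V f (res A hV (e i)) = ev V g (res A hV (e i))) : f = g := by
  refine SplitPrinciple.sheafHom_ext fun W hW a => ?_
  rw [← he.sum_coord (hW.trans hV) a]
  simp only [map_sum, map_smul, ← res_res A hV hW, ev_res, h]

/-- The homomorphism with prescribed values on a frame. -/
def IsFrame.lift {U : S.Opens} {ι : Type*} [Fintype ι] {e : ι → Γ(A, U)}
    (he : IsFrame A e) (b : ι → Γ(B, U)) : Γ(sheafHom A B, U) :=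
  mkSec (fun _ hV => (Fintype.linearCombination _ fun i => res B hV (b i)).comp (he.coord hV))
    (fun V W hV h a => by
      simp only [LinearMap.comp_apply, Fintype.linearCombination_apply, map_sum, he.coord_res hV h,
        res_smul, res_res])

lemma IsFrame.ev_lift {U : S.Opens} {ι : Type*} [Fintype ι] {e : ι → Γ(A, U)}
    (he : IsFrame A e) (b : ι → Γ(B, U)) {V : S.Opens} (hV : V ≤ U) (a : Γ(A, V)) :
    ev V (res _ hV (he.lift b)) a = ∑ i, he.coord hV a i • res B hV (b i) := rfl

lemma IsFrame.ev_lift_self {U : S.Opens} {ι : Type*} [Fintype ι] {e : ι → Γ(A, U)}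
    (he : IsFrame A e) (b : ι → Γ(B, U)) (i : ι) : ev U (he.lift b) (e i) = b i := by
  classical
  have := he.ev_lift b le_rfl (e i)
  rw [res_self] at this
  rw [this]
  have h2 := he.coord_self le_rfl i
  rw [res_self] at h2
  simp [h2, Pi.single_apply, res_self]

/-- The frame of `Hom(A, B)` given by frames of `A` and of `B`. -/
lemma IsFrame.sheafHom {U : S.Opens} {ι κ : Type*} [Fintype ι] [Fintype κ] [DecidableEq ι]
    {e : ι → Γ(A, U)} {b : κ → Γ(B, U)} (he : IsFrame A e) (hb : IsFrame B b) :
    IsFrame (sheafHom A B) fun p : ι × κ => he.lift (Pi.single p.1 (b p.2)) := by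
  intro V hV
  have key : ∀ (c : ι × κ → Γ(S, V)) (i : ι),
      ev V (∑ p, c p • res _ hV (he.lift (Pi.single p.1 (b p.2)))) (res A hV (e i)) =
        ∑ k, c (i, k) • res B hV (b k) := by
    intro c i
    simp only [map_sum, map_smul, LinearMap.sum_apply, LinearMap.smul_apply, ev_res,
      IsFrame.ev_lift_self, Fintype.sum_prod_type]
    rw [Finset.sum_eq_single i (by intro j _ hj; simp [hj.symm]) (by simp)]
    simp
  constructor
  · intro c d hcd
    funext ⟨i, k⟩
    have := congrArg (fun f => ev V f (res A hV (e i))) hcd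
    simp only [key] at this
    exact congrFun ((hb V hV).1 this) k
  · intro f
    refine ⟨fun p => hb.coord hV (ev V f (res A hV (e p.1))) p.2, ?_⟩
    refine he.sheafHom_ext hV fun i => ?_
    rw [key]
    exact hb.sum_coord hV (ev V f (res A hV (e i)))

/-- A global section of `Hom(A, B)` as a morphism. -/
def ofGlobal (f : Γ(sheafHom A B, ⊤)) : A ⟶ B :=
  mkHom (fun U => ev U (res _ le_top f)) (fun {U V} h x => by rw [← ev_res, res_res])

lemma appₗ_ofGlobal (f : Γ(sheafHom A B, ⊤)) (U : S.Opens) (a : Γ(A, U)) :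
    appₗ (ofGlobal f) U a = ev U (res _ le_top f) a := rfl

lemma appₗ_comp {M N K : S.Modules} (φ : M ⟶ N) (ψ : N ⟶ K) (U : S.Opens) (x : Γ(M, U)) :
    appₗ (φ ≫ ψ) U x = appₗ ψ U (appₗ φ U x) := rfl

lemma appₗ_id (M : S.Modules) (U : S.Opens) (x : Γ(M, U)) : appₗ (𝟙 M) U x = x := rfl

lemma appₗ_add {M N : S.Modules} (φ ψ : M ⟶ N) (U : S.Opens) (x : Γ(M, U)) :
    appₗ (φ + ψ) U x = appₗ φ U x + appₗ ψ U x := rfl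

lemma appₗ_sub {M N : S.Modules} (φ ψ : M ⟶ N) (U : S.Opens) (x : Γ(M, U)) :
    appₗ (φ - ψ) U x = appₗ φ U x - appₗ ψ U x := rfl

lemma appₗ_zero {M N : S.Modules} (U : S.Opens) (x : Γ(M, U)) :
    appₗ (0 : M ⟶ N) U x = 0 := rfl

lemma hom_ext_appₗ {M N : S.Modules} {φ ψ : M ⟶ N}
    (h : ∀ (U : S.Opens) (x : Γ(M, U)), appₗ φ U x = appₗ ψ U x) : φ = ψ := by
  ext U x
  exact h U x

lemma ev_psi {E L N : S.Modules} (q : QuadForm E L) (g : N ⟶ E) (U : S.Opens) (v : Γ(E, U))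
    (n : Γ(N, U)) : ev U (appₗ (q.psi g) U v) n = q.b U v (appₗ g U n) := by
  change q.b U (res E le_rfl v) (appₗ g U n) = _
  rw [res_self]

end sheafHom

/-! ### Local nature of sections, frames and isomorphisms -/

/-- Compatible functions on an open covering glue. -/
lemma exists_fglue {U : S.Opens} {ι : Type u} (V : ι → S.Opens) (hV : ∀ i, V i ≤ U)
    (hU : U ≤ iSup V) (s : ∀ i, Γ(S, V i))
    (hs : ∀ i j (W : S.Opens) (hi : W ≤ V i) (hj : W ≤ V j), fres hi (s i) = fres hj (s j)) :
    ∃ t : Γ(S, U), ∀ i, fres (hV i) t = s i :=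
  (TopCat.Sheaf.existsUnique_gluing' S.sheaf
    V U (fun i => homOfLE (hV i)) hU s (fun i j => hs i j _ _ _)).exists

/-- A family of sections that is linearly independent over all smaller open sets and generates
locally is a frame. -/
lemma isFrame_of_locally {M : S.Modules} {U : S.Opens} {ι : Type*} [Fintype ι] (e : ι → Γ(M, U))
    (inj : ∀ (V : S.Opens) (hV : V ≤ U) (c : ι → Γ(S, V)), ∑ i, c i • res M hV (e i) = 0 → c = 0)
    (surj : ∀ (V : S.Opens) (hV : V ≤ U) (y : Γ(M, V)), ∀ x ∈ V, ∃ (W : S.Opens) (hW : W ≤ V),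
      x ∈ W ∧ ∃ c : ι → Γ(S, W), ∑ i, c i • res M (hW.trans hV) (e i) = res M hW y) :
    IsFrame M e := by
  have inj' : ∀ (V : S.Opens) (hV : V ≤ U) (c d : ι → Γ(S, V)),
      ∑ i, c i • res M hV (e i) = ∑ i, d i • res M hV (e i) → c = d := by
    intro V hV c d h
    rw [← sub_eq_zero]
    refine inj V hV _ ?_
    simp [sub_smul, h]
  intro V hV
  refine ⟨fun c d h => inj' V hV c d h, fun y => ?_⟩
  choose W hW hxW c hc using fun x : V => surj V hV y x x.2
  have glue : ∀ i, ∃ t : Γ(S, V), ∀ x, fres (hW x) t = c x i := by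
    intro i
    refine exists_fglue W hW (fun x hx => Opens.mem_iSup.mpr ⟨⟨x, hx⟩, hxW _⟩) (fun x => c x i) ?_
    intro x y W' hi hj
    refine congrFun (inj' W' (hi.trans ((hW x).trans hV)) (fun i => fres hi (c x i))
      (fun i => fres hj (c y i)) ?_) i
    have hx := congrArg (res M hi) (hc x)
    have hy := congrArg (res M hj) (hc y)
    simp only [map_sum, res_smul, res_res] at hx hy
    exact hx.trans hy.symm
  choose t ht using glue
  refine ⟨t, eq_of_locally M _ _ fun x hx => ⟨W ⟨x, hx⟩, hW _, hxW _, ?_⟩⟩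
  rw [← hc]
  simp only [map_sum, res_smul, res_res, ht]

lemma isIso_of_bijective {M N : S.Modules} (φ : M ⟶ N)
    (h : ∀ U, Function.Bijective (appₗ φ U)) : IsIso φ := by
  rw [Scheme.Modules.Hom.isIso_iff_isIso_app]
  intro U
  exact (ConcreteCategory.isIso_iff_bijective (φ.app U)).2 (h U)

/-- A morphism that is bijective on the sections over all sufficiently small open sets is an
isomorphism. -/
lemma isIso_of_locally_bijective {M N : S.Modules} (φ : M ⟶ N)
    (h : ∀ x : S, ∃ U : S.Opens, x ∈ U ∧ ∀ V ≤ U, Function.Bijective (appₗ φ V)) : IsIso φ := by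
  choose U hxU hU using h
  have inj : ∀ V, Function.Injective (appₗ φ V) := by
    intro V a b hab
    refine eq_of_locally M _ _ fun x hx => ⟨V ⊓ U x, inf_le_left, ⟨hx, hxU x⟩, ?_⟩
    apply (hU x _ inf_le_right).1
    rw [appₗ_res, appₗ_res, hab]
  refine isIso_of_bijective φ fun V => ⟨inj V, fun y => ?_⟩
  choose a ha using fun x : V => (hU x.1 (V ⊓ U x) inf_le_right).2 (res N inf_le_left y)
  obtain ⟨t, ht⟩ := exists_glue M (fun x : V => V ⊓ U x) (fun _ => inf_le_left)
    (fun x hx => Opens.mem_iSup.mpr ⟨⟨x, hx⟩, hx, hxU x⟩) a (by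
      intro x y W hi hj
      apply inj
      rw [appₗ_res, appₗ_res, ha, ha, res_res, res_res])
  refine ⟨t, eq_of_locally N _ _ fun x hx => ⟨V ⊓ U x, inf_le_left, ⟨hx, hxU x⟩, ?_⟩⟩
  rw [← appₗ_res, ht ⟨x, hx⟩]
  exact ha ⟨x, hx⟩

/-- A monomorphism of sheaves of modules is injective on sections. -/
lemma injective_of_mono {A B : S.Modules} (f : A ⟶ B) [Mono f] (U : S.Opens) :
    Function.Injective (appₗ f U) := by
  let F : S.Modules ⥤ Ab := Scheme.Modules.toPresheaf S ⋙ (evaluation _ _).obj (op U)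
  have : PreservesLimitsOfShape WalkingCospan ((evaluation (Opens S)ᵒᵖ Ab.{u}).obj (op U)) :=
    evaluation_preservesLimitsOfShape (J := WalkingCospan) (op U)
  have : PreservesLimitsOfShape WalkingCospan F := comp_preservesLimitsOfShape _ _
  exact (AddCommGrpCat.mono_iff_injective (F.map f)).1 inferInstance

/-- A section killed by `f` comes from the kernel of `f`. -/
lemma exists_kernel_section {A B : S.Modules} (f : A ⟶ B) (U : S.Opens) (x : Γ(A, U))
    (hx : appₗ f U x = 0) : ∃ y, appₗ (kernel.ι f) U y = x := by
  let T : ShortComplex S.Modules := ShortComplex.mk (kernel.ι f) f (by simp)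
  have hT : T.Exact := ShortComplex.exact_kernel f
  let F : S.Modules ⥤ Ab := Scheme.Modules.toPresheaf S ⋙ (evaluation _ _).obj (op U)
  have : F.PreservesZeroMorphisms := ⟨fun _ _ => rfl⟩
  have : PreservesLimitsOfShape WalkingParallelPair ((evaluation (Opens S)ᵒᵖ Ab.{u}).obj (op U)) :=
    evaluation_preservesLimitsOfShape (J := WalkingParallelPair) (op U)
  have : PreservesLimitsOfShape WalkingParallelPair F := comp_preservesLimitsOfShape _ _
  have h := hT.map_of_mono_of_preservesKernel F (inferInstanceAs (Mono (kernel.ι f))) inferInstance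
  rw [ShortComplex.ab_exact_iff] at h
  exact h x hx

/-! ### Extension of a sheaf from an open subset -/

section ext

variable (K : S.Modules) (W : S.Opens)

/-- The presheaf `U ↦ K(U ∩ W)`. -/
def extAb : TopCat.Presheaf Ab S where
  obj U := AddCommGrpCat.of Γ(K, U.unop ⊓ W)
  map i := AddCommGrpCat.ofHom (res K (inf_le_inf_right W (leOfHom i.unop)))
  map_id U := by ext y; exact res_self K _ _
  map_comp i j := by ext y; exact (res_res K _ _ _).symm

instance (U : (S.Opens)ᵒᵖ) : Module (S.ringCatSheaf.obj.obj U) ((extAb K W).obj U) :=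
  Module.compHom Γ(K, U.unop ⊓ W) (fres (inf_le_left : U.unop ⊓ W ≤ U.unop))

lemma extAb_isSheaf : (extAb K W).IsSheaf := by
  rw [TopCat.Presheaf.isSheaf_iff_isSheafUniqueGluing]
  intro ι U sf hsf
  obtain ⟨t, ht⟩ := exists_glue (U := iSup U ⊓ W) K (fun i => U i ⊓ W)
    (fun i => inf_le_inf_right W (le_iSup U i)) (by rw [iSup_inf_eq]) sf (by
      intro i j V hi hj
      have h : V ≤ (U i ⊓ U j) ⊓ W :=
        le_inf (le_inf (hi.trans inf_le_left) (hj.trans inf_le_left)) (hi.trans inf_le_right)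
      have := congrArg (res K h) (hsf i j)
      exact (res_res K _ h _).symm.trans (this.trans (res_res K _ h _)))
  refine ⟨t, ht, fun s hs => ?_⟩
  refine eq_of_locally (U := iSup U ⊓ W) K _ _ fun x hx => ?_
  obtain ⟨i, hi⟩ := Opens.mem_iSup.mp hx.1
  exact ⟨U i ⊓ W, inf_le_inf_right W (le_iSup U i), ⟨hi, hx.2⟩, (hs i).trans (ht i).symm⟩

lemma res_inf_smul {U V : S.Opens} (h : V ≤ U) (r : Γ(S, U)) (y : Γ(K, U ⊓ W)) :
    res K (inf_le_inf_right W h) (fres (inf_le_left : U ⊓ W ≤ U) r • y) =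
      fres (inf_le_left : V ⊓ W ≤ V) (fres h r) • res K (inf_le_inf_right W h) y := by
  rw [res_smul, fres_fres, fres_fres]

/-- The sheaf `U ↦ K(U ∩ W)`, that is, `j_* j^* K` for the inclusion `j` of `W`. -/
def extMod : S.Modules :=
  (⟨PresheafOfModules.ofPresheaf (extAb K W) (by
      intro U V i r y
      exact res_inf_smul K W (leOfHom i.unop) r y),
    extAb_isSheaf K W⟩ : SheafOfModules S.ringCatSheaf)

/-- The sections of `extMod K W` over `U` are the sections of `K` over `U ∩ W`. -/
def extEquiv (U : S.Opens) : Γ(extMod K W, U) ≃+ Γ(K, U ⊓ W) := AddEquiv.refl _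

lemma extEquiv_res {U V : S.Opens} (h : V ≤ U) (x : Γ(extMod K W, U)) :
    extEquiv K W V (res _ h x) = res K (inf_le_inf_right W h) (extEquiv K W U x) := rfl

lemma extEquiv_smul {U : S.Opens} (r : Γ(S, U)) (x : Γ(extMod K W, U)) :
    extEquiv K W U (r • x) = fres (inf_le_left : U ⊓ W ≤ U) r • extEquiv K W U x := rfl

/-- The structure sheaf as a module. -/
def unitMod (S : Scheme.{u}) : S.Modules := SheafOfModules.unit S.ringCatSheaf

/-- Sections of the structure sheaf are functions. -/
def unitEquiv (U : S.Opens) : Γ(unitMod S, U) ≃+ Γ(S, U) := AddEquiv.refl _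

lemma unitEquiv_res {U V : S.Opens} (h : V ≤ U) (x : Γ(unitMod S, U)) :
    unitEquiv V (res _ h x) = fres h (unitEquiv U x) := rfl

lemma unitEquiv_smul {U : S.Opens} (r : Γ(S, U)) (x : Γ(unitMod S, U)) :
    unitEquiv U (r • x) = r * unitEquiv U x := rfl

end ext

/-! ### Semilinear maps of sheaves of modules over a morphism of schemes -/

section SemiMap

variable {T : Scheme.{u}} (f : T ⟶ S)

lemma pre_le {U V : S.Opens} (h : V ≤ U) : f ⁻¹ᵁ V ≤ f ⁻¹ᵁ U := fun _ hx => h hx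

lemma pre_inf (U V : S.Opens) : f ⁻¹ᵁ U ⊓ f ⁻¹ᵁ V ≤ f ⁻¹ᵁ (U ⊓ V) := fun _ hx => hx

lemma fres_app {U V : S.Opens} (h : V ≤ U) (r : Γ(S, U)) :
    fres (pre_le f h) (f.app U r) = f.app V (fres h r) :=
  congr($(f.naturality (homOfLE h).op) r).symm

/-- An `f`-semilinear map from `M` to `M'`: a morphism `M → f_* M'`, given on sections. -/
structure SemiMap (M : S.Modules) (M' : T.Modules) where
  app (U : S.Opens) : Γ(M, U) →+ Γ(M', f ⁻¹ᵁ U)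
  app_smul : ∀ (U : S.Opens) (r : Γ(S, U)) (x : Γ(M, U)), app U (r • x) = f.app U r • app U x
  app_res : ∀ {U V : S.Opens} (h : V ≤ U) (x : Γ(M, U)),
    app V (res M h x) = res M' (pre_le f h) (app U x)

variable {f}

/-- The semilinear map given by a morphism `M → f_* M'`. -/
def SemiMap.ofHom {M : S.Modules} {M' : T.Modules}
    (φ : M ⟶ (Scheme.Modules.pushforward f).obj M') : SemiMap f M M' where
  app U := (φ.app U).hom
  app_smul _ r x := φ.app_smul r x
  app_res h x := appₗ_res φ h x

/-- The morphism `M → f_* M'` given by a semilinear map. -/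
def SemiMap.toHom {M : S.Modules} {M' : T.Modules} (φ : SemiMap f M M') :
    M ⟶ (Scheme.Modules.pushforward f).obj M' :=
  mkHom (N := (Scheme.Modules.pushforward f).obj M')
    (fun U => { toFun := φ.app U, map_add' := map_add _, map_smul' := φ.app_smul U })
    (fun h x => φ.app_res h x)

variable (f) in
/-- The pullback of sections as a semilinear map. -/
def pullMap (M : S.Modules) : SemiMap f M ((Scheme.Modules.pullback f).obj M) :=
  SemiMap.ofHom ((Scheme.Modules.pullbackPushforwardAdjunction f).unit.app M)

lemma pullMap_app (M : S.Modules) (U : S.Opens) (x : Γ(M, U)) :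
    (pullMap f M).app U x = pullSec f M U x := rfl

/-- The morphism `f^* M → M'` given by a semilinear map. -/
def SemiMap.desc {M : S.Modules} {M' : T.Modules} (φ : SemiMap f M M') :
    (Scheme.Modules.pullback f).obj M ⟶ M' :=
  ((Scheme.Modules.pullbackPushforwardAdjunction f).homEquiv M M').symm φ.toHom

lemma SemiMap.desc_pullMap {M : S.Modules} {M' : T.Modules} (φ : SemiMap f M M') (U : S.Opens)
    (x : Γ(M, U)) : appₗ φ.desc (f ⁻¹ᵁ U) ((pullMap f M).app U x) = φ.app U x := by
  have h : (Scheme.Modules.pullbackPushforwardAdjunction f).unit.app M ≫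
      (Scheme.Modules.pushforward f).map φ.desc = φ.toHom := by
    exact ((Scheme.Modules.pullbackPushforwardAdjunction f).homEquiv_unit _ _ _).symm.trans
      (Equiv.apply_symm_apply _ _)
  exact congr((Scheme.Modules.Hom.app $h U).hom x)

/-- A morphism out of `f^* M` is determined by its values on the pullbacks of sections. -/
lemma pullback_hom_ext {M : S.Modules} {M' : T.Modules}
    {φ ψ : (Scheme.Modules.pullback f).obj M ⟶ M'}
    (h : ∀ (U : S.Opens) (x : Γ(M, U)), appₗ φ (f ⁻¹ᵁ U) ((pullMap f M).app U x) =
      appₗ ψ (f ⁻¹ᵁ U) ((pullMap f M).app U x)) : φ = ψ := by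
  apply ((Scheme.Modules.pullbackPushforwardAdjunction f).homEquiv M M').injective
  rw [Adjunction.homEquiv_unit, Adjunction.homEquiv_unit]
  exact hom_ext_appₗ h

/-- A semilinear map defined on the sections over the open subsets of `W` only, as a semilinear map
to the extension from the preimage of `W`. -/
def SemiMap.extend {M : S.Modules} {M' : T.Modules} (W : S.Opens)
    (φ : ∀ U : S.Opens, U ≤ W → (Γ(M, U) →+ Γ(M', f ⁻¹ᵁ U)))
    (hsmul : ∀ (U : S.Opens) (hU : U ≤ W) (r : Γ(S, U)) (x : Γ(M, U)),
      φ U hU (r • x) = f.app U r • φ U hU x)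
    (hres : ∀ (U V : S.Opens) (hU : U ≤ W) (h : V ≤ U) (x : Γ(M, U)),
      φ V (h.trans hU) (res M h x) = res M' (pre_le f h) (φ U hU x)) :
    SemiMap f M (extMod M' (f ⁻¹ᵁ W)) where
  app U := (extEquiv M' (f ⁻¹ᵁ W) (f ⁻¹ᵁ U)).symm.toAddMonoidHom.comp
    ((res M' (pre_inf f U W)).comp ((φ (U ⊓ W) inf_le_right).comp (res M inf_le_left)))
  app_smul U r x := by
    apply (extEquiv M' (f ⁻¹ᵁ W) (f ⁻¹ᵁ U)).injective
    rw [extEquiv_smul]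
    refine (congrArg (res M' (pre_inf f U W)) (congrArg (φ (U ⊓ W) inf_le_right)
      (res_smul M inf_le_left r x))).trans ?_
    rw [hsmul, ← fres_app, res_smul, fres_fres]
    rfl
  app_res {U V} h x := by
    apply (extEquiv M' (f ⁻¹ᵁ W) (f ⁻¹ᵁ V)).injective
    rw [extEquiv_res]
    refine (congrArg (res M' (pre_inf f V W)) (congrArg (φ (V ⊓ W) inf_le_right)
      ((res_res M h inf_le_left x).trans
        (res_res M inf_le_left (inf_le_inf_right W h) x).symm))).trans ?_
    rw [hres (U ⊓ W) (V ⊓ W) inf_le_right, res_res]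
    exact (res_res M' _ _ _).symm

/-- The pullback of a frame is a frame. The coordinate functions of the pullback are obtained by
adjunction from those of the given frame. -/
theorem IsFrame.pullMap {M : S.Modules} {U : S.Opens} {ι : Type*} [Fintype ι] {e : ι → Γ(M, U)}
    (he : IsFrame M e) : IsFrame ((Scheme.Modules.pullback f).obj M) fun i =>
      (pullMap f M).app U (e i) := by
  classical
  set P := (Scheme.Modules.pullback f).obj M
  set e' : ι → Γ(P, f ⁻¹ᵁ U) := fun i => (SplitPrinciple.pullMap f M).app U (e i)
  -- the `i`-th coordinate is defined on the sections over open subsets of `U` only, and is extended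
  -- to all of `M` by letting its values be functions on the intersection with the preimage of `U`
  let E (i : ι) : SemiMap f M (extMod (unitMod T) (f ⁻¹ᵁ U)) :=
    SemiMap.extend (f := f) U
    (fun V hV => (unitEquiv (f ⁻¹ᵁ V)).symm.toAddMonoidHom.comp
      ((f.app V).hom.toAddMonoidHom.comp
        ((Pi.evalAddMonoidHom _ i).comp (he.coord hV).toAddMonoidHom)))
    (by
      intro V hV r x
      apply (unitEquiv (f ⁻¹ᵁ V)).injective
      rw [unitEquiv_smul]
      change f.app V (he.coord hV (r • x) i) = _ * f.app V (he.coord hV x i)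
      rw [map_smul, Pi.smul_apply, smul_eq_mul, map_mul])
    (by
      intro V W hV h x
      apply (unitEquiv (f ⁻¹ᵁ W)).injective
      rw [unitEquiv_res]
      change f.app W (he.coord _ (res M h x) i) = fres _ (f.app V (he.coord hV x i))
      rw [he.coord_res hV h, fres_app])
  let ε (i : ι) (V : T.Opens) : Γ(P, V) →+ Γ(T, V ⊓ f ⁻¹ᵁ U) :=
    ((unitEquiv _).toAddMonoidHom.comp (extEquiv _ _ V).toAddMonoidHom).comp
      (appₗ (E i).desc V).toAddMonoidHom
  have ε_smul : ∀ (i : ι) (V : T.Opens) (r : Γ(T, V)) (y : Γ(P, V)),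
      ε i V (r • y) = fres inf_le_left r * ε i V y := by
    intro i V r y
    change unitEquiv _ (extEquiv _ _ V (appₗ (E i).desc V (r • y))) = _
    rw [map_smul, extEquiv_smul, unitEquiv_smul]
    rfl
  have ε_res : ∀ (i : ι) (V V' : T.Opens) (h : V' ≤ V) (y : Γ(P, V)),
      ε i V' (res P h y) = fres (inf_le_inf_right _ h) (ε i V y) := by
    intro i V V' h y
    change unitEquiv _ (extEquiv _ _ V' (appₗ (E i).desc V' (res P h y))) = _
    rw [appₗ_res, extEquiv_res, unitEquiv_res]
    rfl
  have ε_pull : ∀ (i : ι) (V : S.Opens) (x : Γ(M, V)),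
      ε i (f ⁻¹ᵁ V) ((SplitPrinciple.pullMap f M).app V x) =
        fres (pre_inf f V U)
          (f.app (V ⊓ U) (he.coord inf_le_right (res M inf_le_left x) i)) := by
    intro i V x
    change unitEquiv _ (extEquiv _ _ _ (appₗ (E i).desc _ _)) = _
    rw [SemiMap.desc_pullMap]
    rfl
  have ε_self : ∀ i k : ι, ε k (f ⁻¹ᵁ U) (e' i) = if i = k then 1 else 0 := by
    intro i k
    rw [ε_pull, he.coord_self, Pi.single_apply]
    split_ifs <;> simp_all
  -- `σ` multiplies coordinates with the frame, `τ` restricts sections; they agree on pullbacks of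
  -- sections, hence everywhere
  let τ : P ⟶ extMod P (f ⁻¹ᵁ U) := mkHom (N := extMod P (f ⁻¹ᵁ U))
    (fun V => { toFun := fun y => (extEquiv P _ V).symm (res P inf_le_left y)
                map_add' := fun a b => by rw [map_add, map_add]
                map_smul' := fun r a => by
                  apply (extEquiv P _ V).injective
                  rw [RingHom.id_apply, extEquiv_smul]
                  exact res_smul P _ r a })
    (fun {V V'} h y => by
      apply (extEquiv P _ V').injective
      rw [extEquiv_res]
      change res P _ (res P _ y) = res P _ (res P _ y)
      rw [res_res, res_res])
  let σ : P ⟶ extMod P (f ⁻¹ᵁ U) := mkHom (N := extMod P (f ⁻¹ᵁ U))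
    (fun V => { toFun := fun y => (extEquiv P _ V).symm (∑ i, ε i V y • res P inf_le_right (e' i))
                map_add' := fun a b => by
                  rw [← map_add, ← Finset.sum_add_distrib]
                  simp only [map_add, add_smul]
                map_smul' := fun r a => by
                  apply (extEquiv P _ V).injective
                  rw [RingHom.id_apply, extEquiv_smul]
                  simp only [AddEquiv.apply_symm_apply, Finset.smul_sum, ε_smul, mul_smul] })
    (fun {V V'} h y => by
      apply (extEquiv P _ V').injective
      rw [extEquiv_res]
      change ∑ i, ε i V' (res P h y) • res P _ (e' i) = res P _ (∑ i, ε i V y • res P _ (e' i))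
      simp only [map_sum, res_smul, res_res, ε_res])
  have hστ : σ = τ := by
    refine pullback_hom_ext fun V x => ?_
    apply (extEquiv P _ (f ⁻¹ᵁ V)).injective
    change ∑ i, ε i _ ((SplitPrinciple.pullMap f M).app V x) • res P _ (e' i) =
      res P _ ((SplitPrinciple.pullMap f M).app V x)
    simp only [ε_pull]
    have h1 := (SplitPrinciple.pullMap f M).app_res (inf_le_left : V ⊓ U ≤ V) x
    have h2 := congrArg (res P (pre_inf f V U)) h1
    rw [res_res] at h2
    refine Eq.trans ?_ h2
    conv_rhs => rw [← he.sum_coord inf_le_right (res M (inf_le_left : V ⊓ U ≤ V) x)]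
    rw [map_sum, map_sum]
    refine Finset.sum_congr rfl fun i _ => ?_
    rw [SemiMap.app_smul, SemiMap.app_res, res_smul, res_res]
  have sum_ε : ∀ (V : T.Opens) (y : Γ(P, V)),
      ∑ i, ε i V y • res P (inf_le_right : V ⊓ f ⁻¹ᵁ U ≤ f ⁻¹ᵁ U) (e' i) = res P inf_le_left y :=
    fun V y => congrArg (fun φ => extEquiv P _ V (appₗ φ V y)) hστ
  intro V hV
  have hVU : V ≤ V ⊓ f ⁻¹ᵁ U := le_inf le_rfl hV
  have coord : ∀ (c : ι → Γ(T, V)) (k : ι),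
      fres hVU (ε k V (∑ i, c i • res P hV (e' i))) = c k := by
    intro c k
    simp only [map_sum, ε_smul, ε_res, ε_self, map_mul, fres_fres, fres_self]
    rw [Finset.sum_eq_single k (by intro j _ hj; simp [hj]) (by simp)]
    simp
  refine ⟨fun c d h => funext fun k => ?_, fun y => ⟨fun i => fres hVU (ε i V y), ?_⟩⟩
  · rw [← coord c k, ← coord d k]
    exact congrArg (fun y => fres hVU (ε k V y)) h
  · have := congrArg (res P hVU) (sum_ε V y)
    simpa only [map_sum, res_smul, res_res, res_self] using this

end SemiMap

/-! ### Semilinear maps of `Hom` sheaves -/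

section SemiMapHom

variable {T : Scheme.{u}} {f : T ⟶ S}

/-- Locally there are frames of `M` that `φ` maps to frames of `M'`. This holds for the pullback of
sections of a vector bundle and characterizes it. -/
def SemiMap.IsFree {M : S.Modules} {M' : T.Modules} (φ : SemiMap f M M') : Prop :=
  ∀ x : S, ∃ U : S.Opens, x ∈ U ∧ ∃ (ι : Type) (_ : Fintype ι) (e : ι → Γ(M, U)),
    IsFrame M e ∧ IsFrame M' fun i => φ.app U (e i)

lemma pullMap_isFree {M : S.Modules} (hM : IsVectorBundle M) : (pullMap f M).IsFree := by
  intro x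
  obtain ⟨U, hx, n, e, he⟩ := hM.exists_frame x
  exact ⟨U, hx, Fin n, inferInstance, e, he, he.pullMap⟩

variable {A B : S.Modules} {A' B' : T.Modules}

lemma IsFrame.app_restrict {φ : SemiMap f A A'} {U : S.Opens} {ι : Type*} [Fintype ι]
    {e : ι → Γ(A, U)} (he : IsFrame A' fun i => φ.app U (e i)) {V : S.Opens} (hV : V ≤ U) :
    IsFrame A' fun i => φ.app V (res A hV (e i)) := by
  simpa only [φ.app_res] using he.restrict (pre_le f hV)

/-- A homomorphism out of `A'` is determined by its values on the sections `α a`. -/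
lemma SemiMap.IsFree.sheafHom_ext {α : SemiMap f A A'} (hα : α.IsFree) {U : S.Opens}
    {s t : Γ(sheafHom A' B', f ⁻¹ᵁ U)}
    (h : ∀ (V : S.Opens) (hV : V ≤ U) (a : Γ(A, V)), ev _ (res _ (pre_le f hV) s) (α.app V a) =
      ev _ (res _ (pre_le f hV) t) (α.app V a)) : s = t := by
  refine eq_of_locally _ _ _ fun y hy => ?_
  obtain ⟨V, hyV, ι, _, e, -, he⟩ := hα (f y)
  refine ⟨f ⁻¹ᵁ (U ⊓ V), pre_le f inf_le_left, ⟨hy, hyV⟩, ?_⟩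
  refine he.sheafHom_ext (pre_le f inf_le_right) fun i => ?_
  rw [← α.app_res inf_le_right]
  exact h _ inf_le_left _

/-- The homomorphism `s'` is defined on the frames that `α` provides, and glued. -/
lemma SemiMap.IsFree.exists_hom {α : SemiMap f A A'} (hα : α.IsFree) (β : SemiMap f B B')
    (U : S.Opens) (s : Γ(sheafHom A B, U)) : ∃ s' : Γ(sheafHom A' B', f ⁻¹ᵁ U),
      ∀ (V : S.Opens) (hV : V ≤ U) (a : Γ(A, V)),
        ev _ (res _ (pre_le f hV) s') (α.app V a) = β.app V (ev V (res _ hV s) a) := by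
  choose W hxW ι hι e he he' using hα
  let b (x : S) (i : ι x) : Γ(B, U ⊓ W x) := ev _ (res _ inf_le_left s) (res A inf_le_right (e x i))
  have hr (x : S) : IsFrame A' fun i => α.app (U ⊓ W x) (res A inf_le_right (e x i)) :=
    (he' x).app_restrict inf_le_right
  let s' (x : S) : Γ(sheafHom A' B', f ⁻¹ᵁ (U ⊓ W x)) := (hr x).lift fun i => β.app _ (b x i)
  have hs' : ∀ (x : S) (V : S.Opens) (hV : V ≤ U ⊓ W x) (a : Γ(A, V)),
      ev _ (res _ (pre_le f hV) (s' x)) (α.app V a) =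
        β.app V (ev V (res _ (hV.trans inf_le_left) s) a) := by
    intro x V hV a
    rw [← (he x).sum_coord (hV.trans inf_le_right) a]
    simp only [map_sum, map_smul, SemiMap.app_smul]
    refine Finset.sum_congr rfl fun i _ => congrArg _ ?_
    rw [← res_res A inf_le_right hV, α.app_res, ev_res]
    simp only [s']
    rw [(hr x).ev_lift_self, ← β.app_res, ← res_res _ inf_le_left hV, ev_res]
  obtain ⟨t, ht⟩ := exists_glue (U := f ⁻¹ᵁ U) (sheafHom A' B') (fun y : f ⁻¹ᵁ U =>
    f ⁻¹ᵁ (U ⊓ W (f y.1))) (fun _ => pre_le f inf_le_left)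
    (fun y hy => Opens.mem_iSup.mpr ⟨⟨y, hy⟩, hy, hxW _⟩) (fun y => s' (f y.1)) (by
      intro y z V hy hz
      have hle : V ≤ f ⁻¹ᵁ ((U ⊓ W (f y.1)) ⊓ (U ⊓ W (f z.1))) := (le_inf hy hz).trans
        (pre_inf f _ _)
      have h : res (sheafHom A' B') (pre_le f inf_le_left) (s' (f y.1)) =
          res (sheafHom A' B') (pre_le f (inf_le_right :
            (U ⊓ W (f y.1)) ⊓ (U ⊓ W (f z.1)) ≤ _)) (s' (f z.1)) := by
        refine SemiMap.IsFree.sheafHom_ext (α := α)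
          (fun x => ⟨W x, hxW x, ι x, hι x, e x, he x, he' x⟩) fun V hV a => ?_
        rw [res_res, res_res, hs' _ _ (hV.trans inf_le_left), hs' _ _ (hV.trans inf_le_right)]
      have := congrArg (res _ hle) h
      rwa [res_res, res_res] at this)
  refine ⟨t, fun V hV a => eq_of_locally _ _ _ fun y hy => ?_⟩
  have hle : V ⊓ W (f y) ≤ U ⊓ W (f y) := inf_le_inf_right _ hV
  refine ⟨f ⁻¹ᵁ (V ⊓ W (f y)), pre_le f inf_le_left, ⟨hy, hxW _⟩, ?_⟩
  rw [← ev_res, res_res, ← α.app_res, ← β.app_res, ← ev_res, res_res]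
  have := hs' (f y) _ hle (res A inf_le_left a)
  rw [← ht ⟨y, hV hy⟩, res_res] at this
  exact this

/-- The homomorphism `s'` with `s' (α a) = β (s a)`. -/
def SemiMap.IsFree.homFun {α : SemiMap f A A'} (hα : α.IsFree) (β : SemiMap f B B') (U : S.Opens)
    (s : Γ(sheafHom A B, U)) : Γ(sheafHom A' B', f ⁻¹ᵁ U) := (hα.exists_hom β U s).choose

lemma SemiMap.IsFree.ev_homFun {α : SemiMap f A A'} (hα : α.IsFree) (β : SemiMap f B B')
    (U : S.Opens) (s : Γ(sheafHom A B, U)) (V : S.Opens) (hV : V ≤ U) (a : Γ(A, V)) :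
    ev _ (res _ (pre_le f hV) (hα.homFun β U s)) (α.app V a) = β.app V (ev V (res _ hV s) a) :=
  (hα.exists_hom β U s).choose_spec V hV a

/-- The semilinear map on `Hom` sheaves: `h ↦ h'`, where `h' (α a) = β (h a)`. -/
def SemiMap.hom (α : SemiMap f A A') (hα : α.IsFree) (β : SemiMap f B B') :
    SemiMap f (sheafHom A B) (sheafHom A' B') where
  app U := AddMonoidHom.mk' (hα.homFun β U) fun s t => hα.sheafHom_ext fun V hV a => by
    rw [hα.ev_homFun β U _ V hV]
    simp only [map_add, LinearMap.add_apply]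
    rw [hα.ev_homFun β U s V hV, hα.ev_homFun β U t V hV]
  app_smul U r s := hα.sheafHom_ext fun V hV a => by
    simp only [AddMonoidHom.mk'_apply]
    rw [hα.ev_homFun β U _ V hV, res_smul, res_smul, map_smul, map_smul, LinearMap.smul_apply,
      LinearMap.smul_apply, hα.ev_homFun β U s V hV, SemiMap.app_smul, fres_app]
  app_res {U V} h s := hα.sheafHom_ext fun W hW a => by
    simp only [AddMonoidHom.mk'_apply]
    rw [hα.ev_homFun β V _ W hW, res_res, res_res, hα.ev_homFun β U s W (hW.trans h)]

lemma SemiMap.ev_hom (α : SemiMap f A A') (hα : α.IsFree) (β : SemiMap f B B') (U : S.Opens)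
    (s : Γ(sheafHom A B, U)) (a : Γ(A, U)) :
    ev _ ((α.hom hα β).app U s) (α.app U a) = β.app U (ev U s a) := by
  have := hα.ev_homFun β U s U le_rfl a
  rwa [res_self, res_self] at this

lemma SemiMap.hom_lift {α : SemiMap f A A'} (hα : α.IsFree) (β : SemiMap f B B') {U : S.Opens}
    {ι : Type*} [Fintype ι] {e : ι → Γ(A, U)} (he : IsFrame A e)
    (he' : IsFrame A' fun i => α.app U (e i)) (b : ι → Γ(B, U)) :
    (α.hom hα β).app U (he.lift b) = he'.lift fun i => β.app U (b i) := by
  refine he'.sheafHom_ext le_rfl fun i => ?_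
  rw [res_self, α.ev_hom hα β, he.ev_lift_self, he'.ev_lift_self]

lemma SemiMap.IsFree.hom {α : SemiMap f A A'} (hα : α.IsFree) {β : SemiMap f B B'}
    (hβ : β.IsFree) : (α.hom hα β).IsFree := by
  classical
  intro x
  obtain ⟨U, hU, ι, _, e, he, he'⟩ := hα x
  obtain ⟨V, hV, κ, _, b, hb, hb'⟩ := hβ x
  have h1 := he.restrict (inf_le_left : U ⊓ V ≤ U)
  have h2 := hb.restrict (inf_le_right : U ⊓ V ≤ V)
  have h1' := IsFrame.app_restrict he' (inf_le_left : U ⊓ V ≤ U)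
  have h2' := IsFrame.app_restrict hb' (inf_le_right : U ⊓ V ≤ V)
  refine ⟨U ⊓ V, ⟨hU, hV⟩, ι × κ, inferInstance, _, h1.sheafHom h2, ?_⟩
  convert! h1'.sheafHom h2' using 2 with p
  rw [SemiMap.hom_lift hα β h1 h1']
  congr 1
  funext i
  obtain rfl | h := eq_or_ne p.1 i <;> simp [*, Ne.symm]

lemma SemiMap.IsFree.hom_ext {α : SemiMap f A A'} (hα : α.IsFree) {φ ψ : A' ⟶ B'}
    (h : ∀ (U : S.Opens) (a : Γ(A, U)), appₗ φ _ (α.app U a) = appₗ ψ _ (α.app U a)) : φ = ψ := by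
  refine hom_ext_appₗ fun V x => eq_of_locally _ _ _ fun y hy => ?_
  obtain ⟨U, hyU, ι, _, e, -, he⟩ := hα (f y)
  refine ⟨V ⊓ f ⁻¹ᵁ U, inf_le_left, ⟨hy, hyU⟩, ?_⟩
  rw [← appₗ_res, ← appₗ_res]
  exact he.hom_ext (fun i => h U (e i)) inf_le_right _

end SemiMapHom

/-! ### Affine frames and changes of coordinates -/

/-- An affine frame over `U` of the subsheaf of sets `X` of a sheaf of modules `H`: sections `s` and
`h i` such that `c ↦ s + ∑ i, c i • h i` is a bijection from `𝒪 ^ n` to `X` over all open subsets of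
`U`. -/
structure AffFrame (H : S.Modules) (X : ∀ U : S.Opens, Set Γ(H, U)) where
  U : S.Opens
  n : ℕ
  s : Γ(H, U)
  h : Fin n → Γ(H, U)
  bij : ∀ (V : S.Opens) (hV : V ≤ U), Set.BijOn
    (fun c : Fin n → Γ(S, V) => res H hV s + ∑ i, c i • res H hV (h i)) Set.univ (X V)

namespace AffFrame

variable {H : S.Modules} {X : ∀ U : S.Opens, Set Γ(H, U)}

/-- Affine frames are ordered by their domains. -/
instance : Preorder (AffFrame H X) := Preorder.lift AffFrame.U

lemma U_le {σ τ : AffFrame H X} (h : σ ≤ τ) : σ.U ≤ τ.U := h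

/-- The restriction of an affine frame. -/
def restrict (σ : AffFrame H X) {V : S.Opens} (hV : V ≤ σ.U) : AffFrame H X where
  U := V
  n := σ.n
  s := res H hV σ.s
  h i := res H hV (σ.h i)
  bij W hW := by simpa only [res_res] using σ.bij W (hW.trans hV)

lemma indep (τ : AffFrame H X) {V : S.Opens} (hV : V ≤ τ.U) {c d : Fin τ.n → Γ(S, V)}
    (h : ∑ i, c i • res H hV (τ.h i) = ∑ i, d i • res H hV (τ.h i)) : c = d :=
  (τ.bij V hV).2.1 (Set.mem_univ c) (Set.mem_univ d) (by simp only [h])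

lemma s_mem (σ : AffFrame H X) : σ.s ∈ X σ.U := by
  simpa [res_self] using (σ.bij σ.U le_rfl).1 (Set.mem_univ 0)

lemma s_add_mem (σ : AffFrame H X) (k : Fin σ.n) : σ.s + σ.h k ∈ X σ.U := by
  simpa [res_self, Pi.single_apply, ite_smul] using
    (σ.bij σ.U le_rfl).1 (Set.mem_univ (Pi.single k 1))

lemma exists_trans₀ {σ τ : AffFrame H X} (h : σ ≤ τ) : ∃ c : Fin τ.n → Γ(S, σ.U),
    res H (U_le h) τ.s + ∑ l, c l • res H (U_le h) (τ.h l) = σ.s := by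
  obtain ⟨c, -, hc⟩ := (τ.bij σ.U h).2.2 σ.s_mem
  exact ⟨c, hc⟩

/-- The coordinates of the origin of `σ` in the affine frame `τ`. -/
def trans₀ {σ τ : AffFrame H X} (h : σ ≤ τ) : Fin τ.n → Γ(S, σ.U) := (exists_trans₀ h).choose

lemma trans₀_spec {σ τ : AffFrame H X} (h : σ ≤ τ) :
    res H (U_le h) τ.s + ∑ l, trans₀ h l • res H (U_le h) (τ.h l) = σ.s :=
  (exists_trans₀ h).choose_spec

lemma exists_trans₁ {σ τ : AffFrame H X} (h : σ ≤ τ) (k : Fin σ.n) : ∃ d : Fin τ.n → Γ(S, σ.U),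
    ∑ l, d l • res H (U_le h) (τ.h l) = σ.h k := by
  obtain ⟨c, -, hc⟩ := (τ.bij σ.U h).2.2 (σ.s_add_mem k)
  refine ⟨c - trans₀ h, ?_⟩
  have h0 := trans₀_spec h
  simp only [Pi.sub_apply, sub_smul, Finset.sum_sub_distrib]
  have hc' : res H (U_le h) τ.s + ∑ l, c l • res H (U_le h) (τ.h l) = σ.s + σ.h k := hc
  rw [sub_eq_iff_eq_add]
  rw [← h0, add_assoc, add_left_cancel_iff] at hc'
  rw [hc', add_comm]

/-- The coordinates of the `k`-th direction of `σ` in the affine frame `τ`. -/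
def trans₁ {σ τ : AffFrame H X} (h : σ ≤ τ) (k : Fin σ.n) : Fin τ.n → Γ(S, σ.U) :=
  (exists_trans₁ h k).choose

lemma trans₁_spec {σ τ : AffFrame H X} (h : σ ≤ τ) (k : Fin σ.n) :
    ∑ l, trans₁ h k l • res H (U_le h) (τ.h l) = σ.h k :=
  (exists_trans₁ h k).choose_spec

lemma trans₀_eq {σ τ : AffFrame H X} (h : σ ≤ τ) {c : Fin τ.n → Γ(S, σ.U)}
    (hc : res H (U_le h) τ.s + ∑ l, c l • res H (U_le h) (τ.h l) = σ.s) : trans₀ h = c :=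
  τ.indep h (add_left_cancel ((trans₀_spec h).trans hc.symm))

lemma trans₁_eq {σ τ : AffFrame H X} (h : σ ≤ τ) (k : Fin σ.n) {d : Fin τ.n → Γ(S, σ.U)}
    (hd : ∑ l, d l • res H (U_le h) (τ.h l) = σ.h k) : trans₁ h k = d :=
  τ.indep h ((trans₁_spec h k).trans hd.symm)

/-- The change of coordinates from `σ` to `τ` on points with values in a ring `A`. -/
def chg {σ τ : AffFrame H X} (h : σ ≤ τ) {A : Type*} [CommRing A] (φ : Γ(S, σ.U) →+* A)
    (x : Fin σ.n → A) (l : Fin τ.n) : A :=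
  φ (trans₀ h l) + ∑ k, x k * φ (trans₁ h k l)

lemma map_chg {σ τ : AffFrame H X} (h : σ ≤ τ) {A B : Type*} [CommRing A] [CommRing B]
    (φ : Γ(S, σ.U) →+* A) (ψ : A →+* B) (x : Fin σ.n → A) (l : Fin τ.n) :
    ψ (chg h φ x l) = chg h (ψ.comp φ) (fun k => ψ (x k)) l := by
  simp [chg]

lemma chg_self {σ : AffFrame H X} (h : σ ≤ σ) {A : Type*} [CommRing A] (φ : Γ(S, σ.U) →+* A)
    (x : Fin σ.n → A) : chg h φ x = x := by
  have h0 : trans₀ h = 0 := trans₀_eq h (by simp [res_self])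
  have h1 : ∀ k, trans₁ h k = Pi.single k 1 := fun k =>
    trans₁_eq h k (by simp [res_self, Pi.single_apply, ite_smul])
  funext l
  simp [chg, h0, h1, Pi.single_apply]

lemma chg_chg {σ τ ρ : AffFrame H X} (h : σ ≤ τ) (h' : τ ≤ ρ) {A : Type*} [CommRing A]
    (φ : Γ(S, σ.U) →+* A) (x : Fin σ.n → A) :
    chg h' (φ.comp (fres (U_le h))) (chg h φ x) = chg (h.trans h') φ x := by
  have key : ∀ k : Fin τ.n, ∑ l, fres (U_le h) (trans₁ h' k l) • res H (U_le (h.trans h')) (ρ.h l) =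
      res H (U_le h) (τ.h k) := by
    intro k
    rw [← trans₁_spec h' k]
    simp only [map_sum, res_smul, res_res]
  have h0 : trans₀ (h.trans h') = fun l => fres (U_le h) (trans₀ h' l) +
      ∑ m, trans₀ h m * fres (U_le h) (trans₁ h' m l) := by
    refine trans₀_eq (h.trans h') ?_
    rw [← trans₀_spec h, ← trans₀_spec h']
    simp only [map_add, map_sum, res_smul, res_res, add_smul, Finset.sum_smul, mul_smul,
      Finset.sum_add_distrib, ← key, Finset.smul_sum]
    rw [Finset.sum_comm, add_assoc]
  have h1 : ∀ k, trans₁ (h.trans h') k = fun l =>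
      ∑ m, trans₁ h k m * fres (U_le h) (trans₁ h' m l) := by
    intro k
    refine trans₁_eq (h.trans h') k ?_
    rw [← trans₁_spec h]
    simp only [Finset.sum_smul, mul_smul, ← key, Finset.smul_sum]
    rw [Finset.sum_comm]
  funext l
  simp only [chg, h0, h1, map_add, map_sum, map_mul, RingHom.comp_apply, add_mul, Finset.sum_mul,
    Finset.mul_sum, Finset.sum_add_distrib, mul_assoc]
  rw [add_assoc, Finset.sum_comm]

end AffFrame

/-! ### The affine space of an affine frame -/

/-- The ring homomorphism on functions given by a morphism `Y → U`. -/
def pullFun {U : S.Opens} {Y : Scheme.{u}} (g : Y ⟶ U.toScheme) : Γ(S, U) →+* Γ(Y, ⊤) :=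
  (U.topIso.inv ≫ g.appTop).hom

lemma pullFun_comp {U : S.Opens} {Y Z : Scheme.{u}} (k : Z ⟶ Y) (g : Y ⟶ U.toScheme) :
    pullFun (k ≫ g) = k.appTop.hom.comp (pullFun g) := by
  rw [pullFun, Scheme.Hom.comp_appTop, ← Category.assoc]
  rfl

lemma pullFun_homOfLE {U V : S.Opens} (h : U ≤ V) {Y : Scheme.{u}} (g : Y ⟶ U.toScheme) :
    pullFun (g ≫ S.homOfLE h) = (pullFun g).comp (fres h) := by
  have : V.topIso.inv ≫ (S.homOfLE h).appTop = S.presheaf.map (homOfLE h).op ≫ U.topIso.inv := by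
    rw [Scheme.homOfLE_appTop]
    change S.presheaf.map _ ≫ _ = _ ≫ S.presheaf.map _
    exact (S.presheaf.map_comp _ _).symm.trans
      ((congrArg S.presheaf.map (Subsingleton.elim _ _)).trans (S.presheaf.map_comp _ _))
  rw [pullFun, Scheme.Hom.comp_appTop, ← Category.assoc, this, Category.assoc]
  rfl

namespace AffFrame

variable {H : S.Modules} {X : ∀ U : S.Opens, Set Γ(H, U)}

/-- The affine space attached to an affine frame. -/
def space (σ : AffFrame H X) : Scheme.{u} := 𝔸(ULift.{u} (Fin σ.n); σ.U.toScheme)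

/-- The projection of the affine space to the domain of the frame. -/
def proj (σ : AffFrame H X) : σ.space ⟶ σ.U.toScheme :=
  𝔸(ULift.{u} (Fin σ.n); σ.U.toScheme) ↘ σ.U.toScheme

/-- The coordinate functions on the affine space. -/
def coord (σ : AffFrame H X) (k : Fin σ.n) : Γ(σ.space, ⊤) := AffineSpace.coord _ ⟨k⟩

/-- The morphism to the affine space with given coordinates. -/
def lift (σ : AffFrame H X) {Y : Scheme.{u}} (g : Y ⟶ σ.U.toScheme) (x : Fin σ.n → Γ(Y, ⊤)) :
    Y ⟶ σ.space := AffineSpace.homOfVector g fun k => x k.down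

lemma lift_proj (σ : AffFrame H X) {Y : Scheme.{u}} (g : Y ⟶ σ.U.toScheme)
    (x : Fin σ.n → Γ(Y, ⊤)) : σ.lift g x ≫ σ.proj = g := AffineSpace.homOfVector_over _ _

lemma lift_coord (σ : AffFrame H X) {Y : Scheme.{u}} (g : Y ⟶ σ.U.toScheme)
    (x : Fin σ.n → Γ(Y, ⊤)) (k : Fin σ.n) : (σ.lift g x).appTop (σ.coord k) = x k :=
  AffineSpace.homOfVector_appTop_coord _ _ _

lemma hom_ext (σ : AffFrame H X) {Y : Scheme.{u}} {a b : Y ⟶ σ.space} (h : a ≫ σ.proj = b ≫ σ.proj)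
    (h' : ∀ k, a.appTop (σ.coord k) = b.appTop (σ.coord k)) : a = b :=
  AffineSpace.hom_ext h fun k => h' k.down

/-- The map of affine spaces given by the change of coordinates. -/
def map {σ τ : AffFrame H X} (h : σ ≤ τ) : σ.space ⟶ τ.space :=
  τ.lift (σ.proj ≫ S.homOfLE (U_le h)) (chg h (pullFun σ.proj) σ.coord)

lemma map_proj {σ τ : AffFrame H X} (h : σ ≤ τ) :
    map h ≫ τ.proj = σ.proj ≫ S.homOfLE (U_le h) := lift_proj _ _ _

lemma appTop_map {σ τ : AffFrame H X} (h : σ ≤ τ) {Y : Scheme.{u}} (a : Y ⟶ σ.space)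
    (l : Fin τ.n) : (a ≫ map h).appTop (τ.coord l) =
      chg h (pullFun (a ≫ σ.proj)) (fun k => a.appTop (σ.coord k)) l := by
  rw [Scheme.Hom.comp_appTop, CommRingCat.comp_apply, map, lift_coord, pullFun_comp]
  exact map_chg h _ a.appTop.hom _ l

lemma map_self {σ : AffFrame H X} (h : σ ≤ σ) : map h = 𝟙 _ := by
  refine hom_ext _ ?_ fun k => ?_
  · rw [map_proj, Scheme.homOfLE_rfl, Category.comp_id, Category.id_comp]
  · rw [map, lift_coord, chg_self]
    simp

lemma map_map {σ τ ρ : AffFrame H X} (h : σ ≤ τ) (h' : τ ≤ ρ) :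
    map h ≫ map h' = map (h.trans h') := by
  refine hom_ext _ ?_ fun k => ?_
  · rw [Category.assoc, map_proj, ← Category.assoc, map_proj, map_proj, Category.assoc,
      Scheme.homOfLE_homOfLE]
  · rw [appTop_map, map_proj, pullFun_homOfLE, map, map, lift_coord]
    simp only [lift_coord]
    rw [chg_chg h h']

/-- The affine space of a restricted frame is the restriction of the affine space. -/
lemma map_restrict (τ : AffFrame H X) {V : S.Opens} (hV : V ≤ τ.U) :
    IsPullback (map (show τ.restrict hV ≤ τ from hV)) (τ.restrict hV).proj τ.proj
      (S.homOfLE hV) := by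
  have h : (τ.restrict hV) ≤ τ := hV
  have h0 : trans₀ h = 0 := trans₀_eq h (by
    change res H hV τ.s + ∑ l, (0 : Fin τ.n → Γ(S, V)) l • res H hV (τ.h l) = res H hV τ.s
    simp)
  have h1 : ∀ k : Fin τ.n, trans₁ h k = fun l => if l = k then 1 else 0 := fun k =>
    trans₁_eq h k (by
      change ∑ l, (if l = k then (1 : Γ(S, V)) else 0) • res H hV (τ.h l) = res H hV (τ.h k)
      simp [ite_smul])
  have : map h = AffineSpace.map (ULift.{u} (Fin τ.n)) (S.homOfLE hV) := by
    refine hom_ext _ ?_ fun k => ?_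
    · rw [map_proj]
      exact (AffineSpace.map_over _).symm
    · rw [map, lift_coord]
      refine Eq.trans ?_ (AffineSpace.map_appTop_coord (n := ULift.{u} (Fin τ.n))
        (S.homOfLE hV) ⟨k⟩).symm
      change (pullFun _) (trans₀ h k) + ∑ m : Fin τ.n, (τ.restrict hV).coord m *
        (pullFun (τ.restrict hV).proj) (trans₁ h m k) = _
      simp only [h0, h1, Pi.zero_apply, map_zero, zero_add, apply_ite (pullFun _), map_one,
        mul_ite, mul_one, mul_zero]
      exact (Finset.sum_ite_eq Finset.univ k fun x => (τ.restrict hV).coord x).trans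
        (if_pos (Finset.mem_univ _))
  change IsPullback (map h) _ _ _
  rw [this]
  exact AffineSpace.isPullback_map _

/-- For `σ ≤ τ` the change of coordinates is an isomorphism from the affine space of `σ` to that of
the restriction of `τ`; this reduces the claim to `map_restrict`. -/
lemma isPullback_map {σ τ : AffFrame H X} (h : σ ≤ τ) :
    IsPullback (map h) σ.proj τ.proj (S.homOfLE (U_le h)) := by
  -- frames with the same domain are comparable both ways, so that `map h1` is invertible
  have h1 : σ ≤ τ.restrict (U_le h) := le_refl σ.U
  have h2 : τ.restrict (U_le h) ≤ σ := le_refl σ.U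
  have h3 : τ.restrict (U_le h) ≤ τ := U_le h
  have iso : IsIso (map h1) := ⟨map h2, by rw [map_map, map_self], by rw [map_map, map_self]⟩
  have hid : IsIso (S.homOfLE (U_le h1)) := by
    change IsIso (S.homOfLE (le_refl σ.U))
    rw [Scheme.homOfLE_rfl]
    infer_instance
  have sq := (IsPullback.of_horiz_isIso ⟨map_proj h1⟩).paste_horiz (map_restrict τ (U_le h))
  rw [map_map] at sq
  exact Scheme.homOfLE_homOfLE S (le_refl σ.U) (U_le h) ▸ sq

/-! ### Gluing of the affine spaces -/

/-- Locally on `S` there are affine frames. -/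
def Covers (H : S.Modules) (X : ∀ U : S.Opens, Set Γ(H, U)) : Prop :=
  ∀ x : S, ∃ σ : AffFrame H X, x ∈ σ.U

variable (hX : Covers H X)

/-- The open cover of `S` by the domains of the affine frames. -/
def cover : S.OpenCover where
  I₀ := AffFrame H X
  X σ := σ.U
  f σ := σ.U.ι
  mem₀ := by
    rw [Scheme.presieve₀_mem_precoverage_iff]
    refine ⟨fun x => ?_, inferInstance⟩
    obtain ⟨σ, hσ⟩ := hX x
    exact ⟨σ, by simpa using hσ⟩

instance : Preorder (cover hX).I₀ := inferInstanceAs (Preorder (AffFrame H X))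

instance : (cover hX).LocallyDirected :=
  .ofIsBasisOpensRange (fun {i j} => by
    change AffFrame.U i ≤ AffFrame.U j ↔ (AffFrame.U i).ι.opensRange ≤ (AffFrame.U j).ι.opensRange
    rw [Scheme.Opens.opensRange_ι, Scheme.Opens.opensRange_ι]) <| by
    rw [TopologicalSpace.Opens.isBasis_iff_nbhd]
    intro U x hx
    obtain ⟨σ, hσ⟩ := hX x
    refine ⟨U ⊓ σ.U, ⟨σ.restrict (inf_le_right : U ⊓ σ.U ≤ σ.U), ?_⟩, ⟨hx, hσ⟩, inf_le_left⟩
    exact Scheme.Opens.opensRange_ι _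

/-- The gluing datum given by the affine spaces of all affine frames. -/
def gluing : (cover hX).RelativeGluingData where
  functor :=
    { obj := fun σ => space σ
      map := fun h => map (leOfHom h)
      map_id := fun _ => map_self _
      map_comp := fun _ _ => (map_map _ _).symm }
  natTrans :=
    { app := fun σ => proj σ
      naturality := fun _ _ h => map_proj (leOfHom h) }
  equifibered {_ _} h := isPullback_map (leOfHom h)

end AffFrame

namespace AffFrame

variable {H : S.Modules} {X : ∀ U : S.Opens, Set Γ(H, U)} (hX : Covers H X)

/-- The total space of the affine bundle defined by `X`. -/
def total : Scheme.{u} := (gluing hX).glued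

/-- The projection of the affine bundle. -/
def toBase : total hX ⟶ S := (gluing hX).toBase

/-- The inclusion of the affine space of a frame. -/
def incl (σ : AffFrame H X) : σ.space ⟶ total hX := colimit.ι (gluing hX).functor σ

lemma isPullback_incl (σ : AffFrame H X) :
    IsPullback σ.proj (incl hX σ) σ.U.ι (toBase hX) :=
  (gluing hX).isPullback_natTrans_ι_toBase σ

lemma map_incl {σ τ : AffFrame H X} (h : σ ≤ τ) : map h ≫ incl hX τ = incl hX σ :=
  colimit.w (gluing hX).functor (homOfLE h : (show (cover hX).I₀ from σ) ⟶ τ)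

/-- The preimage of the domain of a frame is the affine space. -/
def preimageIso (σ : AffFrame H X) : (toBase hX ⁻¹ᵁ σ.U).toScheme ≅ σ.space :=
  (isPullback_morphismRestrict (toBase hX) σ.U).isoIsPullback _ _ (isPullback_incl hX σ)

lemma preimageIso_proj (σ : AffFrame H X) :
    (preimageIso hX σ).hom ≫ σ.proj = toBase hX ∣_ σ.U :=
  IsPullback.isoIsPullback_hom_fst _ _ _ _

lemma preimageIso_incl (σ : AffFrame H X) :
    (preimageIso hX σ).hom ≫ incl hX σ = (toBase hX ⁻¹ᵁ σ.U).ι :=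
  IsPullback.isoIsPullback_hom_snd _ _ _ _

lemma isAffineBundle_toBase : IsAffineBundle (toBase hX) := by
  intro x
  obtain ⟨σ, hσ⟩ := hX x
  exact ⟨σ.U, hσ, σ.n, preimageIso hX σ, preimageIso_proj hX σ⟩

lemma homOfLE_preimageIso {σ τ : AffFrame H X} (h : σ ≤ τ) :
    (total hX).homOfLE (pre_le (toBase hX) (U_le h)) ≫ (preimageIso hX τ).hom =
      (preimageIso hX σ).hom ≫ map h := by
  have : Mono (incl hX τ) := by
    have := MorphismProperty.of_isPullback (P := MorphismProperty.monomorphisms Scheme)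
      (isPullback_incl hX τ) (inferInstanceAs (Mono _))
    exact this
  rw [← cancel_mono (incl hX τ), Category.assoc, Category.assoc, preimageIso_incl, map_incl,
    preimageIso_incl, Scheme.homOfLE_ι]

/-- The coordinate functions on the preimage in the total space of the domain of a frame. -/
def tautCoord (σ : AffFrame H X) (k : Fin σ.n) : Γ(total hX, toBase hX ⁻¹ᵁ σ.U) :=
  (toBase hX ⁻¹ᵁ σ.U).topIso.hom ((preimageIso hX σ).hom.appTop (σ.coord k))

lemma topIso_pullFun {T : Scheme.{u}} (f : T ⟶ S) (U : S.Opens) :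
    (f ⁻¹ᵁ U).topIso.hom.hom.comp (pullFun (f ∣_ U)) = (f.app U).hom := by
  have h : U.topIso.inv ≫ (f ∣_ U).appTop ≫ (f ⁻¹ᵁ U).topIso.hom = f.app U := by
    rw [morphismRestrict_appTop]
    have aux : ∀ {W : S.Opens} (hW : U = W) (i : op U ⟶ op W) {A : T.Opens}
        (j : op (f ⁻¹ᵁ W) ⟶ op A) (k : op A ⟶ op (f ⁻¹ᵁ U)),
        S.presheaf.map i ≫ (f.app W ≫ T.presheaf.map j) ≫ T.presheaf.map k = f.app U := by
      rintro W rfl i A j k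
      rw [Category.assoc, ← T.presheaf.map_comp, Subsingleton.elim i (𝟙 _),
        Subsingleton.elim (j ≫ k) (𝟙 _)]
      simp
    exact aux U.ι_image_top.symm _ _ _
  rw [← h]
  rfl

lemma fres_topIso {U V : S.Opens} (h : V ≤ U) (a : Γ(U.toScheme, ⊤)) :
    fres h (U.topIso.hom a) = V.topIso.hom ((S.homOfLE h).appTop a) := by
  have h1 : U.topIso.hom ≫ S.presheaf.map (homOfLE h).op =
      (S.homOfLE h).appTop ≫ V.topIso.hom := by
    rw [Scheme.homOfLE_appTop]
    change S.presheaf.map _ ≫ _ = _ ≫ S.presheaf.map _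
    exact (S.presheaf.map_comp _ _).symm.trans
      ((congrArg S.presheaf.map (Subsingleton.elim _ _)).trans (S.presheaf.map_comp _ _))
  exact congr($h1 a)

/-- The coordinate functions for different frames differ by the change of coordinates. -/
lemma fres_tautCoord {σ τ : AffFrame H X} (h : σ ≤ τ) (l : Fin τ.n) :
    fres (pre_le (toBase hX) (U_le h)) (tautCoord hX τ l) =
      chg h ((toBase hX).app σ.U).hom (tautCoord hX σ) l := by
  have h1 := appTop_map h (preimageIso hX σ).hom l
  rw [← homOfLE_preimageIso, preimageIso_proj, Scheme.Hom.comp_appTop, CommRingCat.comp_apply] at h1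
  rw [tautCoord, fres_topIso, h1]
  refine (map_chg h _ (toBase hX ⁻¹ᵁ σ.U).topIso.hom.hom _ l).trans ?_
  rw [topIso_pullFun]
  rfl

variable {hX} {K : (total hX).Modules} (η : SemiMap (toBase hX) H K)

/-- The tautological section over the preimage of the domain of a frame. -/
def tautLocal (σ : AffFrame H X) : Γ(K, toBase hX ⁻¹ᵁ σ.U) :=
  η.app σ.U σ.s + ∑ k, tautCoord hX σ k • η.app σ.U (σ.h k)

lemma res_tautLocal {σ τ : AffFrame H X} (h : σ ≤ τ) :
    res K (pre_le (toBase hX) (U_le h)) (tautLocal η τ) = tautLocal η σ := by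
  simp only [tautLocal, map_add, map_sum, res_smul, fres_tautCoord hX h]
  conv_rhs => rw [← trans₀_spec h]
  have h1 : ∀ k, η.app σ.U (σ.h k) = ∑ l, (toBase hX).app σ.U (trans₁ h k l) •
      res K (pre_le (toBase hX) (U_le h)) (η.app τ.U (τ.h l)) := by
    intro k
    conv_lhs => rw [← trans₁_spec h k]
    simp only [map_sum, η.app_smul, η.app_res]
  simp only [h1, map_add, map_sum, η.app_smul, η.app_res, chg, add_smul, Finset.sum_smul,
    Finset.smul_sum, mul_smul, Finset.sum_add_distrib]
  rw [Finset.sum_comm, ← add_assoc]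

/-- A semilinear map out of `H` gives a section over the total space of the affine bundle: its value
at the tautological point of `X`. -/
lemma exists_tautSection : ∃ t : Γ(K, ⊤), ∀ σ : AffFrame H X, res K le_top t = tautLocal η σ := by
  obtain ⟨t, ht⟩ := exists_glue (U := (⊤ : (total hX).Opens)) K
    (fun σ : AffFrame H X => toBase hX ⁻¹ᵁ σ.U) (fun _ => le_top)
    (fun y _ => by
      obtain ⟨σ, hσ⟩ := hX (toBase hX y)
      exact Opens.mem_iSup.mpr ⟨σ, hσ⟩) (tautLocal η) (by
      intro σ τ W hσ hτ
      have hW : W ≤ toBase hX ⁻¹ᵁ (σ.U ⊓ τ.U) := (le_inf hσ hτ).trans (pre_inf _ _ _)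
      have h1 : σ.restrict (inf_le_left : σ.U ⊓ τ.U ≤ σ.U) ≤ σ :=
        (inf_le_left : σ.U ⊓ τ.U ≤ σ.U)
      have h2 : σ.restrict (inf_le_left : σ.U ⊓ τ.U ≤ σ.U) ≤ τ :=
        (inf_le_right : σ.U ⊓ τ.U ≤ τ.U)
      have := congrArg (res K hW) ((res_tautLocal η h1).trans (res_tautLocal η h2).symm)
      exact (res_res K _ hW _).symm.trans (this.trans (res_res K _ hW _)))
  exact ⟨t, ht⟩

end AffFrame

/-! ### Hyperbolic splittings of a form with an isotropic section -/

lemma IsFrame.ev_dual {A B : S.Modules} {U : S.Opens} {ι : Type*} [Fintype ι] [DecidableEq ι]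
    {e : ι → Γ(A, U)} (he : IsFrame A e) (b : Γ(B, U)) (i : ι) {V : S.Opens} (hV : V ≤ U)
    (a : Γ(A, V)) :
    ev V (res _ hV (he.lift (Pi.single i b))) a = he.coord hV a i • res B hV b := by
  rw [he.ev_lift, Finset.sum_eq_single i (fun j _ hj => by simp [hj]) (by simp), Pi.single_eq_same]

/-- The homomorphism `a ↦ F (s a)` over `U`. -/
def precompSec {A B L : S.Modules} (s : A ⟶ B) {U : S.Opens} (F : Γ(sheafHom B L, U)) :
    Γ(sheafHom A L, U) :=
  mkSec (fun V hV => (ev V (res _ hV F)).comp (appₗ s V)) (fun V W hV h a => by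
    rw [LinearMap.comp_apply, LinearMap.comp_apply, appₗ_res, ← res_res _ hV h F, ev_res])

lemma ev_res_precompSec {A B L : S.Modules} (s : A ⟶ B) {U : S.Opens} (F : Γ(sheafHom B L, U))
    {V : S.Opens} (hV : V ≤ U) (a : Γ(A, V)) :
    ev V (res _ hV (precompSec s F)) a = ev V (res _ hV F) (appₗ s V a) := rfl

/-- Precomposition with `s` as a morphism `Hom(B, L) → Hom(A, L)`. -/
def precomp {A B : S.Modules} (L : S.Modules) (s : A ⟶ B) : sheafHom B L ⟶ sheafHom A L :=
  mkHom (fun U =>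
    { toFun := fun F => precompSec s F
      map_add' := fun F G => sheafHom_ext fun V hV a => by
        rw [ev_res_precompSec, map_add, map_add, map_add, map_add, LinearMap.add_apply,
          LinearMap.add_apply, ev_res_precompSec, ev_res_precompSec]
      map_smul' := fun r F => sheafHom_ext fun V hV a => by
        rw [ev_res_precompSec, res_smul, res_smul, map_smul, map_smul, LinearMap.smul_apply,
          LinearMap.smul_apply, ev_res_precompSec]; rfl })
    (fun {U V} h F => sheafHom_ext fun W hW a => by
      change ev W (res _ hW (precompSec s (res _ h F))) a = ev W (res _ hW (res _ h (precompSec s F))) a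
      rw [res_res, ev_res_precompSec, ev_res_precompSec, res_res])

lemma ev_precomp {A B L : S.Modules} (s : A ⟶ B) (U : S.Opens) (F : Γ(sheafHom B L, U))
    (a : Γ(A, U)) : ev U (appₗ (precomp L s) U F) a = ev U F (appₗ s U a) := by
  have := ev_res_precompSec s F le_rfl a
  rwa [res_self, res_self] at this

namespace QuadForm

variable {E L N : S.Modules} (q : QuadForm E L)

lemma b_comm (U : S.Opens) (v w : Γ(E, U)) : q.b U v w = q.b U w v :=
  QuadraticMap.polar_comm _ _ _

lemma app_add (U : S.Opens) (v w : Γ(E, U)) :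
    q.app U (v + w) = q.app U v + q.app U w + q.b U v w := by
  simp only [b, QuadraticMap.polarBilin_apply_apply, QuadraticMap.polar]
  abel

variable {q} in
lemma IsIsotropic.b_eq_zero {g : N ⟶ E} (h : q.IsIsotropic g) (U : S.Opens) (m n : Γ(N, U)) :
    q.b U (appₗ g U m) (appₗ g U n) = 0 := by
  have := q.app_add U (appₗ g U m) (appₗ g U n)
  rw [← map_add, h, h, h] at this
  simpa using this.symm

variable {g : N ⟶ E} {s : sheafHom N L ⟶ E}

variable {q} in
lemma b_section (hs : s ≫ q.psi g = 𝟙 _) (U : S.Opens) (h : Γ(sheafHom N L, U)) (n : Γ(N, U)) :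
    q.b U (appₗ s U h) (appₗ g U n) = ev U h n := by
  rw [← ev_psi, ← appₗ_comp, hs, appₗ_id]

variable {q} in
/-- If `s` is a section of `ψ_{q,N}`, then `n ↦ (h ↦ b_q (g n, s h))` is the biduality map
`N → Hom(Hom(N, L), L)`. -/
lemma isIso_comp_psi (hN : IsVectorBundle N) (hL : IsLineBundle L) (hs : s ≫ q.psi g = 𝟙 _) :
    IsIso (g ≫ q.psi s) := by
  have key : ∀ (U : S.Opens) (n : Γ(N, U)) (h : Γ(sheafHom N L, U)),
      ev U (appₗ (g ≫ q.psi s) U n) h = ev U h n := by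
    intro U n h
    rw [appₗ_comp, ev_psi, b_comm, b_section hs]
  refine isIso_of_locally_bijective _ fun x => ?_
  obtain ⟨U₁, hx₁, k, e, he⟩ := hN.exists_frame x
  obtain ⟨U₂, hx₂, l, hl⟩ := hL.exists_frame x
  replace he := he.restrict (inf_le_left : U₁ ⊓ U₂ ≤ U₁)
  replace hl := hl.restrict (inf_le_right : U₁ ⊓ U₂ ≤ U₂)
  have hd := he.sheafHom hl
  refine ⟨U₁ ⊓ U₂, ⟨hx₁, hx₂⟩, fun V hV => ⟨fun m n hmn => ?_, fun F => ?_⟩⟩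
  · apply he.coord_injective hV
    funext i
    have h := congrArg (fun F => ev V F (res _ hV (he.lift (Pi.single i (res L inf_le_right (l ())))))) hmn
    simp only [key, he.ev_dual] at h
    have inj := (hl V hV).1
    refine congrFun (@inj (fun _ => he.coord hV m i) (fun _ => he.coord hV n i) ?_) ()
    simpa using h
  · refine ⟨∑ i, hl.coord hV (ev V F (res _ hV (he.lift (Pi.single i (res L inf_le_right (l ()))))))
      () • res N hV (res N inf_le_left (e i)), ?_⟩
    refine hd.sheafHom_ext hV fun p => ?_
    rw [key, he.ev_dual, he.coord_sum]
    have := hl.sum_coord hV (ev V F (res _ hV (he.lift (Pi.single p.1 (res L inf_le_right (l ()))))))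
    simpa using this

variable {q} in
/-- A section `s` of `ψ_{q,N}` becomes isotropic after subtracting `g α`, where `α` is given by a
bilinear form whose associated quadratic form is `q`. -/
lemma exists_isotropic_section (hN : IsVectorBundle N) (hL : IsLineBundle L)
    (hg : q.IsIsotropic g) (hs : s ≫ q.psi g = 𝟙 _) (β : E ⟶ sheafHom E L)
    (hβ : ∀ (U : S.Opens) (v : Γ(E, U)), ev U (appₗ β U v) v = q.app U v) :
    ∃ s' : sheafHom N L ⟶ E, s' ≫ q.psi g = 𝟙 _ ∧ q.IsIsotropic s' := by
  have := isIso_comp_psi hN hL hs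
  let α : sheafHom N L ⟶ N := s ≫ β ≫ precomp L s ≫ inv (g ≫ q.psi s)
  have hα : ∀ (U : S.Opens) (h h' : Γ(sheafHom N L, U)),
      q.b U (appₗ g U (appₗ α U h)) (appₗ s U h') =
        ev U (appₗ β U (appₗ s U h)) (appₗ s U h') := by
    intro U h h'
    have h1 : α ≫ g ≫ q.psi s = s ≫ β ≫ precomp L s := by simp [α]
    rw [← ev_psi, ← appₗ_comp, ← appₗ_comp, h1, appₗ_comp, appₗ_comp, ev_precomp]
  -- `q(s h - g (α h)) = q(s h) - b_q(g (α h), s h) = q(s h) - β(s h)(s h) = 0`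
  refine ⟨s - α ≫ g, ?_, fun U h => ?_⟩
  · rw [Preadditive.sub_comp, hs, Category.assoc, hg.comp_psi, comp_zero, sub_zero]
  · rw [appₗ_sub, appₗ_comp, sub_eq_add_neg, ← map_neg, app_add, hg, add_zero, map_neg, map_neg,
      b_comm, hα, hβ, add_neg_cancel]

/-- The retraction `r` of `g` with `b_q (g (r v), s h) = b_q (v, s h)`. -/
def retraction (g : N ⟶ E) (s : sheafHom N L ⟶ E) [IsIso (g ≫ q.psi s)] : E ⟶ N :=
  q.psi s ≫ inv (g ≫ q.psi s)

lemma comp_retraction [IsIso (g ≫ q.psi s)] : g ≫ q.retraction g s = 𝟙 _ := by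
  rw [retraction, ← Category.assoc, IsIso.hom_inv_id]

lemma retraction_comp [IsIso (g ≫ q.psi s)] : q.retraction g s ≫ g ≫ q.psi s = q.psi s := by
  rw [retraction, Category.assoc, IsIso.inv_hom_id, Category.comp_id]

variable {q} in
/-- The splitting of `q` given by isotropic `g : N → E` and `s : Hom(N, L) → E` that are dual to each
other, and a morphism `σ` whose image is orthogonal to both and is locally complementary. -/
lemma isometric_of_section {Q : S.Modules} {σ : Q ⟶ E} (hg : q.IsIsotropic g)
    (hs : s ≫ q.psi g = 𝟙 _) (hs' : q.IsIsotropic s) (hσg : σ ≫ q.psi g = 0)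
    (hσs : σ ≫ q.psi s = 0) [IsIso (g ≫ q.psi s)]
    (hσ : ∀ x : S, ∃ U : S.Opens, x ∈ U ∧ ∀ V ≤ U, Function.Injective (appₗ σ V) ∧
      ∀ v : Γ(E, V), appₗ (q.psi g) V v = 0 → ∃ n y, v = appₗ g V n + appₗ σ V y) :
    q.Isometric ((hyperbolic N L).orthSum (q.comp σ)) := by
  let Φ : (N ⊞ sheafHom N L) ⊞ Q ⟶ E := biprod.desc (biprod.desc g s) σ
  have hΦ : ∀ (U : S.Opens) (u : Γ((N ⊞ sheafHom N L) ⊞ Q, U)), appₗ Φ U u =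
      appₗ g U (appₗ biprod.fst U (appₗ biprod.fst U u)) +
      appₗ s U (appₗ biprod.snd U (appₗ biprod.fst U u)) + appₗ σ U (appₗ biprod.snd U u) := by
    intro U u
    have : Φ = biprod.fst ≫ biprod.fst ≫ g + biprod.fst ≫ biprod.snd ≫ s + biprod.snd ≫ σ := by
      apply biprod.hom_ext'
      · apply biprod.hom_ext' <;> simp [Φ]
      · simp [Φ]
    rw [this]
    rfl
  have psi_Φ : Φ ≫ q.psi g = biprod.fst ≫ biprod.snd := by
    apply biprod.hom_ext'
    · apply biprod.hom_ext' <;> simp [Φ, hs, hg.comp_psi]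
    · simp [Φ, hσg]
  have r_Φ : Φ ≫ q.retraction g s = biprod.fst ≫ biprod.fst := by
    apply biprod.hom_ext'
    · apply biprod.hom_ext'
      · simp [Φ, comp_retraction]
      · simp only [Φ, biprod.inl_desc_assoc, biprod.inr_desc_assoc, biprod.inl_fst_assoc,
          biprod.inr_fst]
        rw [retraction, ← Category.assoc, hs'.comp_psi, zero_comp]
    · simp only [Φ, biprod.inr_desc_assoc, biprod.inr_fst_assoc, zero_comp]
      rw [retraction, ← Category.assoc, hσs, zero_comp]
  have form : ∀ (U : S.Opens) (u : Γ((N ⊞ sheafHom N L) ⊞ Q, U)),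
      q.app U (appₗ Φ U u) = ((hyperbolic N L).orthSum (q.comp σ)).app U u := by
    intro U u
    have h1 : ∀ (x : Γ(Q, U)) (n : Γ(N, U)), q.b U (appₗ g U n) (appₗ σ U x) = 0 := by
      intro x n
      rw [b_comm, ← ev_psi, ← appₗ_comp, hσg]
      rfl
    have h2 : ∀ (x : Γ(Q, U)) (h : Γ(sheafHom N L, U)), q.b U (appₗ s U h) (appₗ σ U x) = 0 := by
      intro x n
      rw [b_comm, ← ev_psi, ← appₗ_comp, hσs]
      rfl
    rw [hΦ, app_add, app_add, hg, hs', b_comm _ _ (appₗ g _ _), b_section hs, map_add,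
      LinearMap.add_apply, h1, h2, zero_add, zero_add, add_zero]
    rfl
  have iso : IsIso Φ := by
    refine isIso_of_locally_bijective _ fun x => ?_
    obtain ⟨U, hxU, hU⟩ := hσ x
    refine ⟨U, hxU, fun V hV => ⟨?_, fun v => ?_⟩⟩
    · rw [injective_iff_map_eq_zero]
      intro u hu
      have e1 : appₗ biprod.snd V (appₗ biprod.fst V u) = 0 := by
        rw [← appₗ_comp, ← psi_Φ, appₗ_comp, hu, map_zero]
      have e2 : appₗ biprod.fst V (appₗ biprod.fst V u) = 0 := by
        rw [← appₗ_comp, ← r_Φ, appₗ_comp, hu, map_zero]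
      have e3 : appₗ biprod.snd V u = 0 := by
        apply (hU V hV).1
        rw [hΦ, e1, e2, map_zero, map_zero, zero_add, zero_add] at hu
        rw [hu, map_zero]
      have : 𝟙 ((N ⊞ sheafHom N L) ⊞ Q) = biprod.fst ≫ biprod.fst ≫ biprod.inl ≫ biprod.inl +
          biprod.fst ≫ biprod.snd ≫ biprod.inr ≫ biprod.inl + biprod.snd ≫ biprod.inr := by
        apply biprod.hom_ext'
        · apply biprod.hom_ext' <;> simp
        · simp
      rw [← appₗ_id _ V u, this]
      simp only [appₗ_add, appₗ_comp, e1, e2, e3, map_zero, add_zero]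
    · -- subtracting the component along `s` leaves a section of `N^⊥`
      let w := v - appₗ s V (appₗ (q.psi g) V v)
      obtain ⟨n, y, hw⟩ := (hU V hV).2 w (by
        simp only [w]
        rw [map_sub, ← appₗ_comp s, hs, appₗ_id, sub_self])
      have i1 : appₗ Φ V (appₗ (biprod.inl ≫ biprod.inl) V n) = appₗ g V n := by
        rw [← appₗ_comp]; simp [Φ]
      have i2 : ∀ h, appₗ Φ V (appₗ (biprod.inr ≫ biprod.inl) V h) = appₗ s V h := by
        intro h; rw [← appₗ_comp]; simp [Φ]
      have i3 : appₗ Φ V (appₗ biprod.inr V y) = appₗ σ V y := by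
        rw [← appₗ_comp]; simp [Φ]
      refine ⟨appₗ (biprod.inl ≫ biprod.inl) V n + appₗ (biprod.inr ≫ biprod.inl) V
        (appₗ (q.psi g) V v) + appₗ biprod.inr V y, ?_⟩
      rw [map_add, map_add, i1, i2, i3]
      rw [add_right_comm, ← hw]
      exact sub_add_cancel _ _
  refine ⟨(asIso Φ).symm, fun U v => ?_⟩
  rw [← form, ← appₗ_comp]
  simp [appₗ_id]

end QuadForm

/-! ### Frames adapted to an isotropic subbundle -/

/-- A frame of `E` adapted to `g : N → E`: it consists of a frame `g n` of the image of `N`, of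
sections `w` of `N^⊥`, and of sections `t` that are dual to `g n` with respect to the frame `l`
of `L`. -/
structure AdaptedFrame {E L N : S.Modules} (q : QuadForm E L) (g : N ⟶ E) where
  U : S.Opens
  r : ℕ
  m : ℕ
  n : Fin r → Γ(N, U)
  l : Unit → Γ(L, U)
  w : Fin m → Γ(E, U)
  t : Fin r → Γ(E, U)
  isFrame_n : IsFrame N n
  isFrame_l : IsFrame L l
  isFrame : IsFrame E (Sum.elim (Sum.elim (fun i => appₗ g U (n i)) w) t)
  b_w : ∀ i j, q.b U (w i) (appₗ g U (n j)) = 0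
  b_t : ∀ i j, q.b U (t i) (appₗ g U (n j)) = Pi.single (M := fun _ => Γ(L, U)) i (l ()) j

namespace AdaptedFrame

variable {E L N : S.Modules} {q : QuadForm E L} {g : N ⟶ E} (A : AdaptedFrame q g)

lemma decomp {V : S.Opens} (hV : V ≤ A.U) (v : Γ(E, V)) :
    ∃ (a : Γ(N, V)) (c : Fin A.m → Γ(S, V)) (d : Fin A.r → Γ(S, V)),
      v = appₗ g V a + ∑ i, c i • res E hV (A.w i) + ∑ i, d i • res E hV (A.t i) := by
  have h := A.isFrame.sum_coord hV v
  simp only [Fintype.sum_sum_type, Sum.elim_inl, Sum.elim_inr] at h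
  refine ⟨∑ i, A.isFrame.coord hV v (Sum.inl (Sum.inl i)) • res N hV (A.n i),
    fun i => A.isFrame.coord hV v (Sum.inl (Sum.inr i)), fun i => A.isFrame.coord hV v (Sum.inr i),
    h.symm.trans ?_⟩
  simp only [map_sum, map_smul, appₗ_res]

lemma eq_zero_of_add_eq_zero {V : S.Opens} (hV : V ≤ A.U) (a : Γ(N, V)) (c : Fin A.m → Γ(S, V))
    (h : appₗ g V a + ∑ i, c i • res E hV (A.w i) = 0) : c = 0 := by
  have := A.isFrame.coord_sum hV (Sum.elim (Sum.elim (A.isFrame_n.coord hV a) c) 0)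
  simp only [Fintype.sum_sum_type, Sum.elim_inl, Sum.elim_inr] at this
  rw [← A.isFrame_n.sum_coord hV a] at h
  simp only [map_sum, map_smul, appₗ_res] at h
  simp only [h, Pi.zero_apply, zero_smul, Finset.sum_const_zero, add_zero, map_zero] at this
  funext i
  exact (congrFun this (Sum.inl (Sum.inr i))).symm

/-- Locally, the sections of `N^⊥` are spanned by `N` and the sections `w`. -/
lemma decomp_perp (hg : q.IsIsotropic g) {V : S.Opens} (hV : V ≤ A.U) (v : Γ(E, V))
    (hv : appₗ (q.psi g) V v = 0) :
    ∃ (a : Γ(N, V)) (c : Fin A.m → Γ(S, V)), v = appₗ g V a + ∑ i, c i • res E hV (A.w i) := by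
  obtain ⟨a, c, d, rfl⟩ := A.decomp hV v
  have hd : d = 0 := by
    funext j
    have h : q.b V (appₗ g V a + ∑ i, c i • res E hV (A.w i) + ∑ i, d i • res E hV (A.t i))
        (appₗ g V (res N hV (A.n j))) = 0 := by
      rw [← ev_psi, hv]
      rfl
    rw [map_add, map_add, LinearMap.add_apply, LinearMap.add_apply, hg.b_eq_zero, zero_add] at h
    simp only [map_sum, map_smul, LinearMap.sum_apply, LinearMap.smul_apply, appₗ_res, q.b_res,
      A.b_w, A.b_t, map_zero, smul_zero, Finset.sum_const_zero, zero_add] at h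
    rw [Finset.sum_eq_single j
      (fun i _ hi => by rw [Pi.single_eq_of_ne hi.symm, map_zero, smul_zero]) (by simp),
      Pi.single_eq_same] at h
    have inj := (A.isFrame_l V hV).1
    refine congrFun (@inj (fun _ => d j) (fun _ => 0) ?_) ()
    simpa using h
  exact ⟨a, c, by simp [hd]⟩

lemma mono_toPerp [Mono g] (hg : q.IsIsotropic g) : Mono hg.toPerp := by
  have hfac : hg.toPerp ≫ q.perpι g = g := kernel.lift_ι _ _ _
  have : Mono (hg.toPerp ≫ q.perpι g) := by rw [hfac]; infer_instance
  exact mono_of_mono _ (q.perpι g)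

lemma perpι_toPerp (hg : q.IsIsotropic g) (V : S.Opens) (a : Γ(N, V)) :
    appₗ (q.perpι g) V (appₗ hg.toPerp V a) = appₗ g V a := by
  rw [← appₗ_comp, QuadForm.IsIsotropic.toPerp, kernel.lift_ι]

lemma π_toPerp (hg : q.IsIsotropic g) (V : S.Opens) (a : Γ(N, V)) :
    appₗ (cokernel.π hg.toPerp) V (appₗ hg.toPerp V a) = 0 := by
  rw [← appₗ_comp, cokernel.condition]
  rfl

lemma psi_perpι (V : S.Opens) (v : Γ(q.perp g, V)) :
    appₗ (q.psi g) V (appₗ (q.perpι g) V v) = 0 := by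
  rw [← appₗ_comp, kernel.condition]
  rfl

lemma exists_perp (i : Fin A.m) : ∃ y, appₗ (q.perpι g) A.U y = A.w i := by
  refine exists_kernel_section _ _ _ (A.isFrame_n.sheafHom_ext le_rfl fun j => ?_)
  rw [res_self, ev_psi, A.b_w, map_zero]
  rfl

/-- The sections `w`, as sections of `N^⊥`. -/
def perpSec (i : Fin A.m) : Γ(q.perp g, A.U) := (A.exists_perp i).choose

lemma perpι_perpSec (i : Fin A.m) : appₗ (q.perpι g) A.U (A.perpSec i) = A.w i :=
  (A.exists_perp i).choose_spec

/-- The sections `w` give a frame of `N^⊥/N`. -/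
lemma isFrame_reduced [Mono g] (hg : q.IsIsotropic g) :
    IsFrame hg.reducedModule fun i => appₗ (cokernel.π hg.toPerp) A.U (A.perpSec i) := by
  have := mono_toPerp hg
  refine isFrame_of_locally _ (fun V hV c hc => ?_) fun V hV y x hx => ?_
  · obtain ⟨a, ha⟩ := exact_sections hg.toPerp V (∑ i, c i • res _ hV (A.perpSec i)) (by
      simpa only [map_sum, map_smul, appₗ_res] using hc)
    refine A.eq_zero_of_add_eq_zero hV (-a) c ?_
    have := congrArg (appₗ (q.perpι g) V) ha
    rw [perpι_toPerp] at this
    simp only [map_sum, map_smul, appₗ_res, perpι_perpSec] at this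
    rw [map_neg, this, neg_add_cancel]
  · obtain ⟨W, hW, hxW, v, hv⟩ := epi_locally_surjective (cokernel.π hg.toPerp) V y x hx
    obtain ⟨a, c, hac⟩ := A.decomp_perp hg (hW.trans hV) _ (psi_perpι W v)
    refine ⟨W, hW, hxW, c, ?_⟩
    have : v = appₗ hg.toPerp W a + ∑ i, c i • res _ (hW.trans hV) (A.perpSec i) := by
      apply injective_of_mono (q.perpι g) W
      simp only [hac, map_add, map_sum, map_smul, appₗ_res, perpι_perpSec, perpι_toPerp]
    rw [← hv, this]
    simp only [map_add, map_sum, map_smul, appₗ_res, π_toPerp, zero_add]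

end AdaptedFrame

/-! ### Pullback of forms and of adapted frames -/

section pullback

variable {T : Scheme.{u}} {f : T ⟶ S}

lemma IsVectorBundle.pullback {M : S.Modules} (hM : IsVectorBundle M) :
    IsVectorBundle ((Scheme.Modules.pullback f).obj M) := by
  intro y
  obtain ⟨U, hU, n, e, he⟩ := hM.exists_frame (f y)
  exact ⟨f ⁻¹ᵁ U, hU, n, _, he.pullMap⟩

lemma IsLineBundle.pullback {M : S.Modules} (hM : IsLineBundle M) :
    IsLineBundle ((Scheme.Modules.pullback f).obj M) := by
  intro y
  obtain ⟨U, hU, e, he⟩ := hM (f y)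
  exact ⟨f ⁻¹ᵁ U, hU, _, IsFrame.pullMap he⟩

lemma IsLineBundle.isVectorBundle {M : S.Modules} (hM : IsLineBundle M) : IsVectorBundle M :=
  fun x => (hM x).imp fun _ h => ⟨h.1, 1, h.2⟩

lemma pullMap_naturality {M N : S.Modules} (φ : M ⟶ N) (U : S.Opens) (x : Γ(M, U)) :
    appₗ ((Scheme.Modules.pullback f).map φ) (f ⁻¹ᵁ U) ((pullMap f M).app U x) =
      (pullMap f N).app U (appₗ φ U x) := by
  have h := (Scheme.Modules.pullbackPushforwardAdjunction f).unit.naturality φ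
  exact congr((Scheme.Modules.Hom.app $h U).hom x).symm

/-- A quadratic map that vanishes on a family of vectors, together with its polar form, vanishes on
their span. -/
lemma quadraticMap_sum_smul_eq_zero {R M P ι : Type*} [CommRing R] [AddCommGroup M] [Module R M]
    [AddCommGroup P] [Module R P] [Fintype ι] {Q : QuadraticMap R M P} {e : ι → M}
    (h : ∀ i, Q (e i) = 0) (h2 : ∀ i j, QuadraticMap.polar Q (e i) (e j) = 0) (c : ι → R) :
    Q (∑ i, c i • e i) = 0 := by
  classical
  have hb : ∀ (s : Finset ι) (i : ι), Q.polarBilin (e i) (∑ j ∈ s, c j • e j) = 0 := by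
    intro s i
    simp [h2]
  refine Finset.induction_on (motive := fun s => Q (∑ i ∈ s, c i • e i) = 0) Finset.univ (by simp)
    fun i s hi IH => ?_
  have h3 := QuadraticMap.map_add Q (c i • e i) (∑ j ∈ s, c j • e j)
  have h4 : QuadraticMap.polar Q (c i • e i) (∑ j ∈ s, c j • e j) = 0 := by
    rw [QuadraticMap.polar_smul_left]
    exact (congrArg (c i • ·) (hb s i)).trans (smul_zero _)
  rw [Finset.sum_insert hi, h3, IH, QuadraticMap.map_smul, h, h4, smul_zero, zero_add, zero_add]

namespace QuadForm

/-- The quadratic form `v ↦ β(v)(v)`. -/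
def ofBilin {E L : S.Modules} (β : E ⟶ sheafHom E L) : QuadForm E L where
  app U := LinearMap.BilinMap.toQuadraticMap ((ev (N := E) (L := L) U) ∘ₗ appₗ β U)
  app_res h v := by
    simp only [LinearMap.BilinMap.toQuadraticMap_apply, LinearMap.comp_apply, appₗ_res, ev_res]

lemma ofBilin_app {E L : S.Modules} (β : E ⟶ sheafHom E L) (U : S.Opens) (v : Γ(E, U)) :
    (ofBilin β).app U v = ev U (appₗ β U v) v := rfl

variable {E L N : S.Modules} {q : QuadForm E L}
  {q' : QuadForm ((Scheme.Modules.pullback f).obj E) ((Scheme.Modules.pullback f).obj L)}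

lemma IsPullback.b (h : q.IsPullback f q') (U : S.Opens) (v w : Γ(E, U)) :
    q'.b _ ((pullMap f E).app U v) ((pullMap f E).app U w) = (pullMap f L).app U (q.b U v w) := by
  have h' : ∀ v, q'.app _ ((pullMap f E).app U v) = (pullMap f L).app U (q.app U v) := h U
  simp only [QuadForm.b, QuadraticMap.polarBilin_apply_apply, QuadraticMap.polar, ← map_add, h',
    map_sub]

/-- On pullbacks of sections, `ψ` of the pulled back form is the pullback of `ψ`. -/
lemma IsPullback.psi (h : q.IsPullback f q') (g : N ⟶ E) (hN : IsVectorBundle N) (U : S.Opens)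
    (v : Γ(E, U)) :
    appₗ (q'.psi ((Scheme.Modules.pullback f).map g)) _ ((pullMap f E).app U v) =
      ((pullMap f N).hom (pullMap_isFree hN) (pullMap f L)).app U (appₗ (q.psi g) U v) := by
  refine (pullMap_isFree hN).sheafHom_ext fun V hV a => ?_
  rw [← appₗ_res, ← SemiMap.app_res, ev_psi, pullMap_naturality, ← SemiMap.app_res, h.b,
    SemiMap.ev_hom, ← appₗ_res, ev_psi]
  exact hV

/-- A form that vanishes on a frame, together with its polar form, is zero. -/
lemma app_eq_zero_of_frame {U : S.Opens} {ι : Type*} [Fintype ι] {e : ι → Γ(E, U)}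
    (he : IsFrame E e) (h : ∀ i, q.app U (e i) = 0) (h2 : ∀ i j, q.b U (e i) (e j) = 0)
    {V : S.Opens} (hV : V ≤ U) (v : Γ(E, V)) : q.app V v = 0 := by
  rw [← he.sum_coord hV v]
  refine quadraticMap_sum_smul_eq_zero (fun i => by rw [q.app_res, h, map_zero]) (fun i j => ?_) _
  exact (q.b_res hV (e i) (e j)).trans (by rw [h2, map_zero])

lemma IsPullback.isIsotropic (h : q.IsPullback f q') {g : N ⟶ E} (hN : IsVectorBundle N)
    (hg : q.IsIsotropic g) : q'.IsIsotropic ((Scheme.Modules.pullback f).map g) := by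
  intro V v
  refine eq_of_locally _ _ _ fun y hy => ?_
  obtain ⟨U, hyU, r, n, hn⟩ := hN.exists_frame (f y)
  refine ⟨V ⊓ f ⁻¹ᵁ U, inf_le_left, ⟨hy, hyU⟩, ?_⟩
  rw [← q'.app_res, ← appₗ_res, map_zero]
  have h' : ∀ v, q'.app _ ((pullMap f E).app U v) = (pullMap f L).app U (q.app U v) := h U
  refine app_eq_zero_of_frame (q := q'.comp ((Scheme.Modules.pullback f).map g)) hn.pullMap
    (fun i => ?_) (fun i j => ?_) inf_le_right _
  · change q'.app _ (appₗ _ _ _) = 0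
    rw [pullMap_naturality, h', hg, map_zero]
  · have : (q'.comp ((Scheme.Modules.pullback f).map g)).b (f ⁻¹ᵁ U)
        ((pullMap f N).app U (n i)) ((pullMap f N).app U (n j)) =
        q'.b _ (appₗ ((Scheme.Modules.pullback f).map g) _ ((pullMap f N).app U (n i)))
        (appₗ ((Scheme.Modules.pullback f).map g) _ ((pullMap f N).app U (n j))) := by
      simp [QuadForm.b, QuadraticMap.polar, comp]
    rw [this, pullMap_naturality, pullMap_naturality, h.b, hg.b_eq_zero, map_zero]

end QuadForm

/-- The pullback of an adapted frame. -/
def AdaptedFrame.pullback {E L N : S.Modules} {q : QuadForm E L} {g : N ⟶ E}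
    {q' : QuadForm ((Scheme.Modules.pullback f).obj E) ((Scheme.Modules.pullback f).obj L)}
    (h : q.IsPullback f q') (A : AdaptedFrame q g) :
    AdaptedFrame q' ((Scheme.Modules.pullback f).map g) where
  U := f ⁻¹ᵁ A.U
  r := A.r
  m := A.m
  n i := (pullMap f N).app _ (A.n i)
  l i := (pullMap f L).app _ (A.l i)
  w i := (pullMap f E).app _ (A.w i)
  t i := (pullMap f E).app _ (A.t i)
  isFrame_n := A.isFrame_n.pullMap
  isFrame_l := A.isFrame_l.pullMap
  isFrame := by
    convert! (A.isFrame.pullMap (f := f)) using 1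
    funext i
    rcases i with (i | i) | i
    · exact pullMap_naturality g _ _
    · rfl
    · rfl
  b_w i j := by rw [pullMap_naturality, h.b, A.b_w, map_zero]
  b_t i j := by
    rw [pullMap_naturality, h.b, A.b_t]
    obtain rfl | hij := eq_or_ne j i
    · rw [Pi.single_eq_same, Pi.single_eq_same]
    · rw [Pi.single_eq_of_ne hij, Pi.single_eq_of_ne hij, map_zero]

/-! ### Splitting along a morphism -/

section

variable {E L N : S.Modules} {q : QuadForm E L} {g : N ⟶ E}

/-- The morphism `f^*(N^⊥/N) → f^* E` whose composition with `f^*(N^⊥) → f^*(N^⊥/N)` is the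
restriction of `e`. -/
def reducedDesc (hiso : q.IsIsotropic g)
    (e : (Scheme.Modules.pullback f).obj E ⟶ (Scheme.Modules.pullback f).obj E)
    (he : (Scheme.Modules.pullback f).map g ≫ e = 0) :
    (Scheme.Modules.pullback f).obj hiso.reducedModule ⟶ (Scheme.Modules.pullback f).obj E :=
  (SemiMap.ofHom (cokernel.desc hiso.toPerp (q.perpι g ≫
    (Scheme.Modules.pullbackPushforwardAdjunction f).unit.app E ≫
      (Scheme.Modules.pushforward f).map e) (by
    refine hom_ext_appₗ fun U n => ?_
    change appₗ e _ ((pullMap f E).app U (appₗ (q.perpι g) U (appₗ hiso.toPerp U n))) = 0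
    rw [AdaptedFrame.perpι_toPerp, ← pullMap_naturality, ← appₗ_comp, he]
    rfl))).desc

lemma reducedDesc_pullMap (hiso : q.IsIsotropic g)
    (e : (Scheme.Modules.pullback f).obj E ⟶ (Scheme.Modules.pullback f).obj E)
    (he : (Scheme.Modules.pullback f).map g ≫ e = 0) (U : S.Opens) (v : Γ(q.perp g, U)) :
    appₗ (reducedDesc hiso e he) (f ⁻¹ᵁ U)
      ((pullMap f hiso.reducedModule).app U (appₗ (cokernel.π hiso.toPerp) U v)) =
      appₗ e _ ((pullMap f E).app U (appₗ (q.perpι g) U v)) := by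
  rw [reducedDesc, SemiMap.desc_pullMap]
  refine (congr($(cokernel.π_desc hiso.toPerp (q.perpι g ≫
    (Scheme.Modules.pullbackPushforwardAdjunction f).unit.app E ≫
      (Scheme.Modules.pushforward f).map e) _).app U v)).trans ?_
  rfl

/-- Sections over the preimage of `U` that come from `N^⊥/N` are locally images of sections of
`N^⊥`. -/
lemma reduced_induction (hiso : q.IsIsotropic g) {K : T.Modules} {U : S.Opens}
    (y : Γ(hiso.reducedModule, U)) {a b : Γ(K, f ⁻¹ᵁ U)}
    (h : ∀ (V : S.Opens) (hV : V ≤ U) (v : Γ(q.perp g, V)),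
      appₗ (cokernel.π hiso.toPerp) V v = res _ hV y → res K (pre_le f hV) a = res K (pre_le f hV) b) :
    a = b := by
  refine eq_of_locally _ _ _ fun z hz => ?_
  obtain ⟨V, hV, hzV, v, hv⟩ := epi_locally_surjective (cokernel.π hiso.toPerp) U y (f z) hz
  exact ⟨f ⁻¹ᵁ V, pre_le f hV, hzV, h V hV v hv⟩

/-- A section `s` of `f^* ψ_{q,N}` and a bilinear form whose associated quadratic form is `f^* q`
give a splitting of `q` along `f`. -/
theorem splitsAlong_of [Mono g] (hL : IsLineBundle L) (hN : IsVectorBundle N) (hiso : q.IsIsotropic g)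
    (hA : ∀ x : S, ∃ A : AdaptedFrame q g, x ∈ A.U)
    (β : (Scheme.Modules.pullback f).obj E ⟶
      sheafHom ((Scheme.Modules.pullback f).obj E) ((Scheme.Modules.pullback f).obj L))
    (hβ : q.IsPullback f (QuadForm.ofBilin β))
    (s : sheafHom ((Scheme.Modules.pullback f).obj N) ((Scheme.Modules.pullback f).obj L) ⟶
      (Scheme.Modules.pullback f).obj E)
    (hs : s ≫ (QuadForm.ofBilin β).psi ((Scheme.Modules.pullback f).map g) = 𝟙 _) :
    q.SplitsAlong hiso f := by
  set g' := (Scheme.Modules.pullback f).map g with hg'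
  set qT := QuadForm.ofBilin β with hqT
  have hiso' : qT.IsIsotropic g' := hβ.isIsotropic hN hiso
  obtain ⟨s', hs', hsi⟩ := QuadForm.exists_isotropic_section hN.pullback hL.pullback hiso' hs β
    (fun U v => rfl)
  have := QuadForm.isIso_comp_psi hN.pullback hL.pullback hs'
  set r := qT.retraction g' s' with hr
  have hgr : g' ≫ r = 𝟙 _ := qT.comp_retraction
  have hrs : r ≫ g' ≫ qT.psi s' = qT.psi s' := qT.retraction_comp
  -- since `g r` is the identity on `N`, the morphism `1 - g r` descends from `N^⊥` to `N^⊥/N`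
  have he : g' ≫ (𝟙 _ - r ≫ g') = 0 := by
    rw [Preadditive.comp_sub, ← Category.assoc, hgr, Category.comp_id, Category.id_comp, sub_self]
  set σ := reducedDesc hiso (𝟙 _ - r ≫ g') he with hσ
  have key : ∀ (U : S.Opens) (v : Γ(q.perp g, U)), appₗ σ (f ⁻¹ᵁ U)
      ((pullMap f hiso.reducedModule).app U (appₗ (cokernel.π hiso.toPerp) U v)) =
      (pullMap f E).app U (appₗ (q.perpι g) U v) -
        appₗ g' _ (appₗ r _ ((pullMap f E).app U (appₗ (q.perpι g) U v))) :=
    fun U v => reducedDesc_pullMap hiso _ he U v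
  have hperp : ∀ (U : S.Opens) (v : Γ(q.perp g, U)),
      appₗ (qT.psi g') _ ((pullMap f E).app U (appₗ (q.perpι g) U v)) = 0 := by
    intro U v
    rw [hβ.psi g hN, AdaptedFrame.psi_perpι, map_zero]
  have hσg : σ ≫ qT.psi g' = 0 := by
    refine pullback_hom_ext fun U y => reduced_induction hiso y fun V hV v hv => ?_
    rw [← appₗ_res, ← appₗ_res, ← SemiMap.app_res, ← hv, appₗ_comp, key, map_sub, hperp, ← appₗ_comp,
      hiso'.comp_psi, appₗ_zero, appₗ_zero, sub_zero]
    exact hV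
  have hσs : σ ≫ qT.psi s' = 0 := by
    refine pullback_hom_ext fun U y => reduced_induction hiso y fun V hV v hv => ?_
    rw [← appₗ_res, ← appₗ_res, ← SemiMap.app_res, ← hv, appₗ_comp, key, map_sub, ← appₗ_comp,
      ← appₗ_comp, hrs, sub_self, appₗ_zero]
    exact hV
  refine ⟨qT, qT.comp σ, hβ, fun U y => reduced_induction hiso y fun V hV v hv => ?_,
    QuadForm.isometric_of_section hiso' hs' hsi hσg hσs fun z => ?_⟩
  · have h' : ∀ v, qT.app _ ((pullMap f E).app V v) = (pullMap f L).app V (q.app V v) := hβ V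
    rw [← pullMap_app, ← pullMap_app, ← QuadForm.app_res, ← SemiMap.app_res, ← SemiMap.app_res,
      ← QuadForm.app_res, ← hv, q.reducedForm_app, ← h']
    · change qT.app _ (appₗ σ _ _) = _
      rw [key, sub_eq_add_neg, ← map_neg, QuadForm.app_add, hiso', add_zero, ← ev_psi, hperp, map_zero,
        LinearMap.zero_apply, add_zero]
    all_goals exact hV
  · obtain ⟨A, hzA⟩ := hA (f z)
    let A' := A.pullback hβ
    have hQ := (A.isFrame_reduced hiso).pullMap (f := f)
    refine ⟨f ⁻¹ᵁ A.U, hzA, fun V hV => ?_⟩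
    have hval : ∀ c : Fin A.m → Γ(T, V), ∃ a, appₗ σ V (∑ i, c i • res _ hV
        ((pullMap f _).app A.U (appₗ (cokernel.π hiso.toPerp) A.U (A.perpSec i)))) =
        appₗ g' V a + ∑ i, c i • res _ hV (A'.w i) := by
      intro c
      refine ⟨- ∑ i, c i • res _ hV (appₗ r _ (A'.w i)), ?_⟩
      simp only [map_sum, map_smul, appₗ_res, key, A.perpι_perpSec, map_sub, smul_sub, map_neg,
        Finset.sum_sub_distrib]
      rw [neg_add_eq_sub]
      rfl
    constructor
    · rw [injective_iff_map_eq_zero]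
      intro y hy
      rw [← hQ.sum_coord hV y] at hy ⊢
      obtain ⟨a, ha⟩ := hval (hQ.coord hV y)
      have h0 : hQ.coord hV y = 0 := A'.eq_zero_of_add_eq_zero hV a _ (ha.symm.trans hy)
      simp only [h0, Pi.zero_apply, zero_smul, Finset.sum_const_zero]
    · intro v hv
      obtain ⟨a, c, rfl⟩ := A'.decomp_perp hiso' hV v hv
      obtain ⟨a', ha'⟩ := hval c
      refine ⟨a - a', ∑ i, c i • res _ hV ((pullMap f _).app A.U
        (appₗ (cokernel.π hiso.toPerp) A.U (A.perpSec i))), ?_⟩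
      refine Eq.trans ?_ (congrArg (appₗ g' V (a - a') + ·) ha'.symm)
      rw [map_sub]
      rw [← add_assoc, sub_add_cancel]
      rfl

end

end pullback

/-! ### Values at a point -/

/-- The value of a function at a point, in the residue field. -/
def valAt (x : S) {U : S.Opens} (hx : x ∈ U) : Γ(S, U) →+* S.residueField x :=
  (S.evaluation U x hx).hom

lemma valAt_fres {x : S} {U V : S.Opens} (h : V ≤ U) (hx : x ∈ V) (a : Γ(S, U)) :
    valAt x hx (fres h a) = valAt x (h hx) a :=
  congrArg (S.residue x) (TopCat.Presheaf.germ_res_apply S.presheaf (homOfLE h) x hx a)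

lemma mem_vanishingIdeal {x : S} {U : S.Opens} (hx : x ∈ U) (a : Γ(S, U)) :
    a ∈ vanishingIdeal x U hx ↔ valAt x hx a = 0 :=
  (IsLocalRing.residue_eq_zero_iff _).symm

lemma exists_isUnit_fres {x : S} {U : S.Opens} (hx : x ∈ U) (a : Γ(S, U)) (ha : valAt x hx a ≠ 0) :
    ∃ (V : S.Opens) (hV : V ≤ U), x ∈ V ∧ IsUnit (fres hV a) :=
  ⟨S.basicOpen a, S.basicOpen_le a, (S.evaluation_ne_zero_iff_mem_basicOpen x hx a).1 ha,
    RingedSpace.isUnit_res_basicOpen S.toRingedSpace a⟩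

/-- Finitely many elements of the residue field lift to functions near the point. -/
lemma exists_valAt {x : S} {U : S.Opens} (hx : x ∈ U) {ι : Type*} [Finite ι]
    (c : ι → S.residueField x) :
    ∃ (V : S.Opens) (_ : V ≤ U) (hxV : x ∈ V) (a : ι → Γ(S, V)), ∀ i, valAt x hxV (a i) = c i := by
  have h : ∀ i, ∃ (V : S.Opens) (hxV : x ∈ V) (a : Γ(S, V)), valAt x hxV a = c i := by
    intro i
    obtain ⟨y, hy⟩ := S.residue_surjective x (c i)
    obtain ⟨V, hxV, a, ha⟩ := TopCat.Presheaf.exists_germ_eq S.presheaf y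
    exact ⟨V, hxV, a, (congrArg (S.residue x) ha).trans hy⟩
  choose V hxV a ha using h
  let W : S.Opens := ⟨⋂ i, (V i : Set S), isOpen_iInter_of_finite fun i => (V i).2⟩
  have hW : ∀ i, W ≤ V i := fun i => Set.iInter_subset _ i
  have hxW : x ∈ U ⊓ W := ⟨hx, Set.mem_iInter.2 hxV⟩
  refine ⟨U ⊓ W, inf_le_left, hxW, fun i => fres (inf_le_right.trans (hW i)) (a i), fun i => ?_⟩
  rw [valAt_fres, ha]

/-- A section vanishes at a point if and only if its coordinates do. -/
lemma IsFrame.vanishesAt_iff {M : S.Modules} {U : S.Opens} {ι : Type*} [Fintype ι]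
    {e : ι → Γ(M, U)} (he : IsFrame M e) {V : S.Opens} (hV : V ≤ U) {x : S} (hx : x ∈ V)
    (v : Γ(M, V)) : VanishesAt M x v ↔ ∀ i, valAt x hx (he.coord hV v i) = 0 := by
  constructor
  · rintro ⟨W, hW, hxW, h⟩ i
    have h2 : ∀ w ∈ vanishingIdeal x W hxW • (⊤ : Submodule Γ(S, W) Γ(M, W)),
        valAt x hxW (he.coord (hW.trans hV) w i) = 0 := by
      intro w hw
      refine Submodule.smul_induction_on hw (fun r hr m _ => ?_) fun a b ha hb => ?_
      · rw [map_smul, Pi.smul_apply, smul_eq_mul, map_mul, (mem_vanishingIdeal hxW r).1 hr, zero_mul]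
      · rw [map_add, Pi.add_apply, map_add, ha, hb, add_zero]
    have := h2 _ h
    rwa [he.coord_res hV hW, valAt_fres] at this
  · intro h
    refine ⟨V, le_rfl, hx, ?_⟩
    rw [res_self, ← he.sum_coord hV v]
    exact Submodule.sum_mem _ fun i _ => Submodule.smul_mem_smul
      ((mem_vanishingIdeal hx _).2 (h i)) trivial

lemma IsFrame.of_isUnit_det {M : S.Modules} {U : S.Opens} {ι : Type*} [Fintype ι] [DecidableEq ι]
    {e : ι → Γ(M, U)} (he : IsFrame M e) (A : Matrix ι ι Γ(S, U)) (hA : IsUnit A.det) :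
    IsFrame M fun i => ∑ j, A i j • e j := by
  intro V hV
  have hA' : IsUnit (A.map (fres hV)) := by
    rw [Matrix.isUnit_iff_isUnit_det]
    have := hA.map (fres hV)
    rwa [RingHom.map_det] at this
  have h1 : Function.Bijective fun c : ι → Γ(S, V) => Matrix.vecMul c (A.map (fres hV)) := by
    obtain ⟨B, hB, hB'⟩ := isUnit_iff_exists.1 hA'
    refine Function.bijective_iff_has_inverse.2 ⟨fun c => Matrix.vecMul c B, fun c => ?_, fun c => ?_⟩
    · simp only [Matrix.vecMul_vecMul, hB, Matrix.vecMul_one]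
    · simp only [Matrix.vecMul_vecMul, hB', Matrix.vecMul_one]
  convert! (he V hV).comp h1 using 1
  funext c
  simp only [Function.comp_apply, Matrix.vecMul, dotProduct, Matrix.map_apply, map_sum, res_smul,
    Finset.smul_sum, Finset.sum_smul, mul_smul]
  exact Finset.sum_comm

/-- Sections whose values at `x` form a basis of the fibre are a frame near `x`. -/
lemma IsFrame.exists_of_basis {M : S.Modules} {U : S.Opens} {ι κ : Type*} [Fintype ι] [Fintype κ]
    {e : ι → Γ(M, U)} (he : IsFrame M e) {V : S.Opens} (hV : V ≤ U) {x : S} (hx : x ∈ V)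
    (v : κ → Γ(M, V)) (b : Module.Basis κ (S.residueField x) (ι → S.residueField x))
    (hb : ∀ k i, valAt x hx (he.coord hV (v k) i) = b k i) :
    ∃ (W : S.Opens) (hW : W ≤ V), x ∈ W ∧ IsFrame M fun k => res M hW (v k) := by
  classical
  let σ : κ ≃ ι := b.indexEquiv (Pi.basisFun _ ι)
  let A : Matrix ι ι Γ(S, V) := Matrix.of fun i j => he.coord hV (v (σ.symm i)) j
  have hdet : valAt x hx A.det ≠ 0 := by
    have h : LinearIndependent (S.residueField x) (A.map (valAt x hx)).row := by
      convert! (b.reindex σ).linearIndependent using 1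
      funext i j
      simp [A, hb]
    rw [RingHom.map_det]
    exact ((Matrix.isUnit_iff_isUnit_det _).1 (Matrix.linearIndependent_rows_iff_isUnit.1 h)).ne_zero
  obtain ⟨W, hW, hxW, hu⟩ := exists_isUnit_fres hx _ hdet
  refine ⟨W, hW, hxW, ?_⟩
  rw [RingHom.map_det] at hu
  have := ((he.restrict (hW.trans hV)).of_isUnit_det _ hu).reindex σ
  convert! this using 1
  funext k
  simp only [Function.comp_apply, RingHom.mapMatrix_apply, Matrix.map_apply, A, Matrix.of_apply,
    Equiv.symm_apply_apply]
  conv_lhs => rw [← he.sum_coord hV (v k)]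
  simp only [map_sum, res_smul, res_res]

/-! ### Existence of adapted frames -/

/-- If `γ` is isotropic and in duality with `τ`, then they are completed to a basis by vectors
orthogonal to `γ`. -/
lemma exists_orthogonal_complement {K V : Type*} [Field K] [AddCommGroup V] [Module K V]
    [FiniteDimensional K V] {r : ℕ} (γ τ : Fin r → V) (φ : Fin r → V →ₗ[K] K)
    (hγ : LinearIndependent K γ) (h0 : ∀ i j, φ j (γ i) = 0)
    (h1 : ∀ i j, φ j (τ i) = Pi.single (M := fun _ => K) i 1 j) :
    ∃ (m : ℕ) (w : Fin m → V), (∀ i j, φ j (w i) = 0) ∧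
      ∃ b : Module.Basis ((Fin r ⊕ Fin m) ⊕ Fin r) K V, ⇑b = Sum.elim (Sum.elim γ w) τ := by
  classical
  let W : Submodule K V := LinearMap.ker (LinearMap.pi φ)
  have hW : ∀ v ∈ W, ∀ j, φ j v = 0 := fun v hv j => congrFun (LinearMap.mem_ker.1 hv) j
  have hW' : ∀ v, (∀ j, φ j v = 0) → v ∈ W := fun v hv => LinearMap.mem_ker.2 (funext hv)
  have hsum : ∀ (d : Fin r → K) j, φ j (∑ k, d k • τ k) = d j := by
    intro d j
    simp [h1, Pi.single_apply]
  let γ' : Fin r → W := fun i => ⟨γ i, hW' _ (h0 i)⟩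
  have hγ' : LinearIndependent K γ' := LinearIndependent.of_comp W.subtype hγ
  let b₀ := Module.Basis.sumExtend hγ'
  have : Finite (Fin r ⊕ Module.Basis.sumExtendIndex hγ') := Module.Finite.finite_basis b₀
  have : Finite (Module.Basis.sumExtendIndex hγ') := Finite.sum_right (Fin r)
  obtain ⟨m, ⟨ε⟩⟩ := Finite.exists_equiv_fin (Module.Basis.sumExtendIndex hγ')
  let b₁ := b₀.reindex (Equiv.sumCongr (Equiv.refl (Fin r)) ε)
  have hb₁ : ∀ i, b₁ (Sum.inl i) = γ' i := by
    intro i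
    have h : b₁ (Sum.inl i) = b₀ (Sum.inl i) := by simp [b₁]
    rw [h]
    simp only [b₀, Module.Basis.sumExtend, Module.Basis.reindex_apply,
      Module.Basis.extend_apply_self]
    exact congrArg Subtype.val (@Equiv.Set.sumDiffSubset_apply_inl _ _ _
      (hγ'.linearIndepOn_id.subset_extend (Set.subset_univ _)) (Classical.decPred _) _)
  let F : W × (Fin r → K) →ₗ[K] V := W.subtype.coprod (Fintype.linearCombination K τ)
  have hF : Function.Bijective F := by
    constructor
    · rw [injective_iff_map_eq_zero]
      rintro ⟨w, d⟩ h
      have h' : (w : V) + ∑ k, d k • τ k = 0 := h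
      have hd : d = 0 := by
        funext j
        have := congrArg (φ j) h'
        rwa [map_add, hW w w.2, hsum, zero_add, map_zero] at this
      subst hd
      simp only [Pi.zero_apply, zero_smul, Finset.sum_const_zero, add_zero] at h'
      rw [Prod.mk_eq_zero]
      exact ⟨Subtype.ext h', rfl⟩
    · intro v
      refine ⟨(⟨v - ∑ k, φ k v • τ k, hW' _ fun j => ?_⟩, fun k => φ k v), ?_⟩
      · rw [map_sub, hsum, sub_self]
      · exact sub_add_cancel _ _
  refine ⟨m, fun i => (b₁ (Sum.inr i) : V), fun i j => hW _ (b₁ (Sum.inr i)).2 j,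
    (b₁.prod (Pi.basisFun K (Fin r))).map (LinearEquiv.ofBijective F hF), ?_⟩
  funext i
  rcases i with (i | i) | i
  · simp [F, hb₁, γ']
  · simp [F]
  · simp [F, Fintype.linearCombination_apply, Pi.single_apply]

section

variable {E L N : S.Modules} {q : QuadForm E L} {g : N ⟶ E}

/-- Regularity of the subbundle, for the matrix of `b_q (e_i, g n_j)` over the residue field. -/
lemma QuadForm.IsRegularSubbundle.mulVec_injective (hreg : q.IsRegularSubbundle g) {U : S.Opens}
    {x : S} (hx : x ∈ U) {p r : ℕ} {e : Fin p → Γ(E, U)} {n : Fin r → Γ(N, U)} {l : Unit → Γ(L, U)}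
    (he : IsFrame E e) (hn : IsFrame N n) (hl : IsFrame L l) (B : Matrix (Fin p) (Fin r) Γ(S, U))
    (hB : ∀ i j, q.b U (e i) (appₗ g U (n j)) = B i j • l ()) :
    Function.Injective (B.map (valAt x hx)).mulVec := by
  suffices ∀ c, (B.map (valAt x hx)).mulVec c = 0 → c = 0 by
    intro c d hcd
    rw [← sub_eq_zero]
    exact this _ (by rw [Matrix.mulVec_sub, sub_eq_zero]; exact hcd)
  intro c hc
  by_contra hne
  obtain ⟨V, hV, hxV, a, ha⟩ := exists_valAt hx c
  have h1 : ¬ VanishesAt N x (∑ j, a j • res N hV (n j)) := by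
    rw [hn.vanishesAt_iff hV hxV, hn.coord_sum]
    exact fun h => hne (funext fun j => by rw [← ha, h]; rfl)
  obtain ⟨W, hW, hxW, v, hv⟩ := hreg x V hxV _ h1
  apply hv
  have h2 : q.b W (appₗ g W (res N hW (∑ j, a j • res N hV (n j)))) v =
      ∑ i, (∑ i', he.coord (hW.trans hV) v i' * ∑ j, fres hW (a j) * fres (hW.trans hV) (B i' j)) •
        res L (hW.trans hV) (l i) := by
    rw [QuadForm.b_comm]
    conv_lhs => rw [← he.sum_coord (hW.trans hV) v]
    simp only [map_sum, map_smul, res_smul, res_res, appₗ_res, LinearMap.sum_apply,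
      LinearMap.smul_apply, q.b_res, hB, Finset.univ_unique, Finset.sum_singleton, Finset.sum_smul,
      mul_smul, Finset.smul_sum, PUnit.default_eq_unit]
    rw [Finset.sum_comm]
    refine Finset.sum_congr rfl fun i _ => Finset.sum_congr rfl fun j _ => smul_comm _ _ _
  rw [hl.vanishesAt_iff (hW.trans hV) hxW, h2]
  intro i
  rw [hl.coord_sum (hW.trans hV), map_sum]
  refine Finset.sum_eq_zero fun i' _ => ?_
  rw [map_mul, map_sum]
  have h3 := congrFun hc i'
  simp only [Matrix.mulVec, dotProduct, Matrix.map_apply, Pi.zero_apply] at h3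
  simp only [map_mul, valAt_fres, ha]
  rw [← mul_zero (valAt x hxW _), ← h3]
  congr 1
  exact Finset.sum_congr rfl fun j _ => mul_comm _ _

/-- Adapted frames exist near every point. -/
theorem exists_adaptedFrame (hE : IsVectorBundle E) (hL : IsLineBundle L) (hN : IsVectorBundle N)
    (hiso : q.IsIsotropic g) (hreg : q.IsRegularSubbundle g) (x : S) :
    ∃ A : AdaptedFrame q g, x ∈ A.U := by
  classical
  obtain ⟨U₁, hx₁, p, e, he⟩ := hE.exists_frame x
  obtain ⟨U₂, hx₂, r, n, hn⟩ := hN.exists_frame x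
  obtain ⟨U₃, hx₃, l, hl⟩ := hL.exists_frame x
  let U := U₁ ⊓ (U₂ ⊓ U₃)
  have hx : x ∈ U := ⟨hx₁, hx₂, hx₃⟩
  obtain ⟨e, he⟩ : ∃ e : Fin p → Γ(E, U), IsFrame E e := ⟨_, he.restrict inf_le_left⟩
  obtain ⟨n, hn⟩ : ∃ n : Fin r → Γ(N, U), IsFrame N n :=
    ⟨_, hn.restrict (inf_le_right.trans inf_le_left)⟩
  obtain ⟨l, hl⟩ : ∃ l : Unit → Γ(L, U), IsFrame L l :=
    ⟨_, hl.restrict (inf_le_right.trans inf_le_right)⟩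
  generalize U = U at *
  let B : Matrix (Fin p) (Fin r) Γ(S, U) := Matrix.of fun i j =>
    hl.coord le_rfl (q.b U (e i) (appₗ g U (n j))) ()
  have hB : ∀ i j, q.b U (e i) (appₗ g U (n j)) = B i j • l () := by
    intro i j
    have := hl.sum_coord le_rfl (q.b U (e i) (appₗ g U (n j)))
    rw [Finset.univ_unique, Finset.sum_singleton, res_self] at this
    exact this.symm
  have hinj := hreg.mulVec_injective hx he hn hl B hB
  have hb : ∀ {V : S.Opens} (hV : V ≤ U) (c : Fin p → Γ(S, V)) (j : Fin r),
      q.b V (∑ i, c i • res E hV (e i)) (appₗ g V (res N hV (n j))) =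
        (∑ i, c i * fres hV (B i j)) • res L hV (l ()) := by
    intro V hV c j
    simp only [map_sum, map_smul, LinearMap.sum_apply, LinearMap.smul_apply, appₗ_res, q.b_res, hB,
      res_smul, Finset.sum_smul, mul_smul]
  -- a left inverse of the matrix over the residue field lifts, up to a unit determinant
  obtain ⟨C, hC⟩ : ∃ C : Matrix (Fin r) (Fin p) (S.residueField x), C * B.map (valAt x hx) = 1 := by
    obtain ⟨F, hF⟩ := (Matrix.toLin' (B.map (valAt x hx))).exists_leftInverse_of_injective
      (LinearMap.ker_eq_bot.2 hinj)
    refine ⟨LinearMap.toMatrix' F, ?_⟩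
    have := congrArg LinearMap.toMatrix' hF
    rwa [LinearMap.toMatrix'_comp, LinearMap.toMatrix'_toLin', LinearMap.toMatrix'_id] at this
  obtain ⟨V₁, hV₁, hxV₁, C', hC'⟩ := exists_valAt hx (fun p : Fin r × Fin p => C p.1 p.2)
  let M : Matrix (Fin r) (Fin r) Γ(S, V₁) :=
    Matrix.of (fun k i => C' (k, i)) * B.map (fres hV₁)
  have hM : M.map (valAt x hxV₁) = 1 := by
    rw [Matrix.map_mul, ← hC]
    congr 1
    · ext k i
      exact hC' (k, i)
    · ext i j
      exact valAt_fres hV₁ hxV₁ _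
  obtain ⟨V₂, hV₂, hxV₂, hu⟩ := exists_isUnit_fres hxV₁ M.det (by
    rw [RingHom.map_det, RingHom.mapMatrix_apply, hM, Matrix.det_one]
    exact one_ne_zero)
  have h₂ : V₂ ≤ U := hV₂.trans hV₁
  obtain ⟨D, hD⟩ : ∃ D : Matrix (Fin r) (Fin p) Γ(S, V₂), D * B.map (fres h₂) = 1 := by
    rw [RingHom.map_det, RingHom.mapMatrix_apply] at hu
    refine ⟨(M.map (fres hV₂))⁻¹ * (Matrix.of (fun k i => C' (k, i))).map (fres hV₂), ?_⟩
    have : B.map (fres h₂) = (B.map (fres hV₁)).map (fres hV₂) := by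
      ext i j
      exact (fres_fres _ _ _).symm
    rw [Matrix.mul_assoc, this, ← Matrix.map_mul, Matrix.nonsing_inv_mul _ hu]
  let D₀ : Matrix (Fin r) (Fin p) (S.residueField x) := D.map (valAt x hxV₂)
  let B₀ : Matrix (Fin p) (Fin r) (S.residueField x) := B.map (valAt x hx)
  have hD₀ : D₀ * B₀ = 1 := by
    have := congrArg (fun M => M.map (valAt x hxV₂)) hD
    simp only [Matrix.map_mul] at this
    rw [Matrix.map_one _ (map_zero _) (map_one _)] at this
    rw [← this]
    congr 1
    ext i j
    exact (valAt_fres h₂ hxV₂ _).symm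
  -- `γ` is the frame of `N` in the fibre of `E`; by `hD₀` the rows of `D₀` are dual to it
  let γ : Fin r → Fin p → S.residueField x := fun j i =>
    valAt x hx (he.coord le_rfl (appₗ g U (n j)) i)
  have hcoord : ∀ {V : S.Opens} (hV : V ≤ U) (a b : Γ(S, V)),
      a • res L hV (l ()) = b • res L hV (l ()) → a = b := by
    intro V hV a b hab
    have := (hl V hV).1
    refine congrFun (@this (fun _ => a) (fun _ => b) ?_) ()
    simpa using hab
  have hgn : ∀ j, appₗ g U (n j) =
      ∑ i, he.coord le_rfl (appₗ g U (n j)) i • res E le_rfl (e i) := fun j =>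
    (he.sum_coord le_rfl _).symm
  have hγφ : ∀ i j, Matrix.vecMul (γ i) B₀ j = 0 := by
    intro i j
    have h1 := hb le_rfl (he.coord le_rfl (appₗ g U (n i))) j
    rw [← hgn, res_self, hiso.b_eq_zero, ← zero_smul Γ(S, U) (res L le_rfl (l ()))] at h1
    have h2 := congrArg (valAt x hx) (hcoord le_rfl _ _ h1)
    simp only [map_zero, map_sum, map_mul, fres_self] at h2
    exact h2.symm
  -- a relation `∑ a_j g(n_j) = 0` in the fibre gives `B₀ a = 0`, whence `a = 0` by regularity
  have hγ : LinearIndependent (S.residueField x) γ := by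
    rw [Fintype.linearIndependent_iff]
    intro a ha
    refine congrFun (hinj (?_ : B₀.mulVec a = B₀.mulVec 0))
    rw [Matrix.mulVec_zero]
    funext i
    have hG : ∀ k, q.b U (e k) (e i) =
        hl.coord le_rfl (q.b U (e k) (e i)) () • res L le_rfl (l ()) := by
      intro k
      have := hl.sum_coord le_rfl (q.b U (e k) (e i))
      rw [Finset.univ_unique, Finset.sum_singleton] at this
      exact this.symm
    have h1 : ∀ j, B i j = ∑ k, he.coord le_rfl (appₗ g U (n j)) k *
        hl.coord le_rfl (q.b U (e k) (e i)) () := by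
      intro j
      apply hcoord le_rfl
      rw [res_self, ← hB, QuadForm.b_comm]
      conv_lhs => rw [hgn j]
      simp only [map_sum, map_smul, LinearMap.sum_apply, LinearMap.smul_apply, res_self,
        Finset.sum_smul, mul_smul]
      refine Finset.sum_congr rfl fun k _ => ?_
      conv_lhs => rw [hG k, res_self]
    have h2 : ∀ k, ∑ j, a j * γ j k = 0 := fun k => by
      have := congrFun ha k
      simpa using this
    simp only [Matrix.mulVec, dotProduct, B₀, Matrix.map_apply, h1, map_sum, map_mul, Pi.zero_apply,
      Finset.sum_mul]
    rw [Finset.sum_comm]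
    refine Finset.sum_eq_zero fun k _ => ?_
    rw [← zero_mul (valAt x hx (hl.coord le_rfl (q.b U (e k) (e i)) ())), ← h2 k, Finset.sum_mul]
    exact Finset.sum_congr rfl fun j _ => by ring
  obtain ⟨m, w₀, hw₀, bas, hbas⟩ := exists_orthogonal_complement γ (fun k i => D₀ k i)
    (fun j => (LinearMap.proj j).comp B₀.vecMulLinear) hγ hγφ (fun i j => by
      have := congrFun (congrFun hD₀ i) j
      rw [Matrix.one_eq_pi_single] at this
      exact this)
  -- lift the complement to `Y'`; the correction term of `Z` makes it orthogonal to `N` and vanishes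
  -- at `x`, since the complement is orthogonal to `N` in the fibre
  obtain ⟨V₃, hV₃, hxV₃, Y, hY⟩ := exists_valAt hxV₂ (fun p : Fin m × Fin p => w₀ p.1 p.2)
  have h₃ : V₃ ≤ U := hV₃.trans h₂
  let B' : Matrix (Fin p) (Fin r) Γ(S, V₃) := B.map (fres h₃)
  let D' : Matrix (Fin r) (Fin p) Γ(S, V₃) := D.map (fres hV₃)
  let Y' : Matrix (Fin m) (Fin p) Γ(S, V₃) := Matrix.of fun k i => Y (k, i)
  have hDB : D' * B' = 1 := by
    have := congrArg (fun M => M.map (fres hV₃)) hD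
    simp only [Matrix.map_mul] at this
    rw [Matrix.map_one _ (map_zero _) (map_one _)] at this
    rw [← this]
    congr 1
    ext i j
    exact (fres_fres _ _ _).symm
  let Z : Matrix (Fin m) (Fin p) Γ(S, V₃) := Y' - Y' * B' * D'
  have hZB : Z * B' = 0 := by
    rw [Matrix.sub_mul, Matrix.mul_assoc _ D', hDB, Matrix.mul_one, sub_self]
  have hB₀ : B'.map (valAt x hxV₃) = B₀ := by
    ext i j
    exact valAt_fres _ hxV₃ _
  have hZ : ∀ i j, valAt x hxV₃ (Z i j) = w₀ i j := by
    intro i j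
    have h1 : (Y' * B').map (valAt x hxV₃) = 0 := by
      rw [Matrix.map_mul, hB₀]
      ext i k
      refine Eq.trans ?_ (hw₀ i k)
      simp only [Matrix.mul_apply, Matrix.map_apply, Y', Matrix.of_apply, hY]
      rfl
    have h2 : (Z i j) = Y (i, j) - ∑ k, (Y' * B') i k * D' k j := rfl
    rw [h2, map_sub, hY, map_sum, Finset.sum_eq_zero, sub_zero]
    intro k _
    have := congrFun (congrFun h1 i) k
    rw [Matrix.map_apply] at this
    rw [map_mul, this, Matrix.zero_apply, zero_mul]
  let w : Fin m → Γ(E, V₃) := fun k => ∑ i, Z k i • res E h₃ (e i)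
  let t : Fin r → Γ(E, V₃) := fun k => ∑ i, D' k i • res E h₃ (e i)
  obtain ⟨V, hV, hxV, hframe⟩ := he.exists_of_basis h₃ hxV₃
    (Sum.elim (Sum.elim (fun i => res E h₃ (appₗ g U (n i))) w) t) bas (by
      rintro ((k | k) | k) i
      · simp only [Sum.elim_inl, hbas]
        have := he.coord_res le_rfl h₃ (appₗ g U (n k)) i
        rw [this, valAt_fres]
      · simp only [Sum.elim_inl, Sum.elim_inr, hbas, w, he.coord_sum, hZ]
      · simp only [Sum.elim_inr, hbas, t, he.coord_sum]
        exact valAt_fres hV₃ hxV₃ _)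
  have hVU : V ≤ U := hV.trans h₃
  refine ⟨⟨V, r, m, fun i => res N hVU (n i), fun i => res L hVU (l i), fun i => res E hV (w i),
    fun i => res E hV (t i), hn.restrict hVU, hl.restrict hVU, ?_, fun i j => ?_, fun i j => ?_⟩, hxV⟩
  · convert! hframe using 1
    funext i
    rcases i with (i | i) | i
    · simp only [Sum.elim_inl, appₗ_res, res_res]
    · rfl
    · rfl
  · rw [← res_res N h₃ hV, appₗ_res, q.b_res, hb h₃]
    have : ∑ k, Z i k * fres h₃ (B k j) = 0 := congrFun (congrFun hZB i) j
    rw [this, zero_smul, map_zero]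
  · rw [← res_res N h₃ hV, appₗ_res, q.b_res, hb h₃]
    have : ∑ k, D' i k * fres h₃ (B k j) = (1 : Matrix _ _ _) i j := congrFun (congrFun hDB i) j
    rw [this]
    obtain rfl | hij := eq_or_ne i j
    · rw [Matrix.one_apply_eq, one_smul, Pi.single_eq_same, res_res]
    · rw [Matrix.one_apply_ne hij, zero_smul, map_zero, Pi.single_eq_of_ne hij.symm]

end

/-! ### Affine frames of sections and of bilinear forms -/

namespace AffFrame

/-- An affine frame indexed by a finite type. -/
def ofFintype {H : S.Modules} {X : ∀ U : S.Opens, Set Γ(H, U)} {ι : Type*} [Fintype ι]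
    (U : S.Opens) (s : Γ(H, U)) (h : ι → Γ(H, U))
    (bij : ∀ (V : S.Opens) (hV : V ≤ U), Set.BijOn
      (fun c : ι → Γ(S, V) => res H hV s + ∑ i, c i • res H hV (h i)) Set.univ (X V)) :
    AffFrame H X where
  U := U
  n := Fintype.card ι
  s := s
  h := h ∘ (Fintype.equivFin ι).symm
  bij V hV := by
    have h1 : Set.BijOn (fun c : Fin (Fintype.card ι) → Γ(S, V) => c ∘ Fintype.equivFin ι)
        Set.univ Set.univ :=
      Set.bijOn_univ.2 (Equiv.arrowCongr (Fintype.equivFin ι).symm (Equiv.refl Γ(S, V))).bijective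
    convert! (bij V hV).comp h1 using 1
    funext c
    simp only [Function.comp_apply]
    congr 1
    exact Fintype.sum_equiv (Fintype.equivFin ι).symm _ _ (by simp)

end AffFrame

lemma biprod_ext {A B : S.Modules} {U : S.Opens} {u v : Γ(A ⊞ B, U)}
    (h₁ : appₗ (biprod.fst : A ⊞ B ⟶ A) U u = appₗ biprod.fst U v)
    (h₂ : appₗ (biprod.snd : A ⊞ B ⟶ B) U u = appₗ biprod.snd U v) : u = v := by
  have h : ∀ w : Γ(A ⊞ B, U), w = appₗ biprod.inl U (appₗ (biprod.fst : A ⊞ B ⟶ A) U w) +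
      appₗ biprod.inr U (appₗ (biprod.snd : A ⊞ B ⟶ B) U w) := by
    intro w
    rw [← appₗ_comp, ← appₗ_comp, ← appₗ_add, biprod.total, appₗ_id]
  rw [h u, h v, h₁, h₂]

/-- The product of two subsheaves of sets. -/
def prodSet {A B : S.Modules} (X : ∀ U : S.Opens, Set Γ(A, U)) (Y : ∀ U : S.Opens, Set Γ(B, U))
    (U : S.Opens) : Set Γ(A ⊞ B, U) :=
  {u | appₗ biprod.fst U u ∈ X U ∧ appₗ biprod.snd U u ∈ Y U}

/-- The product of two affine frames, on the intersection of their domains. -/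
def AffFrame.prod {A B : S.Modules} {X : ∀ U : S.Opens, Set Γ(A, U)} {Y : ∀ U : S.Opens, Set Γ(B, U)}
    (σ : AffFrame A X) (τ : AffFrame B Y) : AffFrame (A ⊞ B) (prodSet X Y) :=
  AffFrame.ofFintype (σ.U ⊓ τ.U)
    (appₗ biprod.inl _ (res A inf_le_left σ.s) + appₗ biprod.inr _ (res B inf_le_right τ.s))
    (Sum.elim (fun i => appₗ biprod.inl _ (res A inf_le_left (σ.h i)))
      fun i => appₗ biprod.inr _ (res B inf_le_right (τ.h i))) (by
    intro V hV
    have hσ := σ.bij V (hV.trans inf_le_left)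
    have hτ := τ.bij V (hV.trans inf_le_right)
    have ll : ∀ (W : S.Opens) (a : Γ(A, W)), appₗ (biprod.fst : A ⊞ B ⟶ A) W
        (appₗ biprod.inl W a) = a := fun W a => by rw [← appₗ_comp, biprod.inl_fst, appₗ_id]
    have rr : ∀ (W : S.Opens) (a : Γ(B, W)), appₗ (biprod.snd : A ⊞ B ⟶ B) W
        (appₗ biprod.inr W a) = a := fun W a => by rw [← appₗ_comp, biprod.inr_snd, appₗ_id]
    have lr : ∀ (W : S.Opens) (a : Γ(A, W)), appₗ (biprod.snd : A ⊞ B ⟶ B) W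
        (appₗ biprod.inl W a) = 0 := fun W a => by rw [← appₗ_comp, biprod.inl_snd, appₗ_zero]
    have rl : ∀ (W : S.Opens) (a : Γ(B, W)), appₗ (biprod.fst : A ⊞ B ⟶ A) W
        (appₗ biprod.inr W a) = 0 := fun W a => by rw [← appₗ_comp, biprod.inr_fst, appₗ_zero]
    set F := fun c : Fin σ.n ⊕ Fin τ.n → Γ(S, V) => res (A ⊞ B) hV
      (appₗ biprod.inl _ (res A inf_le_left σ.s) + appₗ biprod.inr _ (res B inf_le_right τ.s)) +
      ∑ i, c i • res (A ⊞ B) hV (Sum.elim (fun i => appₗ biprod.inl _ (res A inf_le_left (σ.h i)))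
        (fun i => appₗ biprod.inr _ (res B inf_le_right (τ.h i))) i) with hF
    have fst_F : ∀ c, appₗ biprod.fst V (F c) = res A (hV.trans inf_le_left) σ.s +
        ∑ i, c (Sum.inl i) • res A (hV.trans inf_le_left) (σ.h i) := by
      intro c
      simp only [hF, Fintype.sum_sum_type, Sum.elim_inl, Sum.elim_inr, map_add, map_sum, map_smul,
        ← appₗ_res, ll, rl, res_res, smul_zero, Finset.sum_const_zero, add_zero]
    have snd_F : ∀ c, appₗ biprod.snd V (F c) = res B (hV.trans inf_le_right) τ.s +
        ∑ i, c (Sum.inr i) • res B (hV.trans inf_le_right) (τ.h i) := by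
      intro c
      simp only [hF, Fintype.sum_sum_type, Sum.elim_inl, Sum.elim_inr, map_add, map_sum, map_smul,
        ← appₗ_res, lr, rr, res_res, smul_zero, Finset.sum_const_zero, zero_add]
    refine ⟨fun c _ => ⟨?_, ?_⟩, fun c _ d _ hcd => ?_, fun u hu => ?_⟩
    · rw [fst_F]
      exact hσ.1 (Set.mem_univ fun i => c (Sum.inl i))
    · rw [snd_F]
      exact hτ.1 (Set.mem_univ fun i => c (Sum.inr i))
    · have h1 := congrArg (appₗ biprod.fst V) hcd
      have h2 := congrArg (appₗ biprod.snd V) hcd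
      rw [fst_F, fst_F] at h1
      rw [snd_F, snd_F] at h2
      have h1' := hσ.2.1 (Set.mem_univ fun i => c (Sum.inl i)) (Set.mem_univ _) h1
      have h2' := hτ.2.1 (Set.mem_univ fun i => c (Sum.inr i)) (Set.mem_univ _) h2
      funext i
      rcases i with i | i
      · exact congrFun h1' i
      · exact congrFun h2' i
    · obtain ⟨c, -, hc⟩ := hσ.2.2 hu.1
      obtain ⟨d, -, hd⟩ := hτ.2.2 hu.2
      refine ⟨Sum.elim c d, Set.mem_univ _, biprod_ext ?_ ?_⟩
      · rw [fst_F, ← hc]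
        rfl
      · rw [snd_F, ← hd]
        rfl)

section

variable {E L N : S.Modules} (q : QuadForm E L) (g : N ⟶ E)

/-- The local sections of `ψ_{q,N} : E → Hom(N, L)`, that is, the `s` with `ψ_{q,N} (s h) = h` for all
sections `h` of `Hom(N, L)` over smaller open sets. -/
def dualSec (U : S.Opens) : Set Γ(sheafHom (sheafHom N L) E, U) :=
  {s | ∀ (V : S.Opens) (hV : V ≤ U) (h : Γ(sheafHom N L, V)),
    appₗ (q.psi g) V (ev V (res _ hV s) h) = h}

/-- The bilinear forms `β` on `E` with `β(v)(v) = q(v)`. -/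
def bilinSec (U : S.Opens) : Set Γ(sheafHom E (sheafHom E L), U) :=
  {β | ∀ (V : S.Opens) (hV : V ≤ U) (v : Γ(E, V)), ev V (ev V (res _ hV β) v) v = q.app V v}

variable {q g}

/-- It suffices to test a section of `ψ_{q,N}` on the dual frame of `n`. -/
lemma AdaptedFrame.mem_dualSec_iff (A : AdaptedFrame q g) {V : S.Opens} (hV : V ≤ A.U)
    (s : Γ(sheafHom (sheafHom N L) E, V)) : s ∈ dualSec q g V ↔
      ∀ i, appₗ (q.psi g) V (ev V s (res _ hV (A.isFrame_n.lift (Pi.single i (A.l ()))))) =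
        res _ hV (A.isFrame_n.lift (Pi.single i (A.l ()))) := by
  constructor
  · intro hs i
    have := hs V le_rfl (res _ hV (A.isFrame_n.lift (Pi.single i (A.l ()))))
    rwa [res_self] at this
  · intro hs W hW h
    rw [← (A.isFrame_n.sheafHom A.isFrame_l).sum_coord (hW.trans hV) h]
    simp only [map_sum, map_smul]
    refine Finset.sum_congr rfl fun p _ => ?_
    rw [← res_res _ hV hW, ev_res, appₗ_res, hs]

/-- The affine frame of the sections of `ψ_{q,N}` given by an adapted frame. Its origin is the
section that maps the dual frame of `n` to `t`; its directions take values in `N^⊥`. -/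
def AdaptedFrame.dualFrame (A : AdaptedFrame q g) (hg : q.IsIsotropic g) :
    AffFrame (sheafHom (sheafHom N L) E) (dualSec q g) :=
  AffFrame.ofFintype A.U ((A.isFrame_n.sheafHom A.isFrame_l).lift fun p => A.t p.1)
    (fun k : Fin A.r × (Fin A.r ⊕ Fin A.m) => (A.isFrame_n.sheafHom A.isFrame_l).lift
      (Pi.single (k.1, ()) (Sum.elim (fun i => appₗ g A.U (A.n i)) A.w k.2))) (by
    classical
    intro V hV
    have hd := A.isFrame_n.sheafHom A.isFrame_l
    set F := fun c : Fin A.r × (Fin A.r ⊕ Fin A.m) → Γ(S, V) =>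
      res _ hV (hd.lift fun p => A.t p.1) + ∑ k, c k • res _ hV (hd.lift
        (Pi.single (k.1, ()) (Sum.elim (fun i => appₗ g A.U (A.n i)) A.w k.2))) with hF
    have ev_F : ∀ c i, ev V (F c) (res _ hV (A.isFrame_n.lift (Pi.single i (A.l ())))) =
        res E hV (A.t i) + (∑ j, c (i, Sum.inl j) • res E hV (appₗ g A.U (A.n j)) +
          ∑ j, c (i, Sum.inr j) • res E hV (A.w j)) := by
      intro c i
      have h1 : ∀ (b : Fin A.r × Unit → Γ(E, A.U)),
          ev V (res _ hV (hd.lift b)) (res _ hV (A.isFrame_n.lift (Pi.single i (A.l ())))) =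
            res E hV (b (i, ())) := by
        intro b
        rw [ev_res, hd.ev_lift_self b (i, ())]
      simp only [hF, map_add, map_sum, map_smul, LinearMap.add_apply, LinearMap.sum_apply,
        LinearMap.smul_apply, h1]
      rw [Fintype.sum_prod_type, Finset.sum_eq_single i, Fintype.sum_sum_type]
      · simp only [Pi.single_eq_same, Sum.elim_inl, Sum.elim_inr]
      · intro j _ hj
        refine Finset.sum_eq_zero fun k _ => ?_
        rw [Pi.single_eq_of_ne (by simpa using hj.symm), map_zero, smul_zero]
      · simp
    have psi_t : ∀ i, appₗ (q.psi g) V (res E hV (A.t i)) =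
        res _ hV (A.isFrame_n.lift (Pi.single i (A.l ()))) := by
      intro i
      rw [appₗ_res]
      congr 1
      refine A.isFrame_n.sheafHom_ext le_rfl fun j => ?_
      rw [res_self, ev_psi, A.b_t, A.isFrame_n.ev_lift_self]
    have psi_w : ∀ j, appₗ (q.psi g) V (res E hV (A.w j)) = 0 := by
      intro j
      rw [← A.perpι_perpSec, ← appₗ_res, AdaptedFrame.psi_perpι]
    have psi_n : ∀ j, appₗ (q.psi g) V (res E hV (appₗ g A.U (A.n j))) = 0 := by
      intro j
      rw [← appₗ_res, ← appₗ_comp, hg.comp_psi, appₗ_zero]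
    have indep : ∀ a b : Fin A.r ⊕ Fin A.m → Γ(S, V),
        ∑ j, a (Sum.inl j) • res E hV (appₗ g A.U (A.n j)) +
          ∑ j, a (Sum.inr j) • res E hV (A.w j) =
        ∑ j, b (Sum.inl j) • res E hV (appₗ g A.U (A.n j)) +
          ∑ j, b (Sum.inr j) • res E hV (A.w j) → a = b := by
      intro a b hab
      have h := @(A.isFrame V hV).1 (Sum.elim a 0) (Sum.elim b 0) (by
        simpa [Fintype.sum_sum_type] using hab)
      funext k
      exact congrFun h (Sum.inl k)
    refine ⟨fun c _ => ?_, fun c _ d _ hcd => ?_, fun s hs => ?_⟩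
    · refine (A.mem_dualSec_iff hV _).2 fun i => ?_
      rw [ev_F]
      simp only [map_add, map_sum, map_smul, psi_t, psi_w, psi_n, smul_zero, Finset.sum_const_zero,
        add_zero]
    · funext ⟨i, k⟩
      have h := congrArg (fun s => ev V s (res _ hV (A.isFrame_n.lift (Pi.single i (A.l ()))))) hcd
      simp only [ev_F, add_right_inj] at h
      exact congrFun (indep (fun k => c (i, k)) (fun k => d (i, k)) h) k
    · have h : ∀ i, ∃ c : Fin A.r ⊕ Fin A.m → Γ(S, V),
          ev V s (res _ hV (A.isFrame_n.lift (Pi.single i (A.l ())))) = res E hV (A.t i) +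
            (∑ j, c (Sum.inl j) • res E hV (appₗ g A.U (A.n j)) +
              ∑ j, c (Sum.inr j) • res E hV (A.w j)) := by
        intro i
        obtain ⟨a, c, hac⟩ := A.decomp_perp hg hV
          (ev V s (res _ hV (A.isFrame_n.lift (Pi.single i (A.l ())))) - res E hV (A.t i)) (by
            rw [map_sub, psi_t, (A.mem_dualSec_iff hV s).1 hs, sub_self])
        refine ⟨Sum.elim (A.isFrame_n.coord hV a) c, ?_⟩
        rw [sub_eq_iff_eq_add'] at hac
        rw [hac]
        congr 2
        conv_lhs => rw [← A.isFrame_n.sum_coord hV a]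
        simp only [map_sum, map_smul, appₗ_res, Sum.elim_inl]
      choose c hc using h
      refine ⟨fun k => c k.1 k.2, Set.mem_univ _, ?_⟩
      refine hd.sheafHom_ext hV fun p => ?_
      exact (ev_F _ _).trans (hc p.1).symm)

end

section

variable {E L N : S.Modules} {q : QuadForm E L} {g : N ⟶ E}

/-- The condition `β(v)(v) = q(v)` in terms of the Gram matrix of `β`. The equations off the diagonal
for `i < j` and the diagonal ones determine the polar form of `v ↦ β(v)(v)` on the frame. -/
lemma mem_bilinSec_iff {U : S.Opens} {p : ℕ} {e : Fin p → Γ(E, U)} (he : IsFrame E e) {V : S.Opens}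
    (hV : V ≤ U) (β : Γ(sheafHom E (sheafHom E L), V)) : β ∈ bilinSec q V ↔
      (∀ i, ev V (ev V β (res E hV (e i))) (res E hV (e i)) = q.app V (res E hV (e i))) ∧
      ∀ i j, i < j → ev V (ev V β (res E hV (e i))) (res E hV (e j)) +
        ev V (ev V β (res E hV (e j))) (res E hV (e i)) =
          q.b V (res E hV (e i)) (res E hV (e j)) := by
  constructor
  · intro h
    have h' : ∀ v, ev V (ev V β v) v = q.app V v := fun v => by
      have := h V le_rfl v
      rwa [res_self] at this
    refine ⟨fun i => h' _, fun i j _ => ?_⟩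
    have h3 := h' (res E hV (e i) + res E hV (e j))
    simp only [q.app_add, map_add, LinearMap.add_apply, h'] at h3
    have h4 : ∀ a b c d : Γ(L, V), a + b + (c + d) = a + d + q.b V (res E hV (e i)) (res E hV (e j)) →
        b + c = q.b V (res E hV (e i)) (res E hV (e j)) := by
      intro a b c d h
      have : a + d + (b + c) = a + d + q.b V (res E hV (e i)) (res E hV (e j)) := by
        rw [← h]; abel
      exact add_left_cancel this
    rw [add_comm]
    exact h4 _ _ _ _ h3
  · rintro ⟨h1, h2⟩ W hW v
    let Q : QuadraticMap Γ(S, W) Γ(E, W) Γ(L, W) := LinearMap.BilinMap.toQuadraticMap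
      ((ev (N := E) (L := L) W) ∘ₗ (ev W (res _ hW β))) - q.app W
    have hQ : ∀ v, Q v = ev W (ev W (res _ hW β) v) v - q.app W v := fun v => rfl
    have hpol : ∀ v w, QuadraticMap.polar Q v w = ev W (ev W (res _ hW β) v) w +
        ev W (ev W (res _ hW β) w) v - q.b W v w := by
      intro v w
      have := q.app_add W v w
      simp only [QuadraticMap.polar, hQ, map_add, LinearMap.add_apply, this]
      abel
    have hval : ∀ i j, ev W (ev W (res _ hW β) (res E (hW.trans hV) (e i))) (res E (hW.trans hV) (e j))
        = res L hW (ev V (ev V β (res E hV (e i))) (res E hV (e j))) := by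
      intro i j
      rw [← res_res E hV hW, ← res_res E hV hW, ev_res, ev_res]
    have hb : ∀ i j, q.b W (res E (hW.trans hV) (e i)) (res E (hW.trans hV) (e j)) =
        res L hW (q.b V (res E hV (e i)) (res E hV (e j))) := by
      intro i j
      rw [← res_res E hV hW, ← res_res E hV hW, q.b_res]
    have hq : ∀ i, q.app W (res E (hW.trans hV) (e i)) = res L hW (q.app V (res E hV (e i))) := by
      intro i
      rw [← res_res E hV hW, q.app_res]
    have hself : ∀ v, q.b V v v = q.app V v + q.app V v := by
      intro v
      have := q.app_add V v v
      rw [← two_smul Γ(S, V) v, QuadraticMap.map_smul] at this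
      have h4 : ((2 : Γ(S, V)) * 2) • q.app V v = q.app V v + q.app V v + (q.app V v + q.app V v) := by
        rw [mul_smul, two_smul, two_smul]
      rw [h4] at this
      exact (add_left_cancel this).symm
    rw [← sub_eq_zero, ← hQ, ← he.sum_coord (hW.trans hV) v]
    refine quadraticMap_sum_smul_eq_zero (fun i => ?_) (fun i j => ?_) _
    · rw [hQ, hval, h1, hq, sub_self]
    · rw [hpol, hval, hval, hb, ← map_add, sub_eq_zero]
      congr 1
      rcases lt_trichotomy i j with hij | rfl | hij
      · exact h2 i j hij
      · rw [h1, hself]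
      · rw [add_comm, h2 j i hij, q.b_comm]

/-- The affine frame of the bilinear forms `β` with `β(v)(v) = q(v)` given by a frame `e` of `E`. Its
origin is the upper triangular form, its directions are the elementary alternating forms. -/
lemma exists_bilinFrame {U : S.Opens} {p : ℕ} {e : Fin p → Γ(E, U)} (he : IsFrame E e)
    {l : Unit → Γ(L, U)} (hl : IsFrame L l) :
    ∃ σ : AffFrame (sheafHom E (sheafHom E L)) (bilinSec q), σ.U = U := by
  classical
  let s : Γ(sheafHom E (sheafHom E L), U) := he.lift fun i => he.lift fun j =>
    if i = j then q.app U (e i) else if i < j then q.b U (e i) (e j) else 0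
  let E₀ (a b : Fin p) : Γ(sheafHom E (sheafHom E L), U) :=
    he.lift (Pi.single a (he.lift (Pi.single b (l ()))))
  let ι := {k : Fin p × Fin p // k.1 < k.2}
  let h : ι → Γ(sheafHom E (sheafHom E L), U) := fun k => E₀ k.1.1 k.1.2 - E₀ k.1.2 k.1.1
  refine ⟨AffFrame.ofFintype U s h fun V hV => ?_, rfl⟩
  have ev_s : ∀ i j, ev V (ev V (res _ hV s) (res E hV (e i))) (res E hV (e j)) =
      if i = j then q.app V (res E hV (e i)) else
        if i < j then q.b V (res E hV (e i)) (res E hV (e j)) else 0 := by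
    intro i j
    rw [ev_res, ev_res, he.ev_lift_self, he.ev_lift_self, q.app_res, q.b_res]
    split_ifs <;> simp
  have ev_E₀ : ∀ a b i j, ev V (ev V (res _ hV (E₀ a b)) (res E hV (e i))) (res E hV (e j)) =
      if i = a ∧ j = b then res L hV (l ()) else 0 := by
    intro a b i j
    rw [ev_res, ev_res, he.ev_lift_self]
    by_cases hi : i = a
    · subst hi
      rw [Pi.single_eq_same, he.ev_lift_self]
      by_cases hj : j = b
      · subst hj
        rw [Pi.single_eq_same, if_pos ⟨rfl, rfl⟩]
      · rw [Pi.single_eq_of_ne hj, map_zero, if_neg fun h => hj h.2]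
    · rw [Pi.single_eq_of_ne hi, map_zero, LinearMap.zero_apply, map_zero, if_neg fun h => hi h.1]
  set F := fun c : ι → Γ(S, V) => res _ hV s + ∑ k, c k • res _ hV (h k) with hF
  have ev_F : ∀ c i j, ev V (ev V (F c) (res E hV (e i))) (res E hV (e j)) =
      (if i = j then q.app V (res E hV (e i)) else
        if i < j then q.b V (res E hV (e i)) (res E hV (e j)) else 0) +
      ∑ k : ι, c k • ((if i = k.1.1 ∧ j = k.1.2 then res L hV (l ()) else 0) -
        (if i = k.1.2 ∧ j = k.1.1 then res L hV (l ()) else 0)) := by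
    intro c i j
    simp only [hF, map_add, map_sum, map_smul, LinearMap.add_apply, LinearMap.sum_apply,
      LinearMap.smul_apply, h, map_sub, LinearMap.sub_apply, ev_s, ev_E₀]
  have ev_diag : ∀ c i, ev V (ev V (F c) (res E hV (e i))) (res E hV (e i)) =
      q.app V (res E hV (e i)) := by
    intro c i
    rw [ev_F, if_pos rfl, Finset.sum_eq_zero, add_zero]
    intro k _
    have hk := k.2
    rw [if_neg (fun h => hk.ne (h.1.symm.trans h.2)), if_neg (fun h => hk.ne (h.2.symm.trans h.1)),
      sub_self, smul_zero]
  have ev_lt : ∀ c i j (hij : i < j), ev V (ev V (F c) (res E hV (e i))) (res E hV (e j)) =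
      q.b V (res E hV (e i)) (res E hV (e j)) + c ⟨(i, j), hij⟩ • res L hV (l ()) := by
    intro c i j hij
    rw [ev_F, if_neg hij.ne, if_pos hij, Finset.sum_eq_single ⟨(i, j), hij⟩]
    · rw [if_pos ⟨rfl, rfl⟩, if_neg (fun h => hij.ne h.1), sub_zero]
    · intro k _ hk
      rw [if_neg (fun h => hk (Subtype.ext (Prod.ext h.1.symm h.2.symm))),
        if_neg (fun h => lt_asymm hij (by rw [h.1, h.2]; exact k.2)), sub_self, smul_zero]
    · simp
  have ev_gt : ∀ c i j (hij : i < j), ev V (ev V (F c) (res E hV (e j))) (res E hV (e i)) =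
      - (c ⟨(i, j), hij⟩ • res L hV (l ())) := by
    intro c i j hij
    rw [ev_F, if_neg hij.ne', if_neg hij.asymm, zero_add, Finset.sum_eq_single ⟨(i, j), hij⟩]
    · rw [if_neg (fun h => hij.ne' h.1), if_pos ⟨rfl, rfl⟩, zero_sub, smul_neg]
    · intro k _ hk
      rw [if_neg (fun h => lt_asymm hij (by rw [h.1, h.2]; exact k.2)),
        if_neg (fun h => hk (Subtype.ext (Prod.ext h.2.symm h.1.symm))), sub_self, smul_zero]
    · simp
  refine ⟨fun c _ => ?_, fun c _ d _ hcd => ?_, fun β hβ => ?_⟩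
  · refine (mem_bilinSec_iff he hV _).2 ⟨ev_diag c, fun i j hij => ?_⟩
    rw [ev_lt c i j hij, ev_gt c i j hij, add_neg_cancel_right]
  · funext ⟨⟨i, j⟩, hij⟩
    have h1 := congrArg (fun β => ev V (ev V β (res E hV (e i))) (res E hV (e j))) hcd
    change ev V (ev V (F c) _) _ = ev V (ev V (F d) _) _ at h1
    rw [ev_lt c i j hij, ev_lt d i j hij, add_right_inj] at h1
    exact congrFun (@(hl V hV).1 (fun _ => c ⟨(i, j), hij⟩) (fun _ => d ⟨(i, j), hij⟩)
      (by simpa using h1)) ()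
  · obtain ⟨h1, h2⟩ := (mem_bilinSec_iff he hV β).1 hβ
    let c : ι → Γ(S, V) := fun k => hl.coord hV (ev V (ev V β (res E hV (e k.1.1)))
      (res E hV (e k.1.2)) - q.b V (res E hV (e k.1.1)) (res E hV (e k.1.2))) ()
    have hc : ∀ k, c k • res L hV (l ()) = ev V (ev V β (res E hV (e k.1.1)))
      (res E hV (e k.1.2)) - q.b V (res E hV (e k.1.1)) (res E hV (e k.1.2)) := by
      intro k
      have := hl.sum_coord hV (ev V (ev V β (res E hV (e k.1.1)))
        (res E hV (e k.1.2)) - q.b V (res E hV (e k.1.1)) (res E hV (e k.1.2)))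
      rwa [Finset.univ_unique, Finset.sum_singleton] at this
    refine ⟨c, Set.mem_univ _, ?_⟩
    refine he.sheafHom_ext hV fun i => he.sheafHom_ext hV fun j => ?_
    rcases lt_trichotomy i j with hij | rfl | hij
    · rw [ev_lt c i j hij, hc, add_sub_cancel]
    · rw [ev_diag, h1]
    · rw [ev_gt c j i hij, hc, neg_sub, ← h2 j i hij, add_sub_cancel_left]

end

/-! ### Splitting over the affine bundle and over the covering -/

/-- The composition of a semilinear map with a morphism. -/
def SemiMap.precomp {T : Scheme.{u}} {f : T ⟶ S} {M₁ M : S.Modules} {M' : T.Modules}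
    (α : SemiMap f M M') (φ : M₁ ⟶ M) : SemiMap f M₁ M' where
  app U := (α.app U).comp (appₗ φ U).toAddMonoidHom
  app_smul U r x := by
    simp [α.app_smul]
  app_res h x := by
    change α.app _ (appₗ φ _ _) = _
    rw [appₗ_res, α.app_res]
    rfl

lemma SemiMap.ev_res_hom {T : Scheme.{u}} {f : T ⟶ S} {A B : S.Modules} {A' B' : T.Modules}
    (α : SemiMap f A A') (hα : α.IsFree) (β : SemiMap f B B') {U V : S.Opens} (h : V ≤ U)
    (s : Γ(sheafHom A B, U)) (a : Γ(A, V)) :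
    ev _ (res _ (pre_le f h) ((α.hom hα β).app U s)) (α.app V a) = β.app V (ev V (res _ h s) a) := by
  rw [← SemiMap.app_res, ev_hom]

section

variable {E L N : S.Modules} {q : QuadForm E L} {g : N ⟶ E} {T : Scheme.{u}} {f : T ⟶ S}

/-- The difference of two sections of `ψ_{q,N}` takes values in `N^⊥`. -/
lemma mem_dualSec_direction {U : S.Opens} {s h : Γ(sheafHom (sheafHom N L) E, U)}
    (hs : s ∈ dualSec q g U) (hh : s + h ∈ dualSec q g U) {V : S.Opens} (hV : V ≤ U)
    (n : Γ(sheafHom N L, V)) : appₗ (q.psi g) V (ev V (res _ hV h) n) = 0 := by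
  have h1 := hs V hV n
  have h2 := hh V hV n
  rw [map_add, map_add, LinearMap.add_apply, map_add, h1] at h2
  exact add_eq_left.1 h2

/-- The difference of two bilinear forms that define `q` is alternating. -/
lemma mem_bilinSec_direction {U : S.Opens} {s h : Γ(sheafHom E (sheafHom E L), U)}
    (hs : s ∈ bilinSec q U) (hh : s + h ∈ bilinSec q U) {V : S.Opens} (hV : V ≤ U)
    (v : Γ(E, V)) : ev V (ev V (res _ hV h) v) v = 0 := by
  have h1 := hs V hV v
  have h2 := hh V hV v
  rw [map_add, map_add, LinearMap.add_apply, map_add, LinearMap.add_apply, h1] at h2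
  exact add_eq_left.1 h2

/-- Pullback of sections of `Hom(Hom(N, L), E)`. -/
abbrev pullDual (f : T ⟶ S) (hN : IsVectorBundle N) (hL : IsLineBundle L) (E : S.Modules) :
    SemiMap f (sheafHom (sheafHom N L) E)
      (sheafHom (sheafHom ((Scheme.Modules.pullback f).obj N) ((Scheme.Modules.pullback f).obj L))
        ((Scheme.Modules.pullback f).obj E)) :=
  ((pullMap f N).hom (pullMap_isFree hN) (pullMap f L)).hom
    ((pullMap_isFree hN).hom (pullMap_isFree hL.isVectorBundle)) (pullMap f E)

/-- Pullback of `L`-valued bilinear forms on `E`. -/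
abbrev pullBilin (f : T ⟶ S) (hE : IsVectorBundle E) (L : S.Modules) :
    SemiMap f (sheafHom E (sheafHom E L))
      (sheafHom ((Scheme.Modules.pullback f).obj E) (sheafHom ((Scheme.Modules.pullback f).obj E)
        ((Scheme.Modules.pullback f).obj L))) :=
  (pullMap f E).hom (pullMap_isFree hE) ((pullMap f E).hom (pullMap_isFree hE) (pullMap f L))

/-- A form splits along `f` if over `T` there are global sections that are locally affine
combinations of pullbacks of sections of `ψ_{q,N}`, and of bilinear forms that define `q`. -/
theorem splitsAlong_of_locally [Mono g] (hE : IsVectorBundle E) (hL : IsLineBundle L)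
    (hN : IsVectorBundle N) (hiso : q.IsIsotropic g)
    (hA : ∀ x : S, ∃ A : AdaptedFrame q g, x ∈ A.U)
    (t₁ : Γ(sheafHom (sheafHom ((Scheme.Modules.pullback f).obj N) ((Scheme.Modules.pullback f).obj L))
      ((Scheme.Modules.pullback f).obj E), ⊤))
    (t₂ : Γ(sheafHom ((Scheme.Modules.pullback f).obj E) (sheafHom ((Scheme.Modules.pullback f).obj E)
      ((Scheme.Modules.pullback f).obj L)), ⊤))
    (h : ∀ y : T, ∃ (U : S.Opens) (_ : f y ∈ U) (n : ℕ)
      (s : Γ(sheafHom (sheafHom N L) E ⊞ sheafHom E (sheafHom E L), U))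
      (d : Fin n → Γ(sheafHom (sheafHom N L) E ⊞ sheafHom E (sheafHom E L), U))
      (x : Fin n → Γ(T, f ⁻¹ᵁ U)),
      s ∈ prodSet (dualSec q g) (bilinSec q) U ∧
      (∀ k, s + d k ∈ prodSet (dualSec q g) (bilinSec q) U) ∧
      res _ le_top t₁ = (pullDual f hN hL E).app U (appₗ biprod.fst U s) +
        ∑ k, x k • (pullDual f hN hL E).app U (appₗ biprod.fst U (d k)) ∧
      res _ le_top t₂ = (pullBilin f hE L).app U (appₗ biprod.snd U s) +
        ∑ k, x k • (pullBilin f hE L).app U (appₗ biprod.snd U (d k))) :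
    q.SplitsAlong hiso f := by
  have hβ : q.IsPullback f (QuadForm.ofBilin (ofGlobal t₂)) := by
    intro U v
    refine eq_of_locally _ _ _ fun y hy => ?_
    obtain ⟨W, hyW, n, s, d, x, hs, hd, -, h₂⟩ := h y
    refine ⟨f ⁻¹ᵁ (U ⊓ W), pre_le f inf_le_left, ⟨hy, hyW⟩, ?_⟩
    have hl : U ⊓ W ≤ U := inf_le_left
    have hr : U ⊓ W ≤ W := inf_le_right
    rw [← pullMap_app, ← pullMap_app, ← QuadForm.app_res, ← (pullMap f E).app_res hl,
      ← (pullMap f L).app_res hl, ← q.app_res, QuadForm.ofBilin_app, appₗ_ofGlobal,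
      ← res_res _ le_top (pre_le f hr), h₂]
    simp only [map_add, map_sum, res_smul, map_smul, LinearMap.add_apply, LinearMap.sum_apply,
      LinearMap.smul_apply, SemiMap.ev_res_hom _ _ _ hr, SemiMap.ev_hom]
    rw [hs.2 _ hr, Finset.sum_eq_zero, add_zero]
    intro k _
    rw [mem_bilinSec_direction hs.2 (by rw [← map_add]; exact (hd k).2) hr, map_zero, smul_zero]
  refine splitsAlong_of hL hN hiso hA (ofGlobal t₂) hβ (ofGlobal t₁) ?_
  refine ((pullMap_isFree hN).hom (pullMap_isFree hL.isVectorBundle)).hom_ext fun U a => ?_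
  refine eq_of_locally _ _ _ fun y hy => ?_
  obtain ⟨W, hyW, n, s, d, x, hs, hd, h₁, -⟩ := h y
  refine ⟨f ⁻¹ᵁ (U ⊓ W), pre_le f inf_le_left, ⟨hy, hyW⟩, ?_⟩
  have hl : U ⊓ W ≤ U := inf_le_left
  have hr : U ⊓ W ≤ W := inf_le_right
  rw [← appₗ_res, appₗ_id, appₗ_comp, ← SemiMap.app_res _ hl, appₗ_ofGlobal,
    ← res_res _ le_top (pre_le f hr), h₁]
  simp only [map_add, map_sum, res_smul, map_smul, LinearMap.add_apply, LinearMap.sum_apply,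
    LinearMap.smul_apply, SemiMap.ev_res_hom _ _ _ hr, hβ.psi g hN]
  rw [hs.1 _ hr, Finset.sum_eq_zero, add_zero]
  intro k _
  rw [mem_dualSec_direction hs.1 (by rw [← map_add]; exact (hd k).1) hr, map_zero, smul_zero]

end

section

variable {E L N : S.Modules} {q : QuadForm E L} {g : N ⟶ E}

/-- Pairs of a section of `ψ_{q,N}` and a bilinear form defining `q` have affine frames locally. -/
lemma covers_prodSet (hE : IsVectorBundle E) (hL : IsLineBundle L) (hiso : q.IsIsotropic g)
    (hA : ∀ x : S, ∃ A : AdaptedFrame q g, x ∈ A.U) :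
    AffFrame.Covers (sheafHom (sheafHom N L) E ⊞ sheafHom E (sheafHom E L))
      (prodSet (dualSec q g) (bilinSec q)) := by
  intro x
  obtain ⟨A, hxA⟩ := hA x
  obtain ⟨U, hxU, p, e, he⟩ := hE.exists_frame x
  obtain ⟨V, hxV, l, hl⟩ := hL.exists_frame x
  obtain ⟨τ, hτ⟩ := exists_bilinFrame (q := q) (he.restrict (inf_le_left : U ⊓ V ≤ U))
    (hl.restrict inf_le_right)
  refine ⟨(A.dualFrame hiso).prod τ, hxA, ?_⟩
  change x ∈ τ.U
  rw [hτ]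
  exact ⟨hxU, hxV⟩

/-- The form splits over the affine bundle, by means of the tautological pair. -/
lemma splitsAlong_toBase [Mono g] (hE : IsVectorBundle E) (hL : IsLineBundle L)
    (hN : IsVectorBundle N) (hiso : q.IsIsotropic g)
    (hA : ∀ x : S, ∃ A : AdaptedFrame q g, x ∈ A.U) :
    q.SplitsAlong hiso (AffFrame.toBase (covers_prodSet hE hL hiso hA)) := by
  set hX := covers_prodSet hE hL hiso hA
  set f := AffFrame.toBase hX
  obtain ⟨t₁, ht₁⟩ := AffFrame.exists_tautSection (hX := hX) ((pullDual _ hN hL E).precomp biprod.fst)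
  obtain ⟨t₂, ht₂⟩ := AffFrame.exists_tautSection (hX := hX) ((pullBilin _ hE L).precomp biprod.snd)
  refine splitsAlong_of_locally hE hL hN hiso hA t₁ t₂ fun y => ?_
  obtain ⟨σ, hσ⟩ := hX (f y)
  exact ⟨σ.U, hσ, σ.n, σ.s, σ.h, AffFrame.tautCoord hX σ, σ.s_mem, σ.s_add_mem, ht₁ σ, ht₂ σ⟩

/-- The form splits over the domain of an affine frame, by means of the origin of the frame. -/
lemma splitsAlong_ι [Mono g] (hE : IsVectorBundle E) (hL : IsLineBundle L)
    (hN : IsVectorBundle N) (hiso : q.IsIsotropic g)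
    (hA : ∀ x : S, ∃ A : AdaptedFrame q g, x ∈ A.U)
    (σ : AffFrame (sheafHom (sheafHom N L) E ⊞ sheafHom E (sheafHom E L))
      (prodSet (dualSec q g) (bilinSec q))) : q.SplitsAlong hiso σ.U.ι := by
  have hU : (⊤ : σ.U.toScheme.Opens) ≤ σ.U.ι ⁻¹ᵁ σ.U := fun y _ => y.2
  refine splitsAlong_of_locally hE hL hN hiso hA
    (res _ hU ((pullDual _ hN hL E).app σ.U (appₗ biprod.fst σ.U σ.s)))
    (res _ hU ((pullBilin _ hE L).app σ.U (appₗ biprod.snd σ.U σ.s)))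
    fun y => ⟨σ.U, y.2, 0, σ.s, (Fin.elim0 ·), (Fin.elim0 ·), σ.s_mem, fun k => k.elim0, ?_, ?_⟩
  · rw [res_res, res_self, Finset.univ_eq_empty, Finset.sum_empty, add_zero]
  · rw [res_res, res_self, Finset.univ_eq_empty, Finset.sum_empty, add_zero]

end

end SplitPrinciple
end

open SplitPrinciple

theorem mainTheorem5 {S : Scheme.{u}} {E L N : S.Modules} (hE : IsVectorBundle E)
    (hL : IsLineBundle L) (q : QuadForm E L) (hq : q.IsGenericallySemiregular)
    (g : N ⟶ E) [Mono g] (hN : IsVectorBundle N) (hg : IsVectorBundle (cokernel g))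
    (hiso : q.IsIsotropic g) (hreg : q.IsRegularSubbundle g) :
    IsVectorBundle hiso.reducedModule ∧
    (∃ (V : Scheme.{u}) (p : V ⟶ S), IsAffineBundle p ∧ q.SplitsAlong hiso p) ∧
    (∃ (I : Type u) (U : I → S.Opens), iSup U = ⊤ ∧ ∀ i, q.SplitsAlong hiso (U i).ι) := by
  have hA := exists_adaptedFrame hE hL hN hiso hreg
  have hX := covers_prodSet hE hL hiso hA
  refine ⟨fun x => ?_, ⟨AffFrame.total hX, AffFrame.toBase hX, AffFrame.isAffineBundle_toBase hX,
    splitsAlong_toBase hE hL hN hiso hA⟩, ?_⟩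
  · obtain ⟨A, hxA⟩ := hA x
    exact ⟨A.U, hxA, A.m, _, A.isFrame_reduced hiso⟩
  · choose σ hσ using hX
    exact ⟨S, fun x => (σ x).U, eq_top_iff.2 fun x _ => Opens.mem_iSup.2 ⟨x, hσ x⟩,
      fun x => splitsAlong_ι hE hL hN hiso hA (σ x)⟩
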